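/- **Setting.** Let $(X,g_0)$ be a smooth $d$-dimensional Riemannian manifold and $\Gamma$ a group acting freely, properly discontinuously and cocompactly on $X$ by isometries of $g_0$. Let $(\Omega,\mathbb P)$ be a probability space on which $\Gamma$ acts ergodically by measure preserving maps. Let $(g_\omega)_{\omega\in\Omega}$ be smooth Riemannian metrics on $X$ such that $(\omega,v)\mapsto g_\omega(v,v)$ is measurable on $\Omega\times TX$, each $\gamma\colon (X,g_\omega)\to(X,g_{\gamma\omega})$ is an isometry, and the family is relatively bounded with respect to $g_0$: writing $g_\omega(v,v)=g_0(A_\omega v,v)$ with $A_\omega$ symmetric with respect to $g_0$, there are constants $C_k>0$, $k\ge 0$, with $C_0^{-1}g_0(v,v)\le g_\omega(v,v)\le C_0\,g_0(v,v)$ for all $v\in TX$ and $|\nabla_0^kA_\omega(x)|_0\le C_k$ for all $k$, $x$, $\omega$ (covariant derivatives and norms with respect to $g_0$). Let $V\colon\Omega\times X\to[0,\infty)$ be measurable with $V(\gamma\omega,x)=V(\omega,\gamma^{-1}x)$ and such that each $V_\omega=V(\omega,\cdot)$ is relatively $\Delta_\omega$-bounded with relative bound $<1$, where $\Delta_\omega=\mathrm{div}_\omega\,\mathrm{grad}_\omega\le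 0$ is the Laplacian of $g_\omega$. Let $\mathcal F$ be a relatively compact fundamental domain of $\Gamma$, $r>0$, and let $\Lambda(I)\subset X$, $I\subset\Gamma$, be open sets with $\Lambda(\gamma I)=\gamma\Lambda(I)$ and $\Lambda_0(I)\subset\overline{\Lambda(I)}$, $\Lambda(I)\subset B_r(\Lambda_0(I))$, where $\Lambda_0(I)=\bigcup_{\gamma\in I}\gamma\overline{\mathcal F}$ and $B_r$ is the open $r$-neighbourhood with respect to $g_0$ (for instance smoothed agglomerates). Let $H=H_\omega^I$ be $-\Delta_\omega+V_\omega$ with Dirichlet boundary conditions in $L^2(\Lambda(I),g_\omega)$, i.e. the operator of the closure of the quadratic form $\int_{\Lambda(I)}(|\mathrm{grad}_\omega u|^2+V_\omega|u|^2)\,d\mathrm{vol}_\omega$ on $C_c^\infty(\Lambda(I))$, and put $R=(H+1)^{-1}$. Let $(\psi_\beta)_{\beta=1}^{n}$ be a finite smooth partition of unity on $X/\Gamma$ and, for each $\beta$, let $X_{1,\beta},\dots,X_{d,\beta}$ be smooth vector fields on $X/\Gamma$ that are $g_0$-orthonormal on $\mathrm{supp}\,\psi_\beta$; denote their periodic lifts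 to $X$ by the same symbols. Put $\mathrm{div}_{i,\beta}h=\mathrm{div}_\omega(h\,\psi_\beta X_{i,\beta})$ (in the weak sense), $D^{(1)}h=\Delta_\omega h$, $D^{(2,i,\beta)}h=-2g_0(\mathrm{grad}_\omega h,X_{i,\beta})$, $D^{(3,i,\beta)}=D^{(1)}D^{(2,i,\beta)}$, $D^{(4,i,\beta,j,\mu)}=D^{(2,j,\mu)}D^{(2,i,\beta)}$, and $$\mathcal D=\{\mathrm{Id},D^{(1)},D^{(2,i,\beta)},D^{(3,i,\beta)},D^{(4,i,\beta,j,\mu)}\},\qquad \mathcal B=\{\mathrm{Id},R,\mathrm{div}_{i,\beta}R,\mathrm{div}_{i,\beta}R\,\mathrm{div}_{j,\mu}\},$$ where $\mathrm{div}_{i,\beta}R\,\mathrm{div}_{j,\mu}$ stands for its bounded extension from the domain of $\mathrm{div}_{j,\mu}$ to $L^2(\Lambda(I),g_\omega)$. Functions also denote the corresponding multiplication operators. **Theorem.** There is a constant $\hat C_2$, and for every integer $\nu\ge1$ there is a number $N_\nu$, such that the following holds. Let $f,F\in C_c^\infty(X)$ (complex valued) with $F=1$ on $\mathrm{supp}\,f$.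 For all $\omega\in\Omega$ and $I\subset\Gamma$, the operator $R=(H_\omega^I+1)^{-1}$ exists as a bounded operator on $L^2(\Lambda(I),g_\omega)$ and $$fR^\nu=\sum_{i=1}^{N_\nu}(f_{i1}RB_{i1})\cdots(f_{i\nu}RB_{i\nu}),$$ where $f_{ij}=F$ for $j<\nu$; $f_{i\nu}=Df$ with $D$ a composition of $\nu-1$ operators of $\mathcal D$; and each $B_{ij}$ is a bounded operator of the form $BR^l$ with $B\in\mathcal B$ and $0\le l\le\nu-1$. The choice of the operators of $\mathcal D$ and $\mathcal B$ and of the exponents $l$ in this formula (as formal expressions) depends only on $\nu$ and $(i,j)$. Moreover: * there is a constant $\hat C_1(\nu)$, depending on $\nu,f,F$ but not on $\omega$ and $I$, with $\|f_{ij}\|_\infty\le\hat C_1(\nu)$, and the same constant works when $f,F$ are replaced by $f\circ\gamma^{-1},F\circ\gamma^{-1}$ for any $\gamma\in\Gamma$; * $\|B_{ij}\|\le\hat C_2$, where $\hat C_2$ does not depend on $\nu,\omega,I,f,F$ or on translates of $f,F$. -/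

import Mathlib

open MeasureTheory Filter Topology Bundle
open scoped Manifold Pointwise ENNReal

namespace RandomSchroedinger

/-- The model space `ℝ^d`. -/
abbrev Coord (d : ℕ) : Type := EuclideanSpace ℝ (Fin d)

/-- The tangent space at `x` of a manifold modelled on `ℝ^d`. -/
abbrev Tan (d : ℕ) {X : Type*} [TopologicalSpace X] [ChartedSpace (Coord d) X] (x : X) : Type :=
  TangentSpace 𝓘(ℝ, Coord d) x

/-- Smooth Riemannian metrics on `X`. -/
abbrev SmoothMetric (d : ℕ) (X : Type*) [TopologicalSpace X] [ChartedSpace (Coord d) X]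
    [IsManifold 𝓘(ℝ, Coord d) (⊤ : ℕ∞) X] :=
  ContMDiffRiemannianMetric 𝓘(ℝ, Coord d) (⊤ : ℕ∞) (Coord d)
    (fun x : X => TangentSpace 𝓘(ℝ, Coord d) x)

section Geometry

variable {d : ℕ} {X : Type*} [TopologicalSpace X] [ChartedSpace (Coord d) X]

/-- `∂ h / ∂ y_i` for a function of the coordinates. -/
noncomputable def pderiv (i : Fin d) (h : Coord d → ℝ) (y : Coord d) : ℝ :=
  fderiv ℝ h y (EuclideanSpace.single i 1)

/-- The coordinate vector field `∂_i` of the chart at `x₀`, at the point with coordinates `y`. -/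
noncomputable def coordVec (x₀ : X) (i : Fin d) (y : Coord d) :
    Tan d ((chartAt (Coord d) x₀).symm y) :=
  mfderiv 𝓘(ℝ, Coord d) 𝓘(ℝ, Coord d) (chartAt (Coord d) x₀).symm y
    (EuclideanSpace.single i (1 : ℝ) : Coord d)

/-- The `a`-th component, in the chart at `x₀`, of a tangent vector `v` at `p`. -/
noncomputable def coordComp (x₀ : X) (a : Fin d) (p : X) (v : Tan d p) : ℝ :=
  let c : Coord d := mfderiv 𝓘(ℝ, Coord d) 𝓘(ℝ, Coord d) (chartAt (Coord d) x₀) p v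
  c a

/-- `u ∈ C_c^∞(U)`: a smooth function on `X` whose support is a compact subset of `U`. -/
structure IsTest (d : ℕ) {X : Type*} [TopologicalSpace X] [ChartedSpace (Coord d) X]
    {W : Type*} [NormedAddCommGroup W] [NormedSpace ℝ W] (U : Set X) (u : X → W) : Prop where
  smooth : ContMDiff 𝓘(ℝ, Coord d) 𝓘(ℝ, W) (⊤ : ℕ∞) u
  compact : HasCompactSupport u
  subset : tsupport u ⊆ U

/-- Complex linear extension of an operator on real functions. -/
noncomputable def complexify (D : (X → ℝ) → (X → ℝ)) (h : X → ℂ) : X → ℂ :=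
  fun x => (D (fun z => (h z).re) x : ℂ) + Complex.I * (D (fun z => (h z).im) x : ℂ)

variable [IsManifold 𝓘(ℝ, Coord d) (⊤ : ℕ∞) X]

/-- The matrix `g_ij` in the chart at `x₀`. -/
noncomputable def gram (g : SmoothMetric d X) (x₀ : X) (y : Coord d) : Matrix (Fin d) (Fin d) ℝ :=
  Matrix.of fun i j =>
    g.inner ((chartAt (Coord d) x₀).symm y) (coordVec x₀ i y) (coordVec x₀ j y)

/-- The density `(det g_ij)^{1/2}` in the chart at `x₀`. -/
noncomputable def density (g : SmoothMetric d X) (x₀ : X) (y : Coord d) : ℝ :=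
  Real.sqrt (gram g x₀ y).det

/-- The Riemannian volume of the domain of the chart at `x₀`, as a measure on `X` that vanishes
off this domain: the push-forward of `(det g_ij)^{1/2} dy` under the inverse chart. -/
noncomputable def chartVol [MeasurableSpace X] (g : SmoothMetric d X) (x₀ : X) : Measure X :=
  ((volume.restrict (chartAt (Coord d) x₀).target).withDensity
    (fun y => ENNReal.ofReal (density g x₀ y))).map (chartAt (Coord d) x₀).symm

/-- The Riemannian volume measure: the least measure that dominates the volumes of all chart
domains. The volumes of two chart domains agree on the intersection of these domains, so that
on each chart domain this measure is the volume of that domain. -/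
noncomputable def vol [MeasurableSpace X] (g : SmoothMetric d X) : Measure X :=
  ⨆ x₀ : X, chartVol g x₀

/-- The gradient: `g(grad h, v) = dh(v)` for all `v`. -/
noncomputable def grad (g : SmoothMetric d X) (h : X → ℝ) (x : X) : Tan d x :=
  (g.inner x).inverse (mfderiv 𝓘(ℝ, Coord d) 𝓘(ℝ, ℝ) h x)

/-- The divergence `(det g)^{-1/2} ∑_i ∂_i ((det g)^{1/2} Z^i)` of a vector field, computed at `x`
in the chart at `x`. -/
noncomputable def divg (g : SmoothMetric d X) (Z : (x : X) → Tan d x) (x : X) : ℝ :=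
  (density g x (chartAt (Coord d) x x))⁻¹ *
    ∑ i : Fin d, pderiv i
      (fun y => density g x y *
        coordComp x i ((chartAt (Coord d) x).symm y) (Z ((chartAt (Coord d) x).symm y)))
      (chartAt (Coord d) x x)

/-- The non-positive Laplace operator `Δ = div grad`. -/
noncomputable def laplacian (g : SmoothMetric d X) (h : X → ℝ) : X → ℝ :=
  divg g (grad g h)

/-- Riemannian distance, with value `∞` between different components. -/
noncomputable def riemDist (g : SmoothMetric d X) (x y : X) : ℝ≥0∞ :=
  letI : RiemannianBundle (fun x : X => TangentSpace 𝓘(ℝ, Coord d) x) := ⟨g.toRiemannianMetric⟩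
  Manifold.riemannianEDist 𝓘(ℝ, Coord d) x y

/-- The open `r`-neighbourhood of `S`. -/
def riemNhd (g : SmoothMetric d X) (r : ℝ) (S : Set X) : Set X :=
  {x | ∃ y ∈ S, riemDist g y x < ENNReal.ofReal r}

/-! ### Iterated covariant derivatives of endomorphism fields -/

/-- The Christoffel symbol `Γ^a_{bc}` in the chart at `x₀`. -/
noncomputable def christoffel (g : SmoothMetric d X) (x₀ : X) (a b c : Fin d) (y : Coord d) : ℝ :=
  (1 / 2) * ∑ e : Fin d, (gram g x₀ y)⁻¹ a e *
    (pderiv b (fun z => gram g x₀ z e c) y + pderiv c (fun z => gram g x₀ z e b) y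
      - pderiv e (fun z => gram g x₀ z b c) y)

/-- Components `T^a_{b_1 … b_n}`, in a chart, of a tensor field with one upper and `n` lower
indices. -/
abbrev TensorComp (d n : ℕ) : Type := Fin d → (Fin n → Fin d) → Coord d → ℝ

/-- The covariant derivative in coordinates; the new lower index is the first one. -/
noncomputable def covDeriv (g : SmoothMetric d X) (x₀ : X) {n : ℕ} (T : TensorComp d n) :
    TensorComp d (n + 1) :=
  fun a b y =>
    pderiv (b 0) (T a (Fin.tail b)) y
      + ∑ e : Fin d, christoffel g x₀ a (b 0) e y * T e (Fin.tail b) y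
      - ∑ i : Fin n, ∑ e : Fin d,
          christoffel g x₀ e (b 0) (Fin.tail b i) y * T a (Function.update (Fin.tail b) i e) y

/-- Components, in the chart at `x₀`, of a field of endomorphisms of the tangent spaces. -/
noncomputable def endoComp (x₀ : X) (A : (x : X) → (Tan d x →L[ℝ] Tan d x)) : TensorComp d 1 :=
  fun a b y =>
    coordComp x₀ a ((chartAt (Coord d) x₀).symm y)
      (A ((chartAt (Coord d) x₀).symm y) (coordVec x₀ (b 0) y))

/-- Components of `∇^k A` in the chart at `x₀`. -/
noncomputable def iterCovDeriv (g : SmoothMetric d X) (x₀ : X)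
    (A : (x : X) → (Tan d x →L[ℝ] Tan d x)) : (k : ℕ) → TensorComp d (k + 1)
  | 0 => endoComp x₀ A
  | k + 1 => covDeriv g x₀ (iterCovDeriv g x₀ A k)

/-- The square of the pointwise norm of a tensor, at the point with coordinates `y`. -/
noncomputable def tensorNormSq (g : SmoothMetric d X) (x₀ : X) {n : ℕ} (T : TensorComp d n)
    (y : Coord d) : ℝ :=
  ∑ a : Fin d, ∑ a' : Fin d, ∑ b : Fin n → Fin d, ∑ b' : Fin n → Fin d,
    gram g x₀ y a a' * (∏ i : Fin n, (gram g x₀ y)⁻¹ (b i) (b' i)) * T a b y * T a' b' y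

/-- `|∇_g^k A|_g` at `x`. -/
noncomputable def covDerivNorm (g : SmoothMetric d X) (A : (x : X) → (Tan d x →L[ℝ] Tan d x))
    (k : ℕ) (x : X) : ℝ :=
  Real.sqrt (tensorNormSq g x (iterCovDeriv g x A k) (chartAt (Coord d) x x))

/-- The endomorphism `A` with `g(v, w) = g₀(A v, w)`. -/
noncomputable def relEndo (g₀ g : SmoothMetric d X) (x : X) : Tan d x →L[ℝ] Tan d x :=
  (g₀.inner x).inverse.comp (g.inner x)

/-- `φ : (X, g) → (X, g')` is smooth and preserves the metric. -/
structure IsMetricMap (g g' : SmoothMetric d X) (φ : X → X) : Prop where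
  smooth : ContMDiff 𝓘(ℝ, Coord d) 𝓘(ℝ, Coord d) (⊤ : ℕ∞) φ
  isometric : ∀ (x : X) (v w : Tan d x),
    g'.inner (φ x) (mfderiv 𝓘(ℝ, Coord d) 𝓘(ℝ, Coord d) φ x v)
      (mfderiv 𝓘(ℝ, Coord d) 𝓘(ℝ, Coord d) φ x w) = g.inner x v w

/-- The family `g_ω` is relatively bounded with respect to `g₀`. -/
def RelativelyBounded {Ω : Type*} (g₀ : SmoothMetric d X) (g : Ω → SmoothMetric d X) : Prop :=
  ∃ C : ℕ → ℝ, (∀ k, 0 < C k) ∧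
    (∀ (ω : Ω) (x : X) (v : Tan d x),
      (C 0)⁻¹ * g₀.inner x v v ≤ (g ω).inner x v v ∧
      (g ω).inner x v v ≤ C 0 * g₀.inner x v v) ∧
    ∀ (k : ℕ) (ω : Ω) (x : X), covDerivNorm g₀ (relEndo g₀ (g ω)) k x ≤ C k

/-- `V` is relatively `Δ_g`-bounded with relative bound less than one; the inequality is required
on the core `C_c^∞(X)` of the Laplace operator. -/
def RelLaplaceBounded [MeasurableSpace X] (g : SmoothMetric d X) (V : X → ℝ) : Prop :=
  ∃ a b : ℝ, 0 ≤ a ∧ a < 1 ∧ 0 ≤ b ∧ ∀ u : X → ℝ, IsTest d Set.univ u →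
    eLpNorm (fun x => V x * u x) 2 (vol g) ≤
      ENNReal.ofReal a * eLpNorm (laplacian g u) 2 (vol g) + ENNReal.ofReal b * eLpNorm u 2 (vol g)

/-- The covering: a group `Γ` acts freely on `X` by isometries of `g₀`. That the action is properly
discontinuous and cocompact is expressed by type classes. -/
structure PeriodicAction (Γ : Type*) [Group Γ] [MulAction Γ X] (g₀ : SmoothMetric d X) :
    Prop where
  free : ∀ (γ : Γ) (x : X), γ • x = x → γ = 1
  isometric : ∀ γ : Γ, IsMetricMap g₀ g₀ (fun x => γ • x)

/-- The standing assumptions on the random metrics `g_ω` and the random potentials `V_ω`. -/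
structure RandomFamily (Γ : Type*) [Group Γ] [MulAction Γ X] [MeasurableSpace X]
    {Ω : Type*} [MeasurableSpace Ω] [MulAction Γ Ω]
    (g₀ : SmoothMetric d X) (g : Ω → SmoothMetric d X) (V : Ω → X → ℝ) : Prop where
  metric_measurable :
    letI : MeasurableSpace (TangentBundle 𝓘(ℝ, Coord d) X) := borel _
    Measurable fun p : Ω × TangentBundle 𝓘(ℝ, Coord d) X => (g p.1).inner p.2.proj p.2.2 p.2.2
  relatively_bounded : RelativelyBounded g₀ g
  compatible : ∀ (γ : Γ) (ω : Ω), IsMetricMap (g ω) (g (γ • ω)) (fun x => γ • x)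
  potential_nonneg : ∀ ω x, 0 ≤ V ω x
  potential_measurable : Measurable fun p : Ω × X => V p.1 p.2
  potential_bounded : ∀ ω, RelLaplaceBounded (g ω) (V ω)
  potential_equivariant : ∀ (γ : Γ) (ω : Ω) (x : X), V (γ • ω) x = V ω (γ⁻¹ • x)

/-- A fundamental domain and (the interiors of) smoothed agglomerates `Λ(I)`, `I ⊆ Γ`, of its
translates. No regularity of the boundary of `Λ(I)` is required. -/
structure Agglomerates (Γ : Type*) [Group Γ] [MulAction Γ X] [MeasurableSpace X]
    (g₀ : SmoothMetric d X) where
  domain : Set X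
  isFundamental : IsFundamentalDomain Γ domain (vol g₀)
  relCompact : IsCompact (closure domain)
  Λ : Set Γ → Set X
  isOpen : ∀ I, IsOpen (Λ I)
  equivariant : ∀ (γ : Γ) (I : Set Γ), Λ (γ • I) = γ • Λ I
  radius : ℝ
  radius_pos : 0 < radius
  core_subset : ∀ I : Set Γ, (⋃ γ ∈ I, γ • closure domain) ⊆ closure (Λ I)
  subset_nhd : ∀ I : Set Γ, Λ I ⊆ riemNhd g₀ radius (⋃ γ ∈ I, γ • closure domain)

/-- The lifts to `X` of a finite smooth partition of unity `ψ_β` on `X / Γ` and of smooth vector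
fields `X_{1,β}, …, X_{d,β}` on `X / Γ` that are `g₀`-orthonormal on the support of `ψ_β`. -/
structure PeriodicFrame (Γ : Type*) [Group Γ] [MulAction Γ X] (g₀ : SmoothMetric d X) where
  n : ℕ
  ψ : Fin n → X → ℝ
  ψ_smooth : ∀ β, ContMDiff 𝓘(ℝ, Coord d) 𝓘(ℝ, ℝ) (⊤ : ℕ∞) (ψ β)
  ψ_nonneg : ∀ β x, 0 ≤ ψ β x
  ψ_sum : ∀ x, ∑ β, ψ β x = 1
  ψ_periodic : ∀ β (γ : Γ) x, ψ β (γ • x) = ψ β x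
  vec : Fin d → Fin n → (x : X) → Tan d x
  vec_smooth : ∀ i β, ContMDiff 𝓘(ℝ, Coord d) (𝓘(ℝ, Coord d)).tangent (⊤ : ℕ∞)
    (fun x => (⟨x, vec i β x⟩ : TangentBundle 𝓘(ℝ, Coord d) X))
  vec_periodic : ∀ i β (γ : Γ) x,
    mfderiv 𝓘(ℝ, Coord d) 𝓘(ℝ, Coord d) (fun z : X => γ • z) x (vec i β x) = vec i β (γ • x)
  orthonormal : ∀ β, ∀ x ∈ tsupport (ψ β), ∀ i j,
    g₀.inner x (vec i β x) (vec j β x) = if i = j then 1 else 0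

/-! ### The Dirichlet operator and its resolvent -/

/-- The sesquilinear extension of `g(grad u, grad v)` to complex valued functions, antilinear in
`v`. -/
noncomputable def gradInner (g : SmoothMetric d X) (u v : X → ℂ) (x : X) : ℂ :=
  let G : (X → ℝ) → (X → ℝ) → ℝ := fun p q => g.inner x (grad g p x) (grad g q x)
  ((G (fun z => (u z).re) (fun z => (v z).re) + G (fun z => (u z).im) (fun z => (v z).im) : ℝ) : ℂ)
    + Complex.I * ((G (fun z => (u z).im) (fun z => (v z).re)
      - G (fun z => (u z).re) (fun z => (v z).im) : ℝ) : ℂ)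

/-- The quadratic form of `-Δ_g + V` on `C_c^∞(Λ)`, polarized. -/
noncomputable def energyForm [MeasurableSpace X] (g : SmoothMetric d X) (V : X → ℝ) (Λ : Set X)
    (u v : X → ℂ) : ℂ :=
  ∫ x in Λ, (gradInner g u v x + (V x : ℂ) * u x * starRingEnd ℂ (v x)) ∂(vol g)

/-- The Hilbert space `L²(Λ, g)`. -/
abbrev L2 [MeasurableSpace X] (g : SmoothMetric d X) (Λ : Set X) : Type _ :=
  Lp ℂ 2 ((vol g).restrict Λ)

/-- `u ∈ dom H` and `H u = w`, where `H` is the self-adjoint operator in `L²(Λ, g)` that belongs to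
the closure of the form of `-Δ_g + V` on `C_c^∞(Λ)`: the function `u` is a limit in `L²` of a
form-Cauchy sequence `φ_n` in `C_c^∞(Λ)`, and the closed form satisfies
`q(u, v) = lim q(φ_n, v) = ⟨w, v⟩` for all `v` in the form core `C_c^∞(Λ)`. -/
def DirichletOp [MeasurableSpace X] (g : SmoothMetric d X) (V : X → ℝ) (Λ : Set X)
    (u w : L2 g Λ) : Prop :=
  ∃ φ : ℕ → X → ℂ, (∀ n, IsTest d Λ (φ n)) ∧
    Tendsto (fun n => eLpNorm (fun x => φ n x - u x) 2 ((vol g).restrict Λ)) atTop (𝓝 0) ∧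
    Tendsto (fun p : ℕ × ℕ => energyForm g V Λ (φ p.1 - φ p.2) (φ p.1 - φ p.2)) atTop (𝓝 0) ∧
    ∀ v : X → ℂ, IsTest d Λ v →
      Tendsto (fun n => energyForm g V Λ (φ n) v) atTop
        (𝓝 (∫ x in Λ, w x * starRingEnd ℂ (v x) ∂(vol g)))

/-- `R = (H + 1)^{-1}` as an everywhere defined bounded operator: `R h = u` if and only if
`u ∈ dom H` and `H u + u = h`. -/
def IsResolvent [MeasurableSpace X] (g : SmoothMetric d X) (V : X → ℝ) (Λ : Set X)
    (R : L2 g Λ →L[ℂ] L2 g Λ) : Prop :=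
  ∀ h u : L2 g Λ, R h = u ↔ DirichletOp g V Λ u (h - u)

open Classical in
/-- The operator of multiplication by a bounded measurable function. -/
noncomputable def mulOp [MeasurableSpace X] (g : SmoothMetric d X) (Λ : Set X) (h : X → ℂ) :
    L2 g Λ →L[ℂ] L2 g Λ :=
  if hh : MemLp h ⊤ ((vol g).restrict Λ) then
    (ContinuousLinearMap.mul ℂ ℂ).holderL ((vol g).restrict Λ) ⊤ 2 2 (hh.toLp h)
  else 0

/-- `w = div (h Z)` on `Λ` in the weak sense, for a real vector field `Z`. -/
def IsWeakDiv [MeasurableSpace X] (g : SmoothMetric d X) (Λ : Set X) (Z : (x : X) → Tan d x)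
    (h w : L2 g Λ) : Prop :=
  ∀ v : X → ℝ, IsTest d Λ v →
    ∫ x in Λ, w x * (v x : ℂ) ∂(vol g) =
      - ∫ x in Λ, h x * ((g.inner x (Z x) (grad g v x) : ℝ) : ℂ) ∂(vol g)

/-! ### The sets `𝓓` and `𝓑` of operators -/

/-- Labels of the elements of `𝓓`. -/
inductive DLabel (d n : ℕ) : Type
  | id : DLabel d n
  | D1 : DLabel d n
  | D2 (i : Fin d) (β : Fin n) : DLabel d n
  | D3 (i : Fin d) (β : Fin n) : DLabel d n
  | D4 (i : Fin d) (β : Fin n) (j : Fin d) (μ : Fin n) : DLabel d n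

/-- Labels of the elements of `𝓑`. -/
inductive BLabel (d n : ℕ) : Type
  | id : BLabel d n
  | R : BLabel d n
  | divR (i : Fin d) (β : Fin n) : BLabel d n
  | divRdiv (i : Fin d) (β : Fin n) (j : Fin d) (μ : Fin n) : BLabel d n

variable {Γ : Type*} [Group Γ] [MulAction Γ X] {g₀ : SmoothMetric d X}

namespace PeriodicFrame

variable (P : PeriodicFrame Γ g₀)

/-- The vector field `ψ_β X_{i,β}`, so that `div_{i,β} h = div (h ψ_β X_{i,β})`. -/
noncomputable def cut (i : Fin d) (β : Fin P.n) (x : X) : Tan d x := P.ψ β x • P.vec i β x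

/-- `D^{(1)} h = Δ h`. -/
noncomputable def opD1 (_P : PeriodicFrame Γ g₀) (g : SmoothMetric d X) : (X → ℂ) → X → ℂ :=
  complexify (laplacian g)

/-- `D^{(2,i,β)} h = -2 g₀(grad h, X_{i,β})`, the gradient being that of `g`. -/
noncomputable def opD2 (g : SmoothMetric d X) (i : Fin d) (β : Fin P.n) : (X → ℂ) → X → ℂ :=
  complexify fun h x => -2 * g₀.inner x (grad g h x) (P.vec i β x)

/-- The differential operators `Id`, `D^{(1)}`, `D^{(2,i,β)}`, `D^{(3,i,β)} = D^{(1)} D^{(2,i,β)}`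
and `D^{(4,i,β,j,μ)} = D^{(2,j,μ)} D^{(2,i,β)}`. -/
noncomputable def applyD (g : SmoothMetric d X) : DLabel d P.n → (X → ℂ) → X → ℂ
  | .id, h => h
  | .D1, h => P.opD1 g h
  | .D2 i β, h => P.opD2 g i β h
  | .D3 i β, h => P.opD1 g (P.opD2 g i β h)
  | .D4 i β j μ, h => P.opD2 g j μ (P.opD2 g i β h)

/-- The composition of a list of operators in `𝓓`, applied to `h`. -/
noncomputable def applyWord (g : SmoothMetric d X) (D : List (DLabel d P.n)) (h : X → ℂ) : X → ℂ :=
  D.foldr (P.applyD g) h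

/-- `T` is the bounded operator on `L²(Λ, g)` with the given label: `Id`, `R`, `div_{i,β} R`, or the
bounded extension of `div_{i,β} R div_{j,μ}` from the (dense) domain of `div_{j,μ}`. -/
def IsOpB [MeasurableSpace X] (g : SmoothMetric d X) (Λ : Set X) (R T : L2 g Λ →L[ℂ] L2 g Λ) :
    BLabel d P.n → Prop
  | .id => T = 1
  | .R => T = R
  | .divR i β => ∀ h, IsWeakDiv g Λ (P.cut i β) (R h) (T h)
  | .divRdiv i β j μ => ∀ h k, IsWeakDiv g Λ (P.cut j μ) h k →
      IsWeakDiv g Λ (P.cut i β) (R k) (T h)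

end PeriodicFrame

end Geometry

end RandomSchroedinger

set_option linter.unusedSectionVars false

/-! The engine is a commutator identity. Formally `f R = R f + R [H, f] R`, and in divergence form
`[H, f] u = (Δf) u - 2 div (u grad f)`. Expanding `2 grad f` in the fields `ψ_β X_{i,β}` turns the
last term into `∑ div_{i,β} ((D^{(2,i,β)} f) u)`, which explains the shape of `D^{(2,i,β)}`. This
leaves `R div_{i,β} q R` with `q = D^{(2,i,β)} f`. Since `q R` is again a multiplier times a
resolvent, the same identity applies to it, and the result is `f R = R f + R (D^{(1)} f) R + ∑ R
(div R) (D^{(2)} f) + ∑ R (div R) (D^{(3)} f) R + ∑ R (div R div) (D^{(4)} f) R`. So `f R` is a sum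
over the labels `L` of `𝓓` of terms `R T_L (D_L f) R^{e(L)}` with `T_L` in `𝓑` and `e(L) ≤ 1`. The
second application is what puts a resolvent next to every divergence and so makes every `T_L`
bounded.

Differential operators do not enlarge supports, so `F` may be written in front of every function
that occurs. Expanding `f R^ν = F (f R) R^(ν-1)`, and then the new functions in the same way, `ν -
1` times in all, produces factors `F R T_L` and a last factor `(D f) R R^l`, where `l` collects at
most one resolvent per commutation. This algebra is `iterated_commutator_expansion`.

The sets `Λ(I)` may have irregular boundaries, so the commutator is computed in the form domain `H`,
the completion of `C_c^∞(Λ)` in the form norm. If `ι : H → L²` is the embedding, then `R = ι ι*`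
(`IsFormDomain.isResolvent`). Derivatives along `ψ_β X_{i,β}` and the corresponding divergences
extend to bounded maps `G, E : H → L²`; `div R` is `E ι*` and the extension of `div R div` is `-E
G*`. The norms depend only on the comparison constant `C_0` and on a uniform bound for the
divergences of the fields `ψ_β X_{i,β}`, hence not on `ω`, `I`, `ν` or `f`. The identity is
`IsFormSystem.mul_resolvent`, resting on `IsFormSystem.exists_mul`; `exists_resolvent_commutator`
collects it with the norm bounds.

The sup norms of `D f` require that relative boundedness control all coordinate derivatives of
`g_ω`. Since `∇^k A` is a tensor, its pointwise norm bounds its components in any fixed chart, and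
partial derivatives differ from covariant ones by terms with the Christoffel symbols of `g_0`
(`subound_iterCovDeriv`). Equivariance transfers a bound for `f` to all its translates
(`exists_bound_applyWord`), and together with cocompactness it bounds the divergences of the frame
on all of `X` (`exists_bound_divg_cut`).

Volume and divergence are given by chart formulas. Their independence of the chart (`vol_restrict`,
`divE_transit`) and the divergence theorem `integral_mul_divg` are the geometric basis. -/

namespace RandomSchroedinger

/-! ### Coordinates -/

section Coordinates

variable {d : ℕ} {X : Type*} [TopologicalSpace X] [ChartedSpace (Coord d) X]

/-- The smooth charts of `X`. -/
abbrev SmoothCharts (d : ℕ) (X : Type*) [TopologicalSpace X] [ChartedSpace (Coord d) X] :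
    Set (OpenPartialHomeomorph X (Coord d)) :=
  IsManifold.maximalAtlas 𝓘(ℝ, Coord d) (⊤ : ℕ∞) X

/-- The differential of the inverse of a chart. -/
noncomputable def dInv (e : OpenPartialHomeomorph X (Coord d)) (y : Coord d) :
    Coord d →L[ℝ] Tan d (e.symm y) :=
  mfderiv 𝓘(ℝ, Coord d) 𝓘(ℝ, Coord d) e.symm y

/-- The differential of a chart. -/
noncomputable def dChart (e : OpenPartialHomeomorph X (Coord d)) (p : X) :
    Tan d p →L[ℝ] Coord d :=
  mfderiv 𝓘(ℝ, Coord d) 𝓘(ℝ, Coord d) e p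

/-- The transition map from the chart `e` to the chart `e'`. -/
noncomputable def transit (e e' : OpenPartialHomeomorph X (Coord d)) (y : Coord d) : Coord d :=
  e' (e.symm y)

/-- The image of the domain of `e'` in the chart `e`. -/
def overlap (e e' : OpenPartialHomeomorph X (Coord d)) : Set (Coord d) :=
  e.target ∩ e.symm ⁻¹' e'.source

/-- The components of a vector field in a chart. -/
noncomputable def compE (e : OpenPartialHomeomorph X (Coord d)) (Z : (x : X) → Tan d x)
    (y : Coord d) : Coord d :=
  dChart e (e.symm y) (Z (e.symm y))

theorem isOpen_overlap (e e' : OpenPartialHomeomorph X (Coord d)) : IsOpen (overlap e e') :=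
  e.isOpen_inter_preimage_symm e'.open_source

theorem transit_mem (e e' : OpenPartialHomeomorph X (Coord d)) {y : Coord d}
    (hy : y ∈ overlap e e') : transit e e' y ∈ overlap e' e := by
  refine ⟨e'.map_source hy.2, ?_⟩
  simp only [Set.mem_preimage, transit, e'.left_inv hy.2]
  exact e.map_target hy.1

theorem transit_transit (e e' : OpenPartialHomeomorph X (Coord d)) {y : Coord d}
    (hy : y ∈ overlap e e') : transit e' e (transit e e' y) = y := by
  simp only [transit, e'.left_inv hy.2, e.right_inv hy.1]

theorem symm_transit (e e' : OpenPartialHomeomorph X (Coord d)) {y : Coord d}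
    (hy : y ∈ overlap e e') : e'.symm (transit e e' y) = e.symm y := e'.left_inv hy.2

variable [IsManifold 𝓘(ℝ, Coord d) (⊤ : ℕ∞) X]

theorem chartAt_mem (x : X) : chartAt (Coord d) x ∈ SmoothCharts d X :=
  IsManifold.chart_mem_maximalAtlas x

variable {e e' : OpenPartialHomeomorph X (Coord d)}

instance isManifold_one : IsManifold 𝓘(ℝ, Coord d) 1 X :=
  IsManifold.of_le (n := (⊤ : ℕ∞)) (by norm_cast)

theorem mem_atlas_one (he : e ∈ SmoothCharts d X) :
    e ∈ IsManifold.maximalAtlas 𝓘(ℝ, Coord d) 1 X :=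
  IsManifold.maximalAtlas_subset_of_le (by norm_cast) he

theorem mdiffAt_symm (he : e ∈ SmoothCharts d X) {y : Coord d} (hy : y ∈ e.target) :
    MDifferentiableAt 𝓘(ℝ, Coord d) 𝓘(ℝ, Coord d) e.symm y :=
  mdifferentiableAt_symm_of_mem_maximalAtlas (mem_atlas_one he) hy

theorem mdiffAt_chart (he : e ∈ SmoothCharts d X) {p : X} (hp : p ∈ e.source) :
    MDifferentiableAt 𝓘(ℝ, Coord d) 𝓘(ℝ, Coord d) e p :=
  mdifferentiableAt_of_mem_maximalAtlas (mem_atlas_one he) hp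

theorem mdifferentiable_chart' (he : e ∈ SmoothCharts d X) :
    e.MDifferentiable 𝓘(ℝ, Coord d) 𝓘(ℝ, Coord d) :=
  ⟨fun _ hp => (mdiffAt_chart he hp).mdifferentiableWithinAt,
    fun _ hy => (mdiffAt_symm he hy).mdifferentiableWithinAt⟩

theorem dChart_dInv (he : e ∈ SmoothCharts d X) {y : Coord d} (hy : y ∈ e.target) (v : Coord d) :
    dChart e (e.symm y) (dInv e y v) = v :=
  DFunLike.congr_fun ((mdifferentiable_chart' he).comp_symm_deriv hy) v

theorem dInv_dChart (he : e ∈ SmoothCharts d X) {y : Coord d} (hy : y ∈ e.target)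
    (v : Tan d (e.symm y)) : dInv e y (dChart e (e.symm y) v) = v := by
  have h := (mdifferentiable_chart' he).symm_comp_deriv (e.map_target hy)
  rw [e.right_inv hy] at h
  exact DFunLike.congr_fun h v

theorem contMDiffOn_symm_chart (he : e ∈ SmoothCharts d X) :
    ContMDiffOn 𝓘(ℝ, Coord d) 𝓘(ℝ, Coord d) (⊤ : ℕ∞) e.symm e.target :=
  contMDiffOn_symm_of_mem_maximalAtlas he

theorem contMDiffOn_chart' (he : e ∈ SmoothCharts d X) :
    ContMDiffOn 𝓘(ℝ, Coord d) 𝓘(ℝ, Coord d) (⊤ : ℕ∞) e e.source :=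
  contMDiffOn_of_mem_maximalAtlas he

theorem contDiffOn_comp_symm {W : Type*} [NormedAddCommGroup W] [NormedSpace ℝ W] {u : X → W}
    (he : e ∈ SmoothCharts d X) (hu : ContMDiffOn 𝓘(ℝ, Coord d) 𝓘(ℝ, W) (⊤ : ℕ∞) u e.source) :
    ContDiffOn ℝ (⊤ : ℕ∞) (fun y => u (e.symm y)) e.target :=
  (hu.comp (contMDiffOn_symm_chart he) (fun _ hy => e.map_target hy)).contDiffOn

theorem contMDiffOn_of_comp_symm {W : Type*} [NormedAddCommGroup W] [NormedSpace ℝ W] {u : X → W}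
    (he : e ∈ SmoothCharts d X) (hu : ContDiffOn ℝ (⊤ : ℕ∞) (fun y => u (e.symm y)) e.target) :
    ContMDiffOn 𝓘(ℝ, Coord d) 𝓘(ℝ, W) (⊤ : ℕ∞) u e.source :=
  (hu.contMDiffOn.comp (contMDiffOn_chart' he) (fun _ hy => e.map_source hy)).congr
    fun p hp => by simp [e.left_inv hp]

theorem fderiv_comp_symm {u : X → ℝ} (he : e ∈ SmoothCharts d X)
    {y : Coord d} (hy : y ∈ e.target)
    (hu : MDifferentiableAt 𝓘(ℝ, Coord d) 𝓘(ℝ, ℝ) u (e.symm y)) (v : Coord d) :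
    fderiv ℝ (fun z => u (e.symm z)) y v =
      mfderiv 𝓘(ℝ, Coord d) 𝓘(ℝ, ℝ) u (e.symm y) (dInv e y v) := by
  have h := mfderiv_comp y hu (mdiffAt_symm he hy)
  rw [mfderiv_eq_fderiv] at h
  exact DFunLike.congr_fun h v

theorem contDiffOn_transit (he : e ∈ SmoothCharts d X) (he' : e' ∈ SmoothCharts d X) :
    ContDiffOn ℝ (⊤ : ℕ∞) (transit e e') (overlap e e') :=
  ((contMDiffOn_chart' he').comp ((contMDiffOn_symm_chart he).mono Set.inter_subset_left)
    (fun _ hy => hy.2)).contDiffOn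

theorem fderiv_transit (he : e ∈ SmoothCharts d X) (he' : e' ∈ SmoothCharts d X)
    {y : Coord d} (hy : y ∈ overlap e e') (v : Coord d) :
    fderiv ℝ (transit e e') y v = dChart e' (e.symm y) (dInv e y v) := by
  have h := mfderiv_comp y (mdiffAt_chart he' hy.2) (mdiffAt_symm he hy.1)
  rw [mfderiv_eq_fderiv] at h
  exact DFunLike.congr_fun h v

theorem dChart_transit (he : e ∈ SmoothCharts d X) (he' : e' ∈ SmoothCharts d X)
    {y : Coord d} (hy : y ∈ overlap e e') (v : Tan d (e.symm y)) :
    dChart e' (e.symm y) v = fderiv ℝ (transit e e') y (dChart e (e.symm y) v) := by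
  rw [fderiv_transit he he' hy, dInv_dChart he hy.1]

/-- The two sides lie in tangent spaces at points that are only propositionally equal. Both spaces
are `Coord d` by definition, and the comparison is made there; the same device recurs wherever base
points have to be identified. -/
theorem dInv_transit (he : e ∈ SmoothCharts d X) (he' : e' ∈ SmoothCharts d X)
    {y : Coord d} (hy : y ∈ overlap e e') (v : Coord d) :
    (dInv e' (transit e e' y) (fderiv ℝ (transit e e') y v) : Coord d) = dInv e y v := by
  rw [fderiv_transit he he' hy]
  have h := dInv_dChart he' (transit_mem e e' hy).1
  have key : ∀ (p : X) (hp : p = e'.symm (transit e e' y)) (w : Coord d),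
      (dInv e' (transit e e' y) (dChart e' p w) : Coord d) = w := by
    rintro p rfl w
    exact h w
  exact key _ (symm_transit e e' hy).symm _

theorem differentiableAt_transit (he : e ∈ SmoothCharts d X) (he' : e' ∈ SmoothCharts d X)
    {y : Coord d} (hy : y ∈ overlap e e') : DifferentiableAt ℝ (transit e e') y :=
  ((contDiffOn_transit he he').contDiffAt ((isOpen_overlap e e').mem_nhds hy)).differentiableAt
    (by simp)

theorem fderiv_transit_transit (he : e ∈ SmoothCharts d X) (he' : e' ∈ SmoothCharts d X)
    {y : Coord d} (hy : y ∈ overlap e e') (v : Coord d) :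
    fderiv ℝ (transit e' e) (transit e e' y) (fderiv ℝ (transit e e') y v) = v := by
  have h1 := (differentiableAt_transit he' he (transit_mem e e' hy)).hasFDerivAt.comp y
    (differentiableAt_transit he he' hy).hasFDerivAt
  have h2 : HasFDerivAt (transit e' e ∘ transit e e') (ContinuousLinearMap.id ℝ (Coord d)) y :=
    (hasFDerivAt_id y).congr_of_eventuallyEq (by
      filter_upwards [(isOpen_overlap e e').mem_nhds hy] with z hz
      exact transit_transit e e' hz)
  exact DFunLike.congr_fun (h1.unique h2) v

/-! ### The metric in coordinates -/

/-- The metric in a chart, as a bilinear form. -/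
noncomputable def metricE (g : SmoothMetric d X) (e : OpenPartialHomeomorph X (Coord d))
    (y : Coord d) (v w : Coord d) : ℝ :=
  g.inner (e.symm y) (dInv e y v) (dInv e y w)

/-- The Gram matrix in a chart. -/
noncomputable def gramE (g : SmoothMetric d X) (e : OpenPartialHomeomorph X (Coord d))
    (y : Coord d) : Matrix (Fin d) (Fin d) ℝ :=
  Matrix.of fun i j => metricE g e y (EuclideanSpace.single i 1) (EuclideanSpace.single j 1)

theorem coord_eq_sum (v : Coord d) : v = ∑ i, v i • EuclideanSpace.single i (1 : ℝ) := by
  ext j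
  simp [Pi.single_apply]

theorem metricE_eq_sum (g : SmoothMetric d X) (e : OpenPartialHomeomorph X (Coord d))
    (y : Coord d) (v w : Coord d) :
    metricE g e y v w = ∑ i, ∑ j, v i * w j * gramE g e y i j := by
  conv_lhs => rw [coord_eq_sum v, coord_eq_sum w]
  simp only [metricE, map_sum, map_smul, sum_apply,
    smul_apply, smul_eq_mul, gramE, Matrix.of_apply, Finset.mul_sum]
  rw [Finset.sum_comm]
  exact Finset.sum_congr rfl fun i _ => Finset.sum_congr rfl fun j _ => by ring

theorem metricE_symm (g : SmoothMetric d X) (e : OpenPartialHomeomorph X (Coord d))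
    (y : Coord d) (v w : Coord d) : metricE g e y v w = metricE g e y w v := g.symm _ _ _

theorem metricE_pos (g : SmoothMetric d X) (he : e ∈ SmoothCharts d X) {y : Coord d}
    (hy : y ∈ e.target) {v : Coord d} (hv : v ≠ 0) : 0 < metricE g e y v v := by
  refine g.pos _ _ fun h => hv ?_
  rw [← dChart_dInv he hy v, h, map_zero]

theorem metricE_transit (g : SmoothMetric d X) (he : e ∈ SmoothCharts d X)
    (he' : e' ∈ SmoothCharts d X) {y : Coord d} (hy : y ∈ overlap e e') (v w : Coord d) :
    metricE g e' (transit e e' y) (fderiv ℝ (transit e e') y v) (fderiv ℝ (transit e e') y w) =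
      metricE g e y v w := by
  have key : ∀ (p q : X) (_ : p = q) (a b a' b' : Coord d), a = a' → b = b' →
      g.inner p a b = g.inner q a' b' := by
    rintro p _ rfl a b _ _ rfl rfl; rfl
  exact key _ _ (symm_transit e e' hy) _ _ _ _ (dInv_transit he he' hy v) (dInv_transit he he' hy w)

theorem gramE_symm (g : SmoothMetric d X) (e : OpenPartialHomeomorph X (Coord d))
    (y : Coord d) (i j : Fin d) : gramE g e y i j = gramE g e y j i := metricE_symm g e y _ _

/-- The coordinate fields are smooth sections, being images of constant sections under the tangent
map of the inverse chart, and a smooth metric pairs smooth sections to a smooth function. -/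
theorem contDiffOn_metricE (g : SmoothMetric d X) (he : e ∈ SmoothCharts d X) (v w : Coord d) :
    ContDiffOn ℝ (⊤ : ℕ∞) (fun y => metricE g e y v w) e.target := by
  let : RiemannianBundle (fun x : X => TangentSpace 𝓘(ℝ, Coord d) x) := ⟨g.toRiemannianMetric⟩
  have hv : ∀ v : Coord d, ContMDiffOn 𝓘(ℝ, Coord d) (𝓘(ℝ, Coord d)).tangent (⊤ : ℕ∞)
      (fun y => (⟨e.symm y, dInv e y v⟩ : TangentBundle 𝓘(ℝ, Coord d) X)) e.target := by
    intro v
    have h1 := (contMDiffOn_symm_chart he).contMDiffOn_tangentMapWithin (m := (⊤ : ℕ∞))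
      (by simp) e.open_target.uniqueMDiffOn
    have h2 : ContMDiffOn 𝓘(ℝ, Coord d) (𝓘(ℝ, Coord d)).tangent (⊤ : ℕ∞)
      (fun y => (⟨y, v⟩ : TangentBundle 𝓘(ℝ, Coord d) (Coord d))) e.target := by
      have : ContMDiff 𝓘(ℝ, Coord d) (𝓘(ℝ, Coord d)).tangent (⊤ : ℕ∞)
        (fun y => (⟨y, v⟩ : TangentBundle 𝓘(ℝ, Coord d) (Coord d))) :=
        contMDiff_vectorSpace_iff_contDiff.2 contDiff_const
      exact this.contMDiffOn
    refine (h1.comp h2 (fun y hy => hy)).congr fun y hy => ?_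
    simp only [Function.comp, tangentMapWithin, dInv]
    rw [mfderivWithin_of_isOpen e.open_target hy]
    rfl
  exact (ContMDiffOn.inner_bundle (n := (⊤ : ℕ∞)) (F := Coord d)
    (E := fun x : X => TangentSpace 𝓘(ℝ, Coord d) x) (hv v) (hv w)).contDiffOn

theorem contDiffOn_gramE (g : SmoothMetric d X) (he : e ∈ SmoothCharts d X) (i j : Fin d) :
    ContDiffOn ℝ (⊤ : ℕ∞) (fun y => gramE g e y i j) e.target := contDiffOn_metricE g he _ _

theorem posDef_gramE (g : SmoothMetric d X) (he : e ∈ SmoothCharts d X) {y : Coord d}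
    (hy : y ∈ e.target) : (gramE g e y).PosDef := by
  rw [Matrix.posDef_iff_dotProduct_mulVec]
  refine ⟨?_, fun v hv => ?_⟩
  · ext i j
    simpa using gramE_symm g e y j i
  · have := metricE_pos g he hy (v := WithLp.toLp 2 v) (fun h => hv (by simpa using h))
    rw [metricE_eq_sum] at this
    simpa [dotProduct, Matrix.mulVec, Finset.mul_sum, mul_assoc, mul_comm, mul_left_comm] using this

theorem contMDiff_of_charts {W : Type*} [NormedAddCommGroup W] [NormedSpace ℝ W] {u : X → W}
    (hu : ∀ e ∈ SmoothCharts d X, ContDiffOn ℝ (⊤ : ℕ∞) (fun y => u (e.symm y)) e.target) :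
    ContMDiff 𝓘(ℝ, Coord d) 𝓘(ℝ, W) (⊤ : ℕ∞) u := fun x =>
  (contMDiffOn_of_comp_symm (chartAt_mem x) (hu _ (chartAt_mem x))).contMDiffAt
    ((chartAt (Coord d) x).open_source.mem_nhds (mem_chart_source _ x))

end Coordinates

/-! ### The Riemannian volume -/

section Volume

variable {d : ℕ} {X : Type*} [TopologicalSpace X] [ChartedSpace (Coord d) X]
  [IsManifold 𝓘(ℝ, Coord d) (⊤ : ℕ∞) X]
  {e e' : OpenPartialHomeomorph X (Coord d)}

/-- The density of the volume in a chart. -/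
noncomputable def densityE (g : SmoothMetric d X) (e : OpenPartialHomeomorph X (Coord d))
    (y : Coord d) : ℝ :=
  Real.sqrt (gramE g e y).det

theorem densityE_pos (g : SmoothMetric d X) (he : e ∈ SmoothCharts d X) {y : Coord d}
    (hy : y ∈ e.target) : 0 < densityE g e y :=
  Real.sqrt_pos.2 (posDef_gramE g he hy).det_pos

theorem contDiffOn_det {n : ℕ} {U : Set (Coord d)} {M : Coord d → Matrix (Fin n) (Fin n) ℝ}
    (hM : ∀ i j, ContDiffOn ℝ (⊤ : ℕ∞) (fun y => M y i j) U) :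
    ContDiffOn ℝ (⊤ : ℕ∞) (fun y => (M y).det) U := by
  simp only [Matrix.det_apply']
  exact ContDiffOn.sum fun s _ => contDiffOn_const.mul (contDiffOn_prod fun i _ => hM _ _)

theorem contDiffOn_densityE (g : SmoothMetric d X) (he : e ∈ SmoothCharts d X) :
    ContDiffOn ℝ (⊤ : ℕ∞) (densityE g e) e.target :=
  (contDiffOn_det (contDiffOn_gramE g he)).sqrt fun _ hy => (posDef_gramE g he hy).det_pos.ne'

/-- Gram matrices transform by the congruence `G = Jᵀ G' J` with the Jacobian matrix `J`, so the
determinants differ by the factor `(det J)²`. -/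
theorem densityE_transit (g : SmoothMetric d X) (he : e ∈ SmoothCharts d X)
    (he' : e' ∈ SmoothCharts d X) {y : Coord d} (hy : y ∈ overlap e e') :
    densityE g e y = |(fderiv ℝ (transit e e') y).det| * densityE g e' (transit e e' y) := by
  set L := fderiv ℝ (transit e e') y with hL
  let b := (EuclideanSpace.basisFun (Fin d) ℝ).toBasis
  let J : Matrix (Fin d) (Fin d) ℝ := LinearMap.toMatrix b b L.toLinearMap
  have hJ : ∀ i j, J i j = L (EuclideanSpace.single j 1) i := fun i j => by
    simp [J, b, LinearMap.toMatrix_apply]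
  have hdet : J.det = L.det := LinearMap.det_toMatrix b _
  have hG : gramE g e y = J.transpose * gramE g e' (transit e e' y) * J := by
    ext i j
    have := metricE_transit g he he' hy (EuclideanSpace.single i 1) (EuclideanSpace.single j 1)
    rw [metricE_eq_sum] at this
    rw [gramE, Matrix.of_apply, ← this]
    simp only [Matrix.mul_apply, Matrix.transpose_apply, hJ, Finset.sum_mul]
    rw [Finset.sum_comm]
    exact Finset.sum_congr rfl fun a _ => Finset.sum_congr rfl fun c _ => by ring
  rw [densityE, hG, Matrix.det_mul, Matrix.det_mul, Matrix.det_transpose, ← hdet, densityE,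
    ← Real.sqrt_sq_eq_abs, ← Real.sqrt_mul (sq_nonneg _)]
  congr 1
  ring

variable [MeasurableSpace X] [BorelSpace X]

/-- The volume of the domain of a chart. -/
noncomputable def chartVolE (g : SmoothMetric d X) (e : OpenPartialHomeomorph X (Coord d)) :
    Measure X :=
  ((volume.restrict e.target).withDensity
    (fun y => ENNReal.ofReal (densityE g e y))).map e.symm

theorem measurableSet_target_inter (e : OpenPartialHomeomorph X (Coord d)) {A : Set X}
    (hA : MeasurableSet A) : MeasurableSet (e.target ∩ e.symm ⁻¹' A) := by
  have h : Measurable (e.target.domRestrict e.symm) :=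
    (continuousOn_iff_continuous_domRestrict.1 e.continuousOn_symm).measurable
  have := (e.open_target.measurableSet).subtype_image (h hA)
  convert this using 1
  ext y
  exact ⟨fun h => ⟨⟨y, h.1⟩, h.2, rfl⟩, by rintro ⟨z, hz, rfl⟩; exact ⟨z.2, hz⟩⟩

theorem aemeasurable_symm (e : OpenPartialHomeomorph X (Coord d)) (ρ : Coord d → ℝ≥0∞) :
    AEMeasurable e.symm ((volume.restrict e.target).withDensity ρ) :=
  (e.continuousOn_symm.aemeasurable e.open_target.measurableSet).mono_ac
    (withDensity_absolutelyContinuous _ _)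

theorem chartVolE_apply (g : SmoothMetric d X) (e : OpenPartialHomeomorph X (Coord d)) {A : Set X}
    (hA : MeasurableSet A) :
    chartVolE g e A = ∫⁻ y in e.target ∩ e.symm ⁻¹' A, ENNReal.ofReal (densityE g e y) := by
  rw [chartVolE, Measure.map_apply_of_aemeasurable (aemeasurable_symm e _) hA, withDensity_apply',
    Measure.restrict_restrict' e.open_target.measurableSet, Set.inter_comm]

theorem image_transit (e e' : OpenPartialHomeomorph X (Coord d)) {A : Set X}
    (hA : A ⊆ e.source ∩ e'.source) :
    transit e e' '' (e.target ∩ e.symm ⁻¹' A) = e'.target ∩ e'.symm ⁻¹' A := by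
  ext z
  constructor
  · rintro ⟨y, ⟨hy, hyA⟩, rfl⟩
    have hy' : y ∈ overlap e e' := ⟨hy, (hA hyA).2⟩
    refine ⟨(transit_mem e e' hy').1, ?_⟩
    rw [Set.mem_preimage, symm_transit e e' hy']
    exact hyA
  · rintro ⟨hz, hzA⟩
    have hz' : z ∈ overlap e' e := ⟨hz, (hA hzA).1⟩
    refine ⟨transit e' e z, ⟨(transit_mem e' e hz').1, ?_⟩, transit_transit e' e hz'⟩
    rw [Set.mem_preimage, symm_transit e' e hz']
    exact hzA

/-- Change of variables along the transition map, whose Jacobian determinant is exactly the ratio of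
the densities. -/
theorem chartVolE_apply_eq (g : SmoothMetric d X) (he : e ∈ SmoothCharts d X)
    (he' : e' ∈ SmoothCharts d X) {A : Set X} (hm : MeasurableSet A)
    (hA : A ⊆ e.source ∩ e'.source) : chartVolE g e A = chartVolE g e' A := by
  have hsub : e.target ∩ e.symm ⁻¹' A ⊆ overlap e e' := fun y hy => ⟨hy.1, (hA hy.2).2⟩
  have hmeas := measurableSet_target_inter e hm
  rw [chartVolE_apply g e hm, chartVolE_apply g e' hm, ← image_transit e e' hA,
    lintegral_image_eq_lintegral_abs_det_fderiv_mul volume hmeas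
      (fun y hy => (differentiableAt_transit he he' (hsub hy)).hasFDerivAt.hasFDerivWithinAt)]
  · refine setLIntegral_congr_fun hmeas fun y hy => ?_
    rw [densityE_transit g he he' (hsub hy), ENNReal.ofReal_mul (abs_nonneg _)]
  · intro y hy z hz h
    rw [← transit_transit e e' (hsub hy), ← transit_transit e e' (hsub hz), h]

theorem chartVolE_compl (g : SmoothMetric d X) (e : OpenPartialHomeomorph X (Coord d)) :
    chartVolE g e e.sourceᶜ = 0 := by
  rw [chartVolE_apply g e e.open_source.measurableSet.compl]
  have : e.target ∩ e.symm ⁻¹' e.sourceᶜ = ∅ := by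
    ext y
    simp only [Set.mem_inter_iff, Set.mem_preimage, Set.mem_compl_iff, Set.mem_empty_iff_false,
      iff_false, not_and, not_not]
    exact fun hy => e.map_target hy
  rw [this, Measure.restrict_empty, lintegral_zero_measure]

theorem chartVolE_inter (g : SmoothMetric d X) (e : OpenPartialHomeomorph X (Coord d))
    (A : Set X) : chartVolE g e (A ∩ e.source) = chartVolE g e A :=
  measure_inter_conull (chartVolE_compl g e)

variable [SecondCountableTopology X]

theorem exists_countable_charts (d : ℕ) (X : Type*) [TopologicalSpace X]
    [ChartedSpace (Coord d) X] [SecondCountableTopology X] [Nonempty X] :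
    ∃ x : ℕ → X, ⋃ n, (chartAt (Coord d) (x n)).source = Set.univ := by
  obtain ⟨s, hs, hsu⟩ := TopologicalSpace.countable_cover_nhds
    fun x : X => chart_source_mem_nhds (Coord d) x
  have hne : s.Nonempty := by
    by_contra h
    rw [Set.not_nonempty_iff_eq_empty.1 h, Set.biUnion_empty] at hsu
    exact Set.empty_ne_univ hsu
  obtain ⟨x, rfl⟩ := hs.exists_eq_range hne
  exact ⟨x, by simpa using hsu⟩

/-- The supremum of the chart volumes is computed by gluing: a countable cover by chart domains is
made disjoint and the chart volumes on the pieces are summed to `μ`. As chart volumes agree on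
overlaps, `μ` restricts to the right measure on every chart domain, so it dominates all chart
volumes; conversely each piece of `μ` is dominated by one chart volume. -/
theorem vol_restrict (g : SmoothMetric d X) (he : e ∈ SmoothCharts d X) :
    (vol g).restrict e.source = chartVolE g e := by
  rcases isEmpty_or_nonempty X with hX | hX
  · ext A _
    simp [Set.eq_empty_of_isEmpty]
  obtain ⟨x, hx⟩ := exists_countable_charts d X
  let U : ℕ → Set X := fun n => (chartAt (Coord d) (x n)).source
  have hUm : ∀ n, MeasurableSet (U n) := fun n => (chartAt (Coord d) (x n)).open_source.measurableSet
  let D : ℕ → Set X := disjointed U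
  have hDm : ∀ n, MeasurableSet (D n) := fun n => MeasurableSet.disjointed hUm n
  have hDU : ∀ n, D n ⊆ U n := disjointed_subset U
  let μ : Measure X := Measure.sum fun n => (chartVolE g (chartAt (Coord d) (x n))).restrict (D n)
  have key : ∀ e ∈ SmoothCharts d X, μ.restrict e.source = chartVolE g e := by
    intro e he
    ext A hA
    rw [Measure.restrict_apply hA, Measure.sum_apply _ (hA.inter e.open_source.measurableSet)]
    have h1 : ∀ n, ((chartVolE g (chartAt (Coord d) (x n))).restrict (D n)) (A ∩ e.source) =
        chartVolE g e (A ∩ e.source ∩ D n) := by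
      intro n
      have hm := (hA.inter e.open_source.measurableSet).inter (hDm n)
      rw [Measure.restrict_apply (hA.inter e.open_source.measurableSet)]
      exact chartVolE_apply_eq g (chartAt_mem _) he hm fun p hp => ⟨hDU n hp.2, hp.1.2⟩
    simp only [h1]
    rw [← measure_iUnion, ← Set.inter_iUnion, iUnion_disjointed]
    · have : ⋃ n, U n = Set.univ := hx
      rw [this, Set.inter_univ, chartVolE_inter]
    · intro i j hij
      exact ((disjoint_disjointed U) hij).mono Set.inter_subset_right Set.inter_subset_right
    · exact fun n => (hA.inter e.open_source.measurableSet).inter (hDm n)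
  have hle : ∀ y, chartVolE g (chartAt (Coord d) y) ≤ μ := fun y => by
    rw [← key _ (chartAt_mem y)]
    exact Measure.restrict_le_self
  have hμ : vol g = μ := by
    refine le_antisymm (iSup_le fun y => hle y) (Measure.le_iff.2 fun A hA => ?_)
    rw [Measure.sum_apply _ hA]
    have h1 : ∀ n, ((chartVolE g (chartAt (Coord d) (x n))).restrict (D n)) A ≤
        vol g (A ∩ D n) := fun n => by
      rw [Measure.restrict_apply hA]
      exact (le_iSup (fun y => chartVol g y) (x n)) _
    refine (ENNReal.tsum_le_tsum h1).trans ?_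
    rw [← measure_iUnion]
    · exact measure_mono (Set.iUnion_subset fun n => Set.inter_subset_left)
    · intro i j hij
      exact ((disjoint_disjointed U) hij).mono Set.inter_subset_right Set.inter_subset_right
    · exact fun n => hA.inter (hDm n)
  rw [hμ, key e he]

theorem chartVolE_lt_top (g : SmoothMetric d X) (he : e ∈ SmoothCharts d X) {K : Set (Coord d)}
    (hK : IsCompact K) (hKe : K ⊆ e.target) {A : Set X} (hA : MeasurableSet A)
    (hAK : e.target ∩ e.symm ⁻¹' A ⊆ K) : chartVolE g e A < ∞ := by
  rw [chartVolE_apply g e hA]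
  refine (lintegral_mono_set hAK).trans_lt ?_
  have : IntegrableOn (densityE g e) K :=
    ((contDiffOn_densityE g he).continuousOn.mono hKe).integrableOn_compact hK
  exact this.lintegral_lt_top

instance isLocallyFiniteMeasure_vol (g : SmoothMetric d X) : IsLocallyFiniteMeasure (vol g) := by
  refine ⟨fun x => ?_⟩
  let e := chartAt (Coord d) x
  obtain ⟨K, hK, hKn, hKe⟩ := exists_compact_subset e.open_target (mem_chart_target (Coord d) x)
  have hopen : IsOpen (e.source ∩ e ⁻¹' interior K) :=
    e.isOpen_inter_preimage isOpen_interior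
  refine ⟨_, hopen.mem_nhds ⟨mem_chart_source _ x, hKn⟩, ?_⟩
  have h := vol_restrict g (chartAt_mem (d := d) x)
  rw [← Measure.restrict_eq_self (vol g) (Set.inter_subset_left (s := e.source)), h]
  refine chartVolE_lt_top g (chartAt_mem x) hK hKe hopen.measurableSet fun y hy => ?_
  have := hy.2.2
  rw [Set.mem_preimage, e.right_inv hy.1] at this
  exact interior_subset this

theorem integral_vol_eq {W : Type*} [NormedAddCommGroup W] [NormedSpace ℝ W]
    (g : SmoothMetric d X) (he : e ∈ SmoothCharts d X) {u : X → W} (hu : ContinuousOn u e.source)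
    (hs : Function.support u ⊆ e.source) :
    ∫ x, u x ∂(vol g) = ∫ y in e.target, densityE g e y • u (e.symm y) := by
  rw [← setIntegral_eq_integral_of_forall_compl_eq_zero (s := e.source)
    (fun x hx => by_contra fun h => hx (hs h)), vol_restrict g he, chartVolE, integral_map]
  · rw [integral_withDensity_eq_integral_toReal_smul₀]
    · refine setIntegral_congr_fun e.open_target.measurableSet fun y hy => ?_
      rw [ENNReal.toReal_ofReal (densityE_pos g he hy).le]
    · exact ((contDiffOn_densityE g he).continuousOn.aemeasurable
        e.open_target.measurableSet).ennreal_ofReal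
    · exact Eventually.of_forall fun _ => ENNReal.ofReal_lt_top
  · exact aemeasurable_symm e _
  · have h := hu.aestronglyMeasurable (μ := vol g) e.open_source.measurableSet
    rw [vol_restrict g he] at h
    exact h

end Volume

/-! ### Gradient and divergence -/

section EuclideanAnalysis

theorem integrable_of_zero_off_compact {E : Type*} [TopologicalSpace E] [MeasurableSpace E]
    [OpensMeasurableSpace E] [T2Space E] {μ : Measure E} [IsFiniteMeasureOnCompacts μ] {U K : Set E}
    (hK : IsCompact K) (hKU : K ⊆ U) {u : E → ℝ} (hu : ContinuousOn u U)
    (h0 : ∀ y, y ∉ K → u y = 0) : Integrable u μ := by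
  rw [← integrableOn_iff_integrable_of_support_subset (s := K)
    (fun y hy => by_contra fun h => hy (h0 y h))]
  exact (hu.mono hKU).integrableOn_compact hK

variable {d : ℕ}

theorem contDiffOn_pderiv {U : Set (Coord d)} (hU : IsOpen U) {u : Coord d → ℝ}
    (hu : ContDiffOn ℝ (⊤ : ℕ∞) u U) (i : Fin d) : ContDiffOn ℝ (⊤ : ℕ∞) (pderiv i u) U :=
  (hu.fderiv_of_isOpen hU (by simp)).clm_apply contDiffOn_const

theorem pderiv_congr {U : Set (Coord d)} (hU : IsOpen U) {u v : Coord d → ℝ}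
    (h : Set.EqOn u v U) (i : Fin d) {y : Coord d} (hy : y ∈ U) : pderiv i u y = pderiv i v y := by
  unfold pderiv
  rw [(h.eventuallyEq_of_mem (hU.mem_nhds hy)).fderiv_eq]

theorem fderiv_eq_sum_pderiv (u : Coord d → ℝ) (y v : Coord d) :
    fderiv ℝ u y v = ∑ i, v i * pderiv i u y := by
  conv_lhs => rw [coord_eq_sum v]
  simp [pderiv]

theorem contDiffOn_differentiableAt {U : Set (Coord d)} (hU : IsOpen U)
    {W : Type*} [NormedAddCommGroup W] [NormedSpace ℝ W] {u : Coord d → W}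
    (hu : ContDiffOn ℝ (⊤ : ℕ∞) u U) {y : Coord d} (hy : y ∈ U) : DifferentiableAt ℝ u y :=
  (hu.contDiffAt (hU.mem_nhds hy)).differentiableAt (by simp)

theorem integral_mul_pderiv {U K : Set (Coord d)} (hU : IsOpen U) (hK : IsCompact K) (hKU : K ⊆ U)
    {u w : Coord d → ℝ} (hu : ContDiffOn ℝ (⊤ : ℕ∞) u U) (hw : ContDiffOn ℝ (⊤ : ℕ∞) w U)
    (h0 : ∀ y ∈ U, y ∉ K → u y = 0) (i : Fin d) :
    ∫ y in U, u y * pderiv i w y = - ∫ y in U, w y * pderiv i u y := by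
  -- The extension by zero is differentiable everywhere because it vanishes near every point outside
  -- `K`. The other factor `w` has to be differentiable only on the support of `f`.
  set f : Coord d → ℝ := U.indicator u with hf
  have hfK : ∀ y, y ∉ K → f y = 0 := fun y hy => by
    by_cases hyU : y ∈ U
    · rw [hf, Set.indicator_of_mem hyU, h0 y hyU hy]
    · rw [hf, Set.indicator_of_notMem hyU]
  have hfu : Set.EqOn f u U := fun y hy => Set.indicator_of_mem hy _
  have hfU : ContDiffOn ℝ (⊤ : ℕ∞) f U := hu.congr hfu
  have hfd : ∀ y, DifferentiableAt ℝ f y := fun y => by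
    by_cases hy : y ∈ K
    · exact contDiffOn_differentiableAt hU hfU (hKU hy)
    · have : f =ᶠ[𝓝 y] fun _ => 0 := by
        filter_upwards [hK.isClosed.isOpen_compl.mem_nhds hy] with z hz using hfK z hz
      exact (differentiableAt_const 0).congr_of_eventuallyEq this
  have hft : tsupport f ⊆ K :=
    closure_minimal (fun y hy => by_contra fun h => hy (hfK y h)) hK.isClosed
  have hf'K : ∀ y, y ∉ K → fderiv ℝ f y = 0 := fun y hy =>
    image_eq_zero_of_notMem_tsupport fun h => hy (hft (tsupport_fderiv_subset ℝ h))
  have hc := hu.continuousOn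
  have hwc := hw.continuousOn
  have hfc := hfU.continuousOn
  have h1 : Integrable (fun y => fderiv ℝ f y (EuclideanSpace.single i 1) * w y) :=
    integrable_of_zero_off_compact hK hKU
      ((contDiffOn_pderiv hU hfU i).continuousOn.mul hwc) (fun y hy => by simp [hf'K y hy])
  have h2 : Integrable (fun y => f y * fderiv ℝ w y (EuclideanSpace.single i 1)) :=
    integrable_of_zero_off_compact hK hKU
      (hfc.mul (contDiffOn_pderiv hU hw i).continuousOn) (fun y hy => by simp [hfK y hy])
  have h3 : Integrable (fun y => f y * w y) :=
    integrable_of_zero_off_compact hK hKU (hfc.mul hwc) (fun y hy => by simp [hfK y hy])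
  have := integral_mul_fderiv_eq_neg_fderiv_mul_of_integrable h1 h2 h3 (fun y _ => hfd y)
    (fun y hy => contDiffOn_differentiableAt hU hw (hKU (hft hy)))
  rw [← setIntegral_eq_integral_of_forall_compl_eq_zero (s := U),
    ← setIntegral_eq_integral_of_forall_compl_eq_zero (s := U)
      (f := fun y => fderiv ℝ f y (EuclideanSpace.single i 1) * w y)] at this
  · rw [setIntegral_congr_fun hU.measurableSet (g := fun y => f y * pderiv i w y)
      (fun y hy => by simp only [hfu hy]), setIntegral_congr_fun hU.measurableSet
      (f := fun y => w y * pderiv i u y)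
      (g := fun y => fderiv ℝ f y (EuclideanSpace.single i 1) * w y)
      (fun y hy => by
        simp only [← pderiv_congr hU hfu i hy, mul_comm (w y)]; rfl)]
    exact this
  · exact fun y hy => by simp [hf'K y fun h => hy (hKU h)]
  · exact fun y hy => by simp [hfK y fun h => hy (hKU h)]

/-- Cramer's rule: an entry of the inverse is a quotient of determinants, hence of polynomials in
the entries. -/
theorem contDiffOn_matrix_inv {n : ℕ} {U : Set (Coord d)} {M : Coord d → Matrix (Fin n) (Fin n) ℝ}
    (hM : ∀ i j, ContDiffOn ℝ (⊤ : ℕ∞) (fun y => M y i j) U) (h0 : ∀ y ∈ U, (M y).det ≠ 0)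
    (i j : Fin n) : ContDiffOn ℝ (⊤ : ℕ∞) (fun y => (M y)⁻¹ i j) U := by
  have h : ∀ y, (M y)⁻¹ i j = (M y).det⁻¹ * ((M y).updateRow j (Pi.single i 1)).det := fun y => by
    rw [Matrix.inv_def, Matrix.smul_apply, Matrix.adjugate_apply, Ring.inverse_eq_inv', smul_eq_mul]
  simp only [h]
  refine ((contDiffOn_det hM).inv h0).mul (contDiffOn_det fun a b => ?_)
  by_cases ha : a = j
  · subst ha
    simp only [Matrix.updateRow_self]
    exact contDiffOn_const
  · simp only [Matrix.updateRow_ne ha]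
    exact hM a b

end EuclideanAnalysis

/-! ### Gradients, vector fields and divergences in charts. -/

section Calculus

variable {d : ℕ} {X : Type*} [TopologicalSpace X] [ChartedSpace (Coord d) X]
  [IsManifold 𝓘(ℝ, Coord d) (⊤ : ℕ∞) X]
  {e e' : OpenPartialHomeomorph X (Coord d)}

/-- `ContinuousLinearMap.inverse` is zero on maps that are not invertible, so the gradient has its
defining property only once the metric is known to be an isomorphism onto the dual space. -/
theorem isInvertible_of_pos {E : Type*} [NormedAddCommGroup E] [NormedSpace ℝ E]
    [FiniteDimensional ℝ E] (B : E →L[ℝ] E →L[ℝ] ℝ) (hB : ∀ v, v ≠ 0 → 0 < B v v) :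
    B.IsInvertible := by
  have hinj : Function.Injective B := by
    rw [injective_iff_map_eq_zero]
    intro v hv
    by_contra h
    have := hB v h
    simp [hv] at this
  have hfin : Module.finrank ℝ E = Module.finrank ℝ (E →L[ℝ] ℝ) := by
    rw [← (LinearMap.toContinuousLinearMap (𝕜 := ℝ) (E := E) (F' := ℝ)).finrank_eq]
    exact (Subspace.dual_finrank_eq (K := ℝ) (V := E)).symm
  exact ⟨(LinearEquiv.ofInjectiveOfFinrankEq B.toLinearMap hinj hfin).toContinuousLinearEquiv,
    by ext; rfl⟩

theorem isInvertible_inner (g : SmoothMetric d X) (x : X) : (g.inner x).IsInvertible :=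
  isInvertible_of_pos (E := Coord d) (g.inner x) fun v hv => g.pos x v hv

theorem inner_inverse (g : SmoothMetric d X) (x : X) (L : Tan d x →L[ℝ] ℝ) (v : Tan d x) :
    g.inner x ((g.inner x).inverse L) v = L v := by
  obtain ⟨M, hM⟩ := isInvertible_inner g x
  rw [← hM, ContinuousLinearMap.inverse_equiv]
  exact DFunLike.congr_fun (M.apply_symm_apply L) v

theorem inner_grad (g : SmoothMetric d X) (h : X → ℝ) (x : X) (v : Tan d x) :
    g.inner x (grad g h x) v = mfderiv 𝓘(ℝ, Coord d) 𝓘(ℝ, ℝ) h x v := inner_inverse g x _ v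

/-- The derivative of a function along a vector field. -/
noncomputable def lieD (Z : (x : X) → Tan d x) (h : X → ℝ) (x : X) : ℝ :=
  mfderiv 𝓘(ℝ, Coord d) 𝓘(ℝ, ℝ) h x (Z x)

theorem inner_grad_eq_lieD (g : SmoothMetric d X) (Z : (x : X) → Tan d x) (h : X → ℝ) (x : X) :
    g.inner x (Z x) (grad g h x) = lieD Z h x := by
  rw [g.symm, inner_grad]
  rfl

/-- The divergence computed in a chart. -/
noncomputable def divE (g : SmoothMetric d X) (e : OpenPartialHomeomorph X (Coord d))
    (Z : (x : X) → Tan d x) (y : Coord d) : ℝ :=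
  (densityE g e y)⁻¹ * ∑ i : Fin d, pderiv i (fun y => densityE g e y * compE e Z y i) y

theorem divg_eq (g : SmoothMetric d X) (Z : (x : X) → Tan d x) (x : X) :
    divg g Z x = divE g (chartAt (Coord d) x) Z (chartAt (Coord d) x x) := rfl

/-- Vector fields whose components are smooth in all charts. -/
def SmoothField (Z : (x : X) → Tan d x) : Prop :=
  ∀ e ∈ SmoothCharts d X, ∀ i, ContDiffOn ℝ (⊤ : ℕ∞) (fun y => compE e Z y i) e.target

/-- Real smooth functions. -/
abbrev SmoothFun (d : ℕ) {X : Type*} [TopologicalSpace X] [ChartedSpace (Coord d) X]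
    (h : X → ℝ) : Prop :=
  ContMDiff 𝓘(ℝ, Coord d) 𝓘(ℝ, ℝ) (⊤ : ℕ∞) h

theorem SmoothFun.mdiff {h : X → ℝ} (hh : SmoothFun d h) (x : X) :
    MDifferentiableAt 𝓘(ℝ, Coord d) 𝓘(ℝ, ℝ) h x := (hh x).mdifferentiableAt (by simp)

theorem SmoothFun.coord {h : X → ℝ} (hh : SmoothFun d h) (he : e ∈ SmoothCharts d X) :
    ContDiffOn ℝ (⊤ : ℕ∞) (fun y => h (e.symm y)) e.target :=
  contDiffOn_comp_symm he hh.contMDiffOn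

theorem lieD_coord (he : e ∈ SmoothCharts d X) (Z : (x : X) → Tan d x) {h : X → ℝ}
    {y : Coord d} (hy : y ∈ e.target)
    (hh : MDifferentiableAt 𝓘(ℝ, Coord d) 𝓘(ℝ, ℝ) h (e.symm y)) :
    lieD Z h (e.symm y) = ∑ i, compE e Z y i * pderiv i (fun z => h (e.symm z)) y := by
  rw [← fderiv_eq_sum_pderiv, fderiv_comp_symm he hy hh, compE, dInv_dChart he hy]
  rfl

theorem gramE_mulVec_grad (g : SmoothMetric d X) (he : e ∈ SmoothCharts d X) {h : X → ℝ}
    {y : Coord d} (hy : y ∈ e.target)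
    (hh : MDifferentiableAt 𝓘(ℝ, Coord d) 𝓘(ℝ, ℝ) h (e.symm y)) (k : Fin d) :
    ∑ i, gramE g e y k i * compE e (grad g h) y i = pderiv k (fun z => h (e.symm z)) y := by
  have h1 : metricE g e y (EuclideanSpace.single k 1) (compE e (grad g h) y) =
      pderiv k (fun z => h (e.symm z)) y := by
    rw [metricE, compE, dInv_dChart he hy, g.symm, inner_grad]
    exact (fderiv_comp_symm he hy hh _).symm
  rw [← h1, metricE_eq_sum, eq_comm, Finset.sum_eq_single k]
  · exact Finset.sum_congr rfl fun j _ => by simp [mul_comm]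
  · intro b _ hb
    simp [hb]
  · simp

theorem grad_coord (g : SmoothMetric d X) (he : e ∈ SmoothCharts d X) {h : X → ℝ}
    {y : Coord d} (hy : y ∈ e.target)
    (hh : MDifferentiableAt 𝓘(ℝ, Coord d) 𝓘(ℝ, ℝ) h (e.symm y)) (i : Fin d) :
    compE e (grad g h) y i =
      ∑ k, (gramE g e y)⁻¹ i k * pderiv k (fun z => h (e.symm z)) y := by
  have hdet : IsUnit (gramE g e y).det := (posDef_gramE g he hy).det_pos.ne'.isUnit
  have h1 : Matrix.mulVec (gramE g e y) (fun i => compE e (grad g h) y i) =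
      fun k => pderiv k (fun z => h (e.symm z)) y := by
    ext k
    exact gramE_mulVec_grad g he hy hh k
  have h2 := congrArg (Matrix.mulVec (gramE g e y)⁻¹) h1
  rw [Matrix.mulVec_mulVec, Matrix.nonsing_inv_mul _ hdet, Matrix.one_mulVec] at h2
  exact congrFun h2 i

theorem contDiffOn_gramE_inv (g : SmoothMetric d X) (he : e ∈ SmoothCharts d X) (i j : Fin d) :
    ContDiffOn ℝ (⊤ : ℕ∞) (fun y => (gramE g e y)⁻¹ i j) e.target :=
  contDiffOn_matrix_inv (contDiffOn_gramE g he)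
    (fun _ hy => (posDef_gramE g he hy).det_pos.ne') i j

theorem SmoothFun.grad {h : X → ℝ} (g : SmoothMetric d X) (hh : SmoothFun d h) :
    SmoothField (RandomSchroedinger.grad g h) := fun e he i =>
  (ContDiffOn.sum fun k _ => (contDiffOn_gramE_inv g he i k).mul
    (contDiffOn_pderiv e.open_target (hh.coord he) k)).congr
    fun _ hy => grad_coord g he hy (hh.mdiff _) i

theorem SmoothFun.lieD {h : X → ℝ} {Z : (x : X) → Tan d x} (hZ : SmoothField Z)
    (hh : SmoothFun d h) : SmoothFun d (RandomSchroedinger.lieD Z h) :=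
  contMDiff_of_charts fun e he =>
    (ContDiffOn.sum fun i _ => (hZ e he i).mul
      (contDiffOn_pderiv e.open_target (hh.coord he) i)).congr
    fun _ hy => lieD_coord he Z hy (hh.mdiff _)

theorem contDiffOn_divE (g : SmoothMetric d X) {Z : (x : X) → Tan d x} (hZ : SmoothField Z)
    (he : e ∈ SmoothCharts d X) : ContDiffOn ℝ (⊤ : ℕ∞) (divE g e Z) e.target :=
  ((contDiffOn_densityE g he).inv fun _ hy => (densityE_pos g he hy).ne').mul
    (ContDiffOn.sum fun i _ => contDiffOn_pderiv e.open_target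
      ((contDiffOn_densityE g he).mul (hZ e he i)) i)

end Calculus

/-! ### The divergence theorem -/

section DivergenceTheorem

variable {d : ℕ} {X : Type*} [TopologicalSpace X] [ChartedSpace (Coord d) X]
  [IsManifold 𝓘(ℝ, Coord d) (⊤ : ℕ∞) X]
  {e e' : OpenPartialHomeomorph X (Coord d)}

theorem integrableOn_of_zero_off_compact {U K : Set (Coord d)} (hU : IsOpen U)
    (hK : IsCompact K) (hKU : K ⊆ U) {u : Coord d → ℝ} (hu : ContinuousOn u U)
    (h0 : ∀ y ∈ U, y ∉ K → u y = 0) : IntegrableOn u U :=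
  ((hu.mono hKU).integrableOn_compact hK).of_forall_sdiff_eq_zero hU.measurableSet
    fun y hy => h0 y hy.1 hy.2

theorem lieD_eq_zero {Z : (x : X) → Tan d x} {h : X → ℝ} {x : X} (hx : x ∉ tsupport h) :
    lieD Z h x = 0 := by
  have h0 : h =ᶠ[𝓝 x] fun _ => 0 := notMem_tsupport_iff_eventuallyEq.1 hx
  rw [lieD, h0.mfderiv_eq, mfderiv_const]
  rfl

theorem grad_eq_zero (g : SmoothMetric d X) {h : X → ℝ} {x : X} (hx : x ∉ tsupport h) :
    grad g h x = 0 := by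
  have h0 : h =ᶠ[𝓝 x] fun _ => 0 := notMem_tsupport_iff_eventuallyEq.1 hx
  rw [grad, h0.mfderiv_eq, mfderiv_const]
  exact map_zero _

theorem IsTest.of_coord [T2Space X] (he : e ∈ SmoothCharts d X) {u : Coord d → ℝ}
    (hu : ContDiff ℝ (⊤ : ℕ∞) u) (hc : HasCompactSupport u) (hs : tsupport u ⊆ e.target) :
    IsTest d (e.symm '' tsupport u) (e.source.indicator fun x => u (e x)) := by
  have hK : IsCompact (e.symm '' tsupport u) :=
    IsCompact.image_of_continuousOn hc (e.continuousOn_symm.mono hs)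
  have h0 : ∀ x, x ∉ e.symm '' tsupport u → e.source.indicator (fun x => u (e x)) x = 0 := by
    intro x hx
    by_cases hxe : x ∈ e.source
    · rw [Set.indicator_of_mem hxe]
      refine image_eq_zero_of_notMem_tsupport fun h => hx ⟨_, h, e.left_inv hxe⟩
    · exact Set.indicator_of_notMem hxe _
  have hts : tsupport (e.source.indicator fun x => u (e x)) ⊆ e.symm '' tsupport u :=
    closure_minimal (fun y hy => by_contra fun h => hy (h0 y h)) hK.isClosed
  refine ⟨fun x => ?_, hK.of_isClosed_subset (isClosed_tsupport _) hts, hts⟩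
  by_cases hx : x ∈ e.symm '' tsupport u
  · have hxe : x ∈ e.source := by
      obtain ⟨y, hy, rfl⟩ := hx
      exact e.map_target (hs hy)
    have h1 : ContMDiffOn 𝓘(ℝ, Coord d) 𝓘(ℝ, ℝ) (⊤ : ℕ∞) (fun x => u (e x)) e.source :=
      hu.contMDiff.comp_contMDiffOn (contMDiffOn_chart' he)
    refine (h1.contMDiffAt (e.open_source.mem_nhds hxe)).congr_of_eventuallyEq ?_
    filter_upwards [e.open_source.mem_nhds hxe] with z hz using Set.indicator_of_mem hz _
  · have : (e.source.indicator fun x => u (e x)) =ᶠ[𝓝 x] fun _ => 0 := by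
      filter_upwards [hK.isClosed.isOpen_compl.mem_nhds hx] with z hz using h0 z hz
    exact contMDiffAt_const.congr_of_eventuallyEq this

variable [MeasurableSpace X] [BorelSpace X] [SecondCountableTopology X]

/-- In the chart the density of the volume cancels the inverse density in `divE`, and coordinatewise
integration by parts remains. The right-hand side does not mention the chart. -/
theorem integral_mul_divE (g : SmoothMetric d X) (he : e ∈ SmoothCharts d X)
    {Z : (x : X) → Tan d x} (hZ : SmoothField Z) {φ : X → ℝ} (hφ : IsTest d e.source φ) :
    ∫ x, φ x * divE g e Z (e x) ∂(vol g) = - ∫ x, lieD Z φ x ∂(vol g) := by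
  have hsm : SmoothFun d φ := hφ.smooth
  set K := e '' tsupport φ with hKdef
  have hK : IsCompact K := IsCompact.image_of_continuousOn hφ.compact
    (e.continuousOn.mono hφ.subset)
  have hKe : K ⊆ e.target := by
    rintro _ ⟨x, hx, rfl⟩
    exact e.map_source (hφ.subset hx)
  have h0 : ∀ y ∈ e.target, y ∉ K → e.symm y ∉ tsupport φ := fun y hy hyK h =>
    hyK ⟨_, h, e.right_inv hy⟩
  have hρ := contDiffOn_densityE g he
  have hφc := hsm.coord he
  have hdiv := contDiffOn_divE g hZ he
  rw [integral_vol_eq g he, integral_vol_eq g he]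
  · have e1 : ∀ y ∈ e.target, densityE g e y • (φ (e.symm y) * divE g e Z (e (e.symm y))) =
        ∑ i, φ (e.symm y) * pderiv i (fun y => densityE g e y * compE e Z y i) y := by
      intro y hy
      have := (densityE_pos g he hy).ne'
      rw [e.right_inv hy, divE, smul_eq_mul, ← Finset.mul_sum]
      field_simp
    have e2 : ∀ y ∈ e.target, densityE g e y • lieD Z φ (e.symm y) =
        ∑ i, (densityE g e y * compE e Z y i) * pderiv i (fun y => φ (e.symm y)) y := by
      intro y hy
      rw [lieD_coord he Z hy (hsm.mdiff _), smul_eq_mul, Finset.mul_sum]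
      exact Finset.sum_congr rfl fun i _ => by ring
    have hW : ∀ i, ContDiffOn ℝ (⊤ : ℕ∞) (fun y => densityE g e y * compE e Z y i) e.target :=
      fun i => hρ.mul (hZ e he i)
    rw [setIntegral_congr_fun e.open_target.measurableSet e1,
      setIntegral_congr_fun e.open_target.measurableSet e2, integral_finsetSum,
      integral_finsetSum, ← Finset.sum_neg_distrib]
    · refine Finset.sum_congr rfl fun i _ => ?_
      exact integral_mul_pderiv e.open_target hK hKe hφc (hW i)
        (fun y hy hyK => image_eq_zero_of_notMem_tsupport (h0 y hy hyK)) i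
    · intro i _
      refine integrableOn_of_zero_off_compact e.open_target hK hKe
        ((hW i).continuousOn.mul (contDiffOn_pderiv e.open_target hφc i).continuousOn) ?_
      intro y hy hyK
      have hev : (fun y => φ (e.symm y)) =ᶠ[𝓝 y] fun _ => 0 := by
        have hmem : e.target ∩ Kᶜ ∈ 𝓝 y :=
          (e.open_target.inter hK.isClosed.isOpen_compl).mem_nhds ⟨hy, hyK⟩
        filter_upwards [hmem] with z hz
        exact image_eq_zero_of_notMem_tsupport (h0 z hz.1 hz.2)
      simp only [pderiv, hev.fderiv_eq]
      simp
    · intro i _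
      refine integrableOn_of_zero_off_compact e.open_target hK hKe
        (hφc.continuousOn.mul (contDiffOn_pderiv e.open_target (hW i) i).continuousOn) ?_
      intro y hy hyK
      simp [image_eq_zero_of_notMem_tsupport (h0 y hy hyK)]
  · exact (hsm.lieD hZ).continuous.continuousOn
  · exact fun x hx => hφ.subset (by_contra fun h => hx (lieD_eq_zero h))
  · exact hsm.continuous.continuousOn.mul
      (hdiv.continuousOn.comp e.continuousOn fun x hx => e.map_source hx)
  · intro x hx
    refine hφ.subset (by_contra fun h => hx ?_)
    simp [image_eq_zero_of_notMem_tsupport h]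

/-- No computation with second derivatives is needed: by `integral_mul_divE` both expressions have
the same integral against every test function supported in the overlap, so they agree almost
everywhere there, and by continuity everywhere. -/
theorem divE_transit [T2Space X] (g : SmoothMetric d X) (he : e ∈ SmoothCharts d X)
    (he' : e' ∈ SmoothCharts d X) {Z : (x : X) → Tan d x} (hZ : SmoothField Z) {y : Coord d}
    (hy : y ∈ overlap e e') : divE g e' Z (transit e e' y) = divE g e Z y := by
  set O := overlap e e' with hO
  have hOo : IsOpen O := isOpen_overlap e e'
  -- The weight makes Lebesgue integrals in the chart equal to integrals over `X`; it is positive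
  -- and can be divided out at the end.
  set D : Coord d → ℝ := fun y => densityE g e y * (divE g e Z y - divE g e' Z (transit e e' y))
    with hD
  have hρ : ContinuousOn (densityE g e) O :=
    (contDiffOn_densityE g he).continuousOn.mono Set.inter_subset_left
  have hτ : ContinuousOn (transit e e') O := (contDiffOn_transit he he').continuousOn
  have hd1 : ContinuousOn (divE g e Z) O :=
    (contDiffOn_divE g hZ he).continuousOn.mono Set.inter_subset_left
  have hd2 : ContinuousOn (fun y => divE g e' Z (transit e e' y)) O :=
    (contDiffOn_divE g hZ he').continuousOn.comp hτ fun z hz => (transit_mem e e' hz).1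
  have hDc : ContinuousOn D O := hρ.mul (hd1.sub hd2)
  have hae : ∀ᵐ y, y ∈ O → D y = 0 := by
    refine hOo.ae_eq_zero_of_integral_contDiff_smul_eq_zero
      (hDc.locallyIntegrableOn hOo.measurableSet) fun u hu hc hs => ?_
    have hst : tsupport u ⊆ e.target := fun z hz => (hs hz).1
    set φ : X → ℝ := e.source.indicator fun x => u (e x) with hφ
    have hT := IsTest.of_coord he hu hc hst
    have hT1 : IsTest d e.source φ := ⟨hT.smooth, hT.compact, hT.subset.trans (by
      rintro _ ⟨z, hz, rfl⟩; exact e.map_target (hst hz))⟩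
    have hT2 : IsTest d e'.source φ := ⟨hT.smooth, hT.compact, hT.subset.trans (by
      rintro _ ⟨z, hz, rfl⟩; exact (hs hz).2)⟩
    have h1 := integral_mul_divE g he hZ hT1
    have h2 := integral_mul_divE g he' hZ hT2
    have hsupp : ∀ x, φ x ≠ 0 → x ∈ e.source ∩ e'.source := fun x hx =>
      ⟨hT1.subset (subset_tsupport _ hx), hT2.subset (subset_tsupport _ hx)⟩
    have hsm : SmoothFun d φ := hT.smooth
    rw [← h2] at h1
    rw [integral_vol_eq g he, integral_vol_eq g he] at h1
    · have key : ∀ y ∈ e.target, φ (e.symm y) = u y := fun y hy => by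
        rw [hφ, Set.indicator_of_mem (e.map_target hy), e.right_inv hy]
      have hu0 : ∀ y, y ∉ tsupport u → u y = 0 := fun y => image_eq_zero_of_notMem_tsupport
      have i1 : IntegrableOn (fun y => densityE g e y • (φ (e.symm y) * divE g e Z (e (e.symm y))))
          e.target := by
        refine (integrableOn_of_zero_off_compact e.open_target hc hst
          (u := fun y => densityE g e y * (u y * divE g e Z y)) ?_ ?_).congr_fun ?_
          e.open_target.measurableSet
        · exact (contDiffOn_densityE g he).continuousOn.mul
            (hu.continuous.continuousOn.mul (contDiffOn_divE g hZ he).continuousOn)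
        · intro y _ hy
          simp [hu0 y hy]
        · intro y hy
          simp only [key y hy, e.right_inv hy, smul_eq_mul]
      have i2 : IntegrableOn
          (fun y => densityE g e y • (φ (e.symm y) * divE g e' Z (e' (e.symm y)))) e.target := by
        have : IntegrableOn (fun y => densityE g e y * (u y * divE g e' Z (transit e e' y))) O := by
          refine integrableOn_of_zero_off_compact hOo hc hs ?_ ?_
          · exact hρ.mul (hu.continuous.continuousOn.mul hd2)
          · intro y _ hy
            simp [hu0 y hy]
        refine (this.of_forall_sdiff_eq_zero e.open_target.measurableSet ?_).congr_fun ?_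
          e.open_target.measurableSet
        · intro y hy
          simp [hu0 y fun h => hy.2 (hs h)]
        · intro y hy
          simp only [key y hy, smul_eq_mul, transit]
      rw [← sub_eq_zero, ← integral_sub i1 i2] at h1
      rw [← setIntegral_eq_integral_of_forall_compl_eq_zero (s := e.target), ← h1]
      · refine setIntegral_congr_fun e.open_target.measurableSet fun y hy => ?_
        simp only [key y hy, e.right_inv hy, smul_eq_mul, hD, transit]
        ring
      · intro y hy
        simp [hu0 y fun h => hy (hst h)]
    · have hc2 : ContinuousOn (fun x => divE g e' Z (e' x)) e'.source :=
        (contDiffOn_divE g hZ he').continuousOn.comp e'.continuousOn fun x hx => e'.map_source hx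
      refine Continuous.continuousOn (continuous_iff_continuousAt.2 fun x => ?_)
      by_cases hx : x ∈ tsupport φ
      · exact hsm.continuous.continuousAt.mul
          (hc2.continuousAt (e'.open_source.mem_nhds (hT2.subset hx)))
      · have : (fun x => φ x * divE g e' Z (e' x)) =ᶠ[𝓝 x] fun _ => 0 := by
          filter_upwards [notMem_tsupport_iff_eventuallyEq.1 hx] with z hz
          simp [hz]
        exact (continuousAt_const).congr this.symm
    · intro x hx
      exact (hsupp x fun h => hx (by simp [h])).1
    · exact hsm.continuous.continuousOn.mul
        ((contDiffOn_divE g hZ he).continuousOn.comp e.continuousOn fun x hx => e.map_source hx)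
    · intro x hx
      exact (hsupp x fun h => hx (by simp [h])).1
  have hEq : Set.EqOn D (fun _ => 0) O :=
    Measure.eqOn_open_of_ae_eq (μ := volume)
      ((ae_restrict_iff' hOo.measurableSet).2 hae) hOo hDc continuousOn_const
  have h3 := hEq hy
  simp only [hD, mul_eq_zero, (densityE_pos g he hy.1).ne', false_or, sub_eq_zero] at h3
  exact h3.symm

theorem divg_coord [T2Space X] (g : SmoothMetric d X) (he : e ∈ SmoothCharts d X)
    {Z : (x : X) → Tan d x} (hZ : SmoothField Z) {y : Coord d} (hy : y ∈ e.target) :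
    divg g Z (e.symm y) = divE g e Z y :=
  divE_transit g he (chartAt_mem _) hZ ⟨hy, mem_chart_source _ _⟩

theorem smoothFun_divg [T2Space X] (g : SmoothMetric d X) {Z : (x : X) → Tan d x}
    (hZ : SmoothField Z) : SmoothFun d (divg g Z) :=
  contMDiff_of_charts fun _ he => (contDiffOn_divE g hZ he).congr fun _ hy => divg_coord g he hZ hy

theorem divg_eq_zero (g : SmoothMetric d X) {Z : (x : X) → Tan d x} {x : X}
    (hZ : ∀ᶠ z in 𝓝 x, Z z = 0) : divg g Z x = 0 := by
  set e := chartAt (Coord d) x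
  have hx : e x ∈ e.target := mem_chart_target _ x
  have hev : ∀ᶠ y in 𝓝 (e x), Z (e.symm y) = 0 := by
    have := (e.continuousAt_symm hx)
    rw [ContinuousAt, e.left_inv (mem_chart_source _ x)] at this
    exact this.eventually hZ
  rw [divg_eq, divE]
  refine mul_eq_zero_of_right _ (Finset.sum_eq_zero fun i _ => ?_)
  have : (fun y => densityE g e y * compE e Z y i) =ᶠ[𝓝 (e x)] fun _ => 0 := by
    filter_upwards [hev] with y hy
    simp [compE, hy]
  simp only [pderiv]
  rw [this.fderiv_eq]
  simp

end DivergenceTheorem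

/-! ### Test functions -/

section TestFunctions

variable {d : ℕ} {X : Type*} [TopologicalSpace X] [ChartedSpace (Coord d) X]

theorem tsupport_mono {Y W W' : Type*} [TopologicalSpace Y] [Zero W] [Zero W'] {u : Y → W}
    {v : Y → W'} (h : ∀ x, u x = 0 → v x = 0) : tsupport v ⊆ tsupport u :=
  closure_mono fun x hx hu => hx (h x hu)

theorem IsTest.of_subset {W W' : Type*} [NormedAddCommGroup W] [NormedSpace ℝ W]
    [NormedAddCommGroup W'] [NormedSpace ℝ W'] {U : Set X} {u : X → W} {v : X → W'}
    (hu : IsTest d U u) (hv : ContMDiff 𝓘(ℝ, Coord d) 𝓘(ℝ, W') (⊤ : ℕ∞) v)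
    (hs : tsupport v ⊆ tsupport u) : IsTest d U v :=
  ⟨hv, hu.compact.of_isClosed_subset (isClosed_tsupport _) hs, hs.trans hu.subset⟩

theorem IsTest.mono {W : Type*} [NormedAddCommGroup W] [NormedSpace ℝ W] {U U' : Set X} {u : X → W}
    (hu : IsTest d U u) (h : U ⊆ U') : IsTest d U' u := ⟨hu.smooth, hu.compact, hu.subset.trans h⟩

theorem IsTest.re {U : Set X} {u : X → ℂ} (hu : IsTest d U u) : IsTest d U fun x => (u x).re :=
  hu.of_subset (Complex.reCLM.contDiff.contMDiff.comp hu.smooth)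
    (tsupport_mono fun x h => by simp [h])

theorem IsTest.im {U : Set X} {u : X → ℂ} (hu : IsTest d U u) : IsTest d U fun x => (u x).im :=
  hu.of_subset (Complex.imCLM.contDiff.contMDiff.comp hu.smooth)
    (tsupport_mono fun x h => by simp [h])

theorem contMDiff_ofReal {u : X → ℝ} (hu : ContMDiff 𝓘(ℝ, Coord d) 𝓘(ℝ, ℝ) (⊤ : ℕ∞) u) :
    ContMDiff 𝓘(ℝ, Coord d) 𝓘(ℝ, ℂ) (⊤ : ℕ∞) fun x => (u x : ℂ) :=
  Complex.ofRealCLM.contDiff.contMDiff.comp hu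

theorem IsTest.ofReal {U : Set X} {u : X → ℝ} (hu : IsTest d U u) :
    IsTest d U fun x => (u x : ℂ) :=
  hu.of_subset (contMDiff_ofReal hu.smooth) (tsupport_mono fun x h => by simp [h])

theorem IsTest.conj {U : Set X} {u : X → ℂ} (hu : IsTest d U u) :
    IsTest d U fun x => starRingEnd ℂ (u x) :=
  hu.of_subset (Complex.conjCLE.contDiff.contMDiff.comp hu.smooth)
    (tsupport_mono fun x h => by simp [h])

theorem IsTest.mul_left {A : Type*} [NormedRing A] [NormedAlgebra ℝ A] {U : Set X} {f u : X → A}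
    (hu : IsTest d U u) (hf : ContMDiff 𝓘(ℝ, Coord d) 𝓘(ℝ, A) (⊤ : ℕ∞) f) :
    IsTest d U fun x => f x * u x :=
  hu.of_subset ((contDiff_mul (𝕜 := ℝ) (𝔸 := A)).comp_contMDiff (hf.prodMk_space hu.smooth))
    (tsupport_mono fun x h => by simp [h])

theorem IsTest.mul_right {A : Type*} [NormedRing A] [NormedAlgebra ℝ A] {U : Set X} {f u : X → A}
    (hu : IsTest d U u) (hf : ContMDiff 𝓘(ℝ, Coord d) 𝓘(ℝ, A) (⊤ : ℕ∞) f) :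
    IsTest d U fun x => u x * f x :=
  hu.of_subset ((contDiff_mul (𝕜 := ℝ) (𝔸 := A)).comp_contMDiff (hu.smooth.prodMk_space hf))
    (tsupport_mono fun x h => by simp [h])

theorem IsTest.add [T2Space X] {W : Type*} [NormedAddCommGroup W] [NormedSpace ℝ W] {U : Set X} {u v : X → W}
    (hu : IsTest d U u) (hv : IsTest d U v) : IsTest d U fun x => u x + v x := by
  have hs : tsupport (fun x => u x + v x) ⊆ tsupport u ∪ tsupport v := tsupport_add u v
  exact ⟨hu.smooth.add hv.smooth, HasCompactSupport.of_support_subset_isCompact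
    (hu.compact.isCompact.union hv.compact) (subset_closure.trans hs),
    hs.trans (Set.union_subset hu.subset hv.subset)⟩

theorem IsTest.const_mul {U : Set X} {u : X → ℂ} (hu : IsTest d U u) (c : ℂ) :
    IsTest d U fun x => c * u x :=
  hu.mul_left contMDiff_const

theorem IsTest.zero {W : Type*} [NormedAddCommGroup W] [NormedSpace ℝ W] (U : Set X) :
    IsTest d U (fun _ => 0 : X → W) :=
  ⟨contMDiff_const, HasCompactSupport.zero, by simp [tsupport]⟩

theorem IsTest.continuous {W : Type*} [NormedAddCommGroup W] [NormedSpace ℝ W] {U : Set X}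
    {u : X → W} (hu : IsTest d U u) : Continuous u := hu.smooth.continuous

variable [IsManifold 𝓘(ℝ, Coord d) (⊤ : ℕ∞) X] [MeasurableSpace X] [BorelSpace X]
  [SecondCountableTopology X]

theorem integrable_of_isTest {W : Type*} [NormedAddCommGroup W] [NormedSpace ℝ W]
    (g : SmoothMetric d X) {U : Set X} {u : X → W} (hu : IsTest d U u) :
    Integrable u (vol g) :=
  hu.continuous.integrable_of_hasCompactSupport hu.compact

/-! ### Derivatives along vector fields -/

theorem lieD_add {Z : (x : X) → Tan d x} {u v : X → ℝ} (hu : SmoothFun d u) (hv : SmoothFun d v)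
    (x : X) : lieD Z (fun z => u z + v z) x = lieD Z u x + lieD Z v x := by
  unfold lieD
  rw [show (fun z => u z + v z) = u + v from rfl, mfderiv_add (hu.mdiff x) (hv.mdiff x)]
  rfl

theorem lieD_mul {Z : (x : X) → Tan d x} {u v : X → ℝ} (hu : SmoothFun d u) (hv : SmoothFun d v)
    (x : X) : lieD Z (fun z => u z * v z) x = u x * lieD Z v x + v x * lieD Z u x := by
  have h := ((hu.mdiff x).hasMFDerivAt.mul (hv.mdiff x).hasMFDerivAt).mfderiv
  unfold lieD
  rw [show (fun z => u z * v z) = u * v from rfl, h]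
  rfl

theorem SmoothFun.mul {u v : X → ℝ} (hu : SmoothFun d u) (hv : SmoothFun d v) :
    SmoothFun d fun x => u x * v x :=
  (contDiff_mul (𝕜 := ℝ) (𝔸 := ℝ)).comp_contMDiff (hu.prodMk_space hv)

theorem lieD_sum {ι : Type*} {Z : (x : X) → Tan d x} (s : Finset ι) {u : ι → X → ℝ}
    (hu : ∀ i, SmoothFun d (u i)) (x : X) :
    lieD Z (fun z => ∑ i ∈ s, u i z) x = ∑ i ∈ s, lieD Z (u i) x := by
  classical
  induction s using Finset.induction_on with
  | empty =>
    simp only [Finset.sum_empty, lieD]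
    rw [mfderiv_const]
    rfl
  | insert a s ha ih =>
    have hs : SmoothFun d (fun z => ∑ i ∈ s, u i z) := contMDiff_finsetSum fun i _ => hu i
    simp only [Finset.sum_insert ha]
    rw [lieD_add (hu a) hs, ih]

theorem IsTest.lieD {Z : (x : X) → Tan d x} (hZ : SmoothField Z) {U : Set X} {u : X → ℝ}
    (hu : IsTest d U u) : IsTest d U (RandomSchroedinger.lieD Z u) := by
  have hs : SmoothFun d u := hu.smooth
  exact hu.of_subset (hs.lieD hZ) (closure_minimal
    (fun x hx => by_contra fun h => hx (lieD_eq_zero h)) (isClosed_tsupport _))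

/-- The divergence theorem on a manifold without boundary. -/
theorem integral_mul_divg [T2Space X] (g : SmoothMetric d X) {Z : (x : X) → Tan d x}
    (hZ : SmoothField Z) {φ : X → ℝ} (hφ : IsTest d Set.univ φ) :
    ∫ x, φ x * divg g Z x ∂(vol g) = - ∫ x, lieD Z φ x ∂(vol g) := by
  have := ChartedSpace.locallyCompactSpace (Coord d) X
  obtain ⟨ρ, hρ⟩ := SmoothPartitionOfUnity.exists_isSubordinate_chartAt_source
    (I := 𝓘(ℝ, Coord d)) X
  -- Only finitely many members of a partition of unity subordinate to chart domains meet the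
  -- support of `φ`, so `φ` is a finite sum of test functions each living in one chart.
  have hfin := ρ.locallyFinite.finite_nonempty_inter_compact hφ.compact.isCompact
  set s := hfin.toFinset with hs
  have hρs : ∀ i, SmoothFun d (ρ i) := fun i => (ρ i).contMDiff
  have hφs : SmoothFun d φ := hφ.smooth
  have hsum : ∀ x, φ x = ∑ i ∈ s, ρ i x * φ x := by
    intro x
    rw [← Finset.sum_mul]
    by_cases hx : x ∈ tsupport φ
    · have h1 := ρ.sum_eq_one (Set.mem_univ x)
      rw [finsum_eq_sum_of_support_subset (s := s)] at h1
      · rw [h1, one_mul]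
      · intro i hi
        simp only [hs, Set.Finite.coe_toFinset]
        exact ⟨x, hi, hx⟩
    · simp [image_eq_zero_of_notMem_tsupport hx]
  have hT : ∀ i, IsTest d (chartAt (Coord d) i).source fun x => ρ i x * φ x := fun i =>
    have h := hφ.mul_left (hρs i)
    ⟨h.smooth, h.compact, (tsupport_mono fun x h => by simp [h]).trans (hρ i)⟩
  have hone : ∀ i, ∫ x, (ρ i x * φ x) * divg g Z x ∂(vol g) =
      - ∫ x, lieD Z (fun x => ρ i x * φ x) x ∂(vol g) := by
    intro i
    rw [← integral_mul_divE g (chartAt_mem i) hZ (hT i)]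
    congr 1
    ext x
    by_cases hx : x ∈ tsupport fun x => ρ i x * φ x
    · have hxe := (hT i).subset hx
      rw [← divg_coord g (chartAt_mem i) hZ ((chartAt (Coord d) i).map_source hxe),
        (chartAt (Coord d) i).left_inv hxe]
    · have : ρ i x * φ x = 0 :=
        image_eq_zero_of_notMem_tsupport (f := fun x => ρ i x * φ x) hx
      simp [this]
  have e1 : ∀ x, φ x * divg g Z x = ∑ i ∈ s, (ρ i x * φ x) * divg g Z x := fun x => by
    rw [← Finset.sum_mul, ← hsum x]
  have e2 : ∀ x, lieD Z φ x = ∑ i ∈ s, lieD Z (fun x => ρ i x * φ x) x := fun x => by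
    rw [← lieD_sum s (fun i => (hρs i).mul hφs)]
    exact congrArg (fun u => lieD Z u x) (funext hsum)
  simp only [e1, e2]
  rw [integral_finsetSum, integral_finsetSum, ← Finset.sum_neg_distrib]
  · exact Finset.sum_congr rfl fun i _ => hone i
  · exact fun i _ => integrable_of_isTest g ((hT i).lieD hZ)
  · exact fun i _ => integrable_of_isTest g ((hT i).mul_right (smoothFun_divg g hZ))

/-! ### The operators `D` on test functions -/

theorem inner_coord (g₀ : SmoothMetric d X) {e : OpenPartialHomeomorph X (Coord d)}
    (he : e ∈ SmoothCharts d X) (Z Z' : (x : X) → Tan d x) {y : Coord d} (hy : y ∈ e.target) :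
    g₀.inner (e.symm y) (Z (e.symm y)) (Z' (e.symm y)) =
      ∑ i, ∑ j, compE e Z y i * compE e Z' y j * gramE g₀ e y i j := by
  rw [← metricE_eq_sum, metricE, compE, compE, dInv_dChart he hy, dInv_dChart he hy]

theorem smoothFun_inner (g₀ : SmoothMetric d X) {Z Z' : (x : X) → Tan d x} (hZ : SmoothField Z)
    (hZ' : SmoothField Z') : SmoothFun d fun x => g₀.inner x (Z x) (Z' x) :=
  contMDiff_of_charts fun _ he =>
    (ContDiffOn.sum fun i _ => ContDiffOn.sum fun j _ =>
      ((hZ _ he i).mul (hZ' _ he j)).mul (contDiffOn_gramE g₀ he i j)).congr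
    fun _ hy => inner_coord g₀ he Z Z' hy

theorem SmoothFun.laplacian [T2Space X] {h : X → ℝ} (g : SmoothMetric d X) (hh : SmoothFun d h) :
    SmoothFun d (RandomSchroedinger.laplacian g h) := smoothFun_divg g (hh.grad g)

theorem laplacian_eq_zero (g : SmoothMetric d X) {h : X → ℝ} {x : X} (hx : x ∉ tsupport h) :
    RandomSchroedinger.laplacian g h x = 0 :=
  divg_eq_zero g (by
    filter_upwards [(isClosed_tsupport h).isOpen_compl.mem_nhds hx] with z hz
    exact grad_eq_zero g hz)

theorem IsTest.complexify {D : (X → ℝ) → X → ℝ}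
    (hD : ∀ h, SmoothFun d h → SmoothFun d (D h)) (h0 : ∀ h x, x ∉ tsupport h → D h x = 0)
    {U : Set X} {u : X → ℂ} (hu : IsTest d U u) :
    IsTest d U (RandomSchroedinger.complexify D u) ∧
      tsupport (RandomSchroedinger.complexify D u) ⊆ tsupport u := by
  have hs : tsupport (RandomSchroedinger.complexify D u) ⊆ tsupport u := by
    refine closure_minimal (fun x hx => by_contra fun h => hx ?_) (isClosed_tsupport _)
    have h1 : x ∉ tsupport fun z => (u z).re := fun h' =>
      h (tsupport_mono (fun z h => by simp [h]) h')
    have h2 : x ∉ tsupport fun z => (u z).im := fun h' =>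
      h (tsupport_mono (fun z h => by simp [h]) h')
    simp [RandomSchroedinger.complexify, h0 _ _ h1, h0 _ _ h2]
  refine ⟨hu.of_subset ?_ hs, hs⟩
  have h1 := contMDiff_ofReal (hD _ hu.re.smooth)
  have h2 := contMDiff_ofReal (hD _ hu.im.smooth)
  have h3 : ContMDiff 𝓘(ℝ, Coord d) 𝓘(ℝ, ℂ) (⊤ : ℕ∞)
      fun x => Complex.I * (D (fun z => (u z).im) x : ℂ) :=
    (contDiff_mul (𝕜 := ℝ) (𝔸 := ℂ)).comp_contMDiff (contMDiff_const.prodMk_space h2)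
  exact h1.add h3

end TestFunctions

/-! ### Smooth vector fields, the periodic frame, and the operators in `𝓓` on test functions. -/

section Frame

variable {d : ℕ} {X : Type*} [TopologicalSpace X] [ChartedSpace (Coord d) X]
  [IsManifold 𝓘(ℝ, Coord d) (⊤ : ℕ∞) X]

theorem SmoothField.of_contMDiff {Z : (x : X) → Tan d x}
    (hZ : ContMDiff 𝓘(ℝ, Coord d) (𝓘(ℝ, Coord d)).tangent (⊤ : ℕ∞)
      (fun x => (⟨x, Z x⟩ : TangentBundle 𝓘(ℝ, Coord d) X))) : SmoothField Z := by
  intro e he i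
  have h1 := (contMDiffOn_chart' he).contMDiffOn_tangentMapWithin (m := (⊤ : ℕ∞))
    (by simp) e.open_source.uniqueMDiffOn
  have h2 := h1.comp (hZ.comp_contMDiffOn (contMDiffOn_symm_chart he))
    (fun y hy => e.map_target hy)
  have h3 : ContMDiffOn 𝓘(ℝ, Coord d) (𝓘(ℝ, Coord d)).tangent (⊤ : ℕ∞)
      (fun y => (⟨y, compE e Z y⟩ : TangentBundle 𝓘(ℝ, Coord d) (Coord d))) e.target := by
    refine h2.congr fun y hy => ?_
    simp only [Function.comp, tangentMapWithin, compE, dChart]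
    rw [mfderivWithin_of_isOpen e.open_source (e.map_target hy), e.right_inv hy]
    rfl
  have h4 : ContDiffOn ℝ (⊤ : ℕ∞) (compE e Z) e.target :=
    contMDiffOn_vectorSpace_iff_contDiffOn.1 h3
  exact (EuclideanSpace.proj (𝕜 := ℝ) i).contDiff.comp_contDiffOn h4

theorem SmoothField.smul {Z : (x : X) → Tan d x} (hZ : SmoothField Z) {ψ : X → ℝ}
    (hψ : SmoothFun d ψ) : SmoothField fun x => ψ x • Z x := fun e he i =>
  ((hψ.coord he).mul (hZ e he i)).congr fun y _ => by simp [compE]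

variable {Γ : Type*} [Group Γ] [MulAction Γ X] {g₀ : SmoothMetric d X}

namespace PeriodicFrame

variable (P : PeriodicFrame Γ g₀)

theorem smoothField_vec (i : Fin d) (β : Fin P.n) : SmoothField (P.vec i β) :=
  SmoothField.of_contMDiff (P.vec_smooth i β)

theorem smoothField_cut (i : Fin d) (β : Fin P.n) : SmoothField (P.cut i β) :=
  (P.smoothField_vec i β).smul (P.ψ_smooth β)

/-- The real operator underlying `D^{(2,i,β)}`. -/
noncomputable def realD2 (g : SmoothMetric d X) (i : Fin d) (β : Fin P.n) (h : X → ℝ) (x : X) : ℝ :=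
  -2 * g₀.inner x (grad g h x) (P.vec i β x)

variable [MeasurableSpace X] [BorelSpace X] [SecondCountableTopology X] [T2Space X]

theorem smoothFun_realD2 (g : SmoothMetric d X) (i : Fin d) (β : Fin P.n) {h : X → ℝ}
    (hh : SmoothFun d h) : SmoothFun d (P.realD2 g i β h) :=
  SmoothFun.mul contMDiff_const (smoothFun_inner g₀ (hh.grad g) (P.smoothField_vec i β))

theorem realD2_eq_zero (g : SmoothMetric d X) (i : Fin d) (β : Fin P.n) {h : X → ℝ} {x : X}
    (hx : x ∉ tsupport h) : P.realD2 g i β h x = 0 := by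
  rw [realD2, grad_eq_zero g hx]
  simp

theorem isTest_opD1 (g : SmoothMetric d X) {U : Set X} {u : X → ℂ} (hu : IsTest d U u) :
    IsTest d U (P.opD1 g u) ∧ tsupport (P.opD1 g u) ⊆ tsupport u :=
  hu.complexify (fun _ hh => SmoothFun.laplacian g hh) fun _ _ hx => laplacian_eq_zero g hx

theorem isTest_opD2 (g : SmoothMetric d X) (i : Fin d) (β : Fin P.n) {U : Set X} {u : X → ℂ}
    (hu : IsTest d U u) :
    IsTest d U (P.opD2 g i β u) ∧ tsupport (P.opD2 g i β u) ⊆ tsupport u :=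
  hu.complexify (D := P.realD2 g i β) (fun _ hh => P.smoothFun_realD2 g i β hh)
    fun _ _ hx => P.realD2_eq_zero g i β hx

theorem isTest_applyD (g : SmoothMetric d X) (L : DLabel d P.n) {U : Set X} {u : X → ℂ}
    (hu : IsTest d U u) :
    IsTest d U (P.applyD g L u) ∧ tsupport (P.applyD g L u) ⊆ tsupport u := by
  cases L with
  | id => exact ⟨hu, subset_rfl⟩
  | D1 => exact P.isTest_opD1 g hu
  | D2 i β => exact P.isTest_opD2 g i β hu
  | D3 i β =>
    have h1 := P.isTest_opD2 g i β hu
    have h2 := P.isTest_opD1 g h1.1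
    exact ⟨h2.1, h2.2.trans h1.2⟩
  | D4 i β j μ =>
    have h1 := P.isTest_opD2 g i β hu
    have h2 := P.isTest_opD2 g j μ h1.1
    exact ⟨h2.1, h2.2.trans h1.2⟩

end PeriodicFrame

end Frame

/-! ### Isometries -/

section Isometries

variable {d : ℕ} {X : Type*} [TopologicalSpace X] [ChartedSpace (Coord d) X]
  [IsManifold 𝓘(ℝ, Coord d) (⊤ : ℕ∞) X]
  {e : OpenPartialHomeomorph X (Coord d)} {φ : X ≃ₜ X}

/-- The chart `e ∘ φ⁻¹`. -/
def movedChart (φ : X ≃ₜ X) (e : OpenPartialHomeomorph X (Coord d)) :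
    OpenPartialHomeomorph X (Coord d) :=
  φ.symm.transOpenPartialHomeomorph e

theorem movedChart_mem
    (hφ : ContMDiff 𝓘(ℝ, Coord d) 𝓘(ℝ, Coord d) (⊤ : ℕ∞) φ)
    (hφ' : ContMDiff 𝓘(ℝ, Coord d) 𝓘(ℝ, Coord d) (⊤ : ℕ∞) φ.symm)
    (he : e ∈ SmoothCharts d X) : movedChart φ e ∈ SmoothCharts d X := by
  refine OpenPartialHomeomorph.mem_maximalAtlas_of_contMDiffOn (I := 𝓘(ℝ, Coord d)) (n := (⊤ : ℕ∞))
    (movedChart φ e) ?_ ?_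
  · exact (contMDiffOn_chart' he).comp hφ'.contMDiffOn fun x hx => hx
  · exact hφ.comp_contMDiffOn (contMDiffOn_symm_chart he)

theorem ContMDiff.mdiff_map {φ : X → X} (hφ : ContMDiff 𝓘(ℝ, Coord d) 𝓘(ℝ, Coord d) (⊤ : ℕ∞) φ)
    (x : X) : MDifferentiableAt 𝓘(ℝ, Coord d) 𝓘(ℝ, Coord d) φ x :=
  (hφ x).mdifferentiableAt (by simp)

theorem dInv_movedChart (hφ : ContMDiff 𝓘(ℝ, Coord d) 𝓘(ℝ, Coord d) (⊤ : ℕ∞) φ)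
    (he : e ∈ SmoothCharts d X) {y : Coord d} (hy : y ∈ e.target) (v : Coord d) :
    dInv (movedChart φ e) y v =
      mfderiv 𝓘(ℝ, Coord d) 𝓘(ℝ, Coord d) φ (e.symm y) (dInv e y v) :=
  DFunLike.congr_fun (mfderiv_comp y (ContMDiff.mdiff_map hφ _) (mdiffAt_symm he hy)) v

theorem dChart_movedChart (hφ : ContMDiff 𝓘(ℝ, Coord d) 𝓘(ℝ, Coord d) (⊤ : ℕ∞) φ)
    (hφ' : ContMDiff 𝓘(ℝ, Coord d) 𝓘(ℝ, Coord d) (⊤ : ℕ∞) φ.symm)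
    (he : e ∈ SmoothCharts d X) {y : Coord d} (hy : y ∈ e.target) (v : Tan d (e.symm y)) :
    dChart (movedChart φ e) (φ (e.symm y))
      (mfderiv 𝓘(ℝ, Coord d) 𝓘(ℝ, Coord d) φ (e.symm y) v) = dChart e (e.symm y) v := by
  have h := dChart_dInv (movedChart_mem hφ hφ' he) (y := y) hy (dChart e (e.symm y) v)
  rw [dInv_movedChart hφ he hy, dInv_dChart he hy] at h
  exact h

variable {g g' : SmoothMetric d X}

/-- In the transported chart `g'` has the same coefficients as `g` has in the original one.
Everything built from these coefficients is therefore invariant under isometries. -/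
theorem metricE_movedChart (hm : IsMetricMap g g' φ) (he : e ∈ SmoothCharts d X) {y : Coord d}
    (hy : y ∈ e.target) (v w : Coord d) :
    metricE g' (movedChart φ e) y v w = metricE g e y v w := by
  unfold metricE
  rw [dInv_movedChart hm.smooth he hy, dInv_movedChart hm.smooth he hy]
  exact hm.isometric _ _ _

theorem densityE_movedChart (hm : IsMetricMap g g' φ) (he : e ∈ SmoothCharts d X) {y : Coord d}
    (hy : y ∈ e.target) : densityE g' (movedChart φ e) y = densityE g e y := by
  have : gramE g' (movedChart φ e) y = gramE g e y := by
    ext i j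
    exact metricE_movedChart hm he hy _ _
  rw [densityE, this, densityE]

/-- `Z'` is the push-forward of `Z`. -/
def PushForward (φ : X → X) (Z Z' : (x : X) → Tan d x) : Prop :=
  ∀ x, Z' (φ x) = mfderiv 𝓘(ℝ, Coord d) 𝓘(ℝ, Coord d) φ x (Z x)

theorem mfderiv_surjective (hφ : ContMDiff 𝓘(ℝ, Coord d) 𝓘(ℝ, Coord d) (⊤ : ℕ∞) φ)
    (hφ' : ContMDiff 𝓘(ℝ, Coord d) 𝓘(ℝ, Coord d) (⊤ : ℕ∞) φ.symm) (x : X) :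
    Function.Surjective (mfderiv 𝓘(ℝ, Coord d) 𝓘(ℝ, Coord d) φ x) := by
  have h := mfderiv_comp (φ x) (I := 𝓘(ℝ, Coord d)) (I' := 𝓘(ℝ, Coord d)) (I'' := 𝓘(ℝ, Coord d))
    (g := φ) (f := φ.symm) (ContMDiff.mdiff_map hφ _) (ContMDiff.mdiff_map hφ' _)
  rw [show (φ ∘ φ.symm : X → X) = id from funext φ.apply_symm_apply, mfderiv_id] at h
  intro w
  have key : ∀ z : X, z = x → ∀ L : Coord d →L[ℝ] Coord d,
      L = (mfderiv 𝓘(ℝ, Coord d) 𝓘(ℝ, Coord d) φ z : Coord d →L[ℝ] Coord d) →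
      L = (mfderiv 𝓘(ℝ, Coord d) 𝓘(ℝ, Coord d) φ x : Coord d →L[ℝ] Coord d) := by
    rintro z rfl L hL; exact hL
  refine ⟨mfderiv 𝓘(ℝ, Coord d) 𝓘(ℝ, Coord d) φ.symm (φ x) w, ?_⟩
  have h1 := key _ (φ.symm_apply_apply x) _ rfl
  have h2 := DFunLike.congr_fun h w
  rw [← h1]
  exact h2.symm

/-- Both vectors have the same scalar product with every `dφ v`. These exhaust the tangent space,
and the metric is definite. -/
theorem pushForward_grad (hm : IsMetricMap g g' φ)
    (hφ' : ContMDiff 𝓘(ℝ, Coord d) 𝓘(ℝ, Coord d) (⊤ : ℕ∞) φ.symm) {h h' : X → ℝ}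
    (hh : SmoothFun d h') (hc : ∀ x, h' (φ x) = h x) :
    PushForward φ (grad g h) (grad g' h') := by
  intro x
  have hc' : h = h' ∘ φ := funext fun x => (hc x).symm
  have key : ∀ v : Tan d x, g'.inner (φ x) (grad g' h' (φ x))
      (mfderiv 𝓘(ℝ, Coord d) 𝓘(ℝ, Coord d) φ x v) =
      g'.inner (φ x) (mfderiv 𝓘(ℝ, Coord d) 𝓘(ℝ, Coord d) φ x (grad g h x))
        (mfderiv 𝓘(ℝ, Coord d) 𝓘(ℝ, Coord d) φ x v) := by
    intro v
    rw [inner_grad, hm.isometric, inner_grad, hc',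
      mfderiv_comp x (hh.mdiff (φ x)) (ContMDiff.mdiff_map hm.smooth x)]
    rfl
  by_contra hne
  have h1 := g'.pos _ _ (sub_ne_zero.2 hne)
  obtain ⟨v, hv⟩ := mfderiv_surjective hm.smooth hφ' x
    (grad g' h' (φ x) - mfderiv 𝓘(ℝ, Coord d) 𝓘(ℝ, Coord d) φ x (grad g h x))
  have h2 := key v
  rw [hv, ← sub_eq_zero, ← sub_apply, ← map_sub] at h2
  exact h1.ne' h2

/-- By independence of the chart, the divergence at `φ x` may be computed in the transported chart,
where the formula is literally the one at `x`. -/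
theorem divg_pushForward [MeasurableSpace X] [BorelSpace X] [SecondCountableTopology X] [T2Space X]
    (hm : IsMetricMap g g' φ)
    (hφ' : ContMDiff 𝓘(ℝ, Coord d) 𝓘(ℝ, Coord d) (⊤ : ℕ∞) φ.symm) {Z Z' : (x : X) → Tan d x}
    (hZ' : SmoothField Z') (hp : PushForward φ Z Z') (x : X) :
    divg g' Z' (φ x) = divg g Z x := by
  set e := chartAt (Coord d) x with hedef
  have he : e ∈ SmoothCharts d X := chartAt_mem x
  have hx : e x ∈ e.target := mem_chart_target _ x
  have h1 := divg_coord g' (movedChart_mem hm.smooth hφ' he) hZ' (y := e x) hx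
  have h2 : (movedChart φ e).symm (e x) = φ x := congrArg φ (e.left_inv (mem_chart_source _ x))
  rw [h2] at h1
  rw [h1, divg_eq, divE, divE, densityE_movedChart hm he hx]
  congr 1
  refine Finset.sum_congr rfl fun i _ => ?_
  refine pderiv_congr e.open_target (fun y hy => ?_) i hx
  have h3 : compE (movedChart φ e) Z' y = compE e Z y := by
    have := dChart_movedChart hm.smooth hφ' he hy (Z (e.symm y))
    rw [← hp] at this
    exact this
  simp only [densityE_movedChart hm he hy, h3]
  rfl

theorem laplacian_pushForward [MeasurableSpace X] [BorelSpace X] [SecondCountableTopology X]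
    [T2Space X] (hm : IsMetricMap g g' φ)
    (hφ' : ContMDiff 𝓘(ℝ, Coord d) 𝓘(ℝ, Coord d) (⊤ : ℕ∞) φ.symm) {h h' : X → ℝ}
    (hh : SmoothFun d h') (hc : ∀ x, h' (φ x) = h x) (x : X) :
    laplacian g' h' (φ x) = laplacian g h x :=
  divg_pushForward hm hφ' (hh.grad g') (pushForward_grad hm hφ' hh hc) x

end Isometries

/-! ### Equivariance of the operators in `𝓓` and of the frame divergences under the group. -/

section Equivariance

variable {d : ℕ} {X : Type*} [TopologicalSpace X] [ChartedSpace (Coord d) X]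
  [IsManifold 𝓘(ℝ, Coord d) (⊤ : ℕ∞) X] [MeasurableSpace X] [BorelSpace X]
  [SecondCountableTopology X] [T2Space X]
  {Γ : Type*} [Group Γ] [MulAction Γ X] {g₀ : SmoothMetric d X}

/-- The homeomorphism given by a group element. -/
def PeriodicAction.homeo (hΓ : PeriodicAction Γ g₀) (γ : Γ) : X ≃ₜ X where
  toEquiv := MulAction.toPerm γ
  continuous_toFun := (hΓ.isometric γ).smooth.continuous
  continuous_invFun := (hΓ.isometric γ⁻¹).smooth.continuous

variable {g g' : SmoothMetric d X} {γ : Γ}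

theorem complexify_equivariant {D D' : (X → ℝ) → X → ℝ}
    (hD : ∀ h h' : X → ℝ, SmoothFun d h' → (∀ x, h' (γ • x) = h x) →
      ∀ x, D' h' (γ • x) = D h x) {U : Set X} {u u' : X → ℂ} (hu : IsTest d U u')
    (hc : ∀ x, u' (γ • x) = u x) (x : X) : complexify D' u' (γ • x) = complexify D u x := by
  unfold complexify
  rw [hD (fun z => (u z).re) (fun z => (u' z).re) hu.re.smooth (fun x => by rw [hc]),
    hD (fun z => (u z).im) (fun z => (u' z).im) hu.im.smooth (fun x => by rw [hc])]

theorem laplacian_equivariant (hΓ : PeriodicAction Γ g₀) (hm : IsMetricMap g g' fun x => γ • x) {h h' : X → ℝ}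
    (hh : SmoothFun d h') (hc : ∀ x, h' (γ • x) = h x) (x : X) :
    laplacian g' h' (γ • x) = laplacian g h x :=
  laplacian_pushForward (φ := hΓ.homeo γ) hm (hΓ.isometric γ⁻¹).smooth hh hc x

theorem realD2_equivariant (hΓ : PeriodicAction Γ g₀) (P : PeriodicFrame Γ g₀)
    (hm : IsMetricMap g g' fun x => γ • x) (i : Fin d) (β : Fin P.n)
    {h h' : X → ℝ} (hh : SmoothFun d h') (hc : ∀ x, h' (γ • x) = h x) (x : X) :
    P.realD2 g' i β h' (γ • x) = P.realD2 g i β h x := by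
  have h1 := pushForward_grad (φ := hΓ.homeo γ) hm (hΓ.isometric γ⁻¹).smooth hh hc x
  have h2 := (hΓ.isometric γ).isometric x (grad g h x) (P.vec i β x)
  rw [P.vec_periodic] at h2
  unfold PeriodicFrame.realD2
  rw [← h2]
  congr 1
  exact congrArg (fun w => g₀.inner (γ • x) w (P.vec i β (γ • x))) h1

theorem applyD_equivariant (hΓ : PeriodicAction Γ g₀) (P : PeriodicFrame Γ g₀)
    (hm : IsMetricMap g g' fun x => γ • x) (L : DLabel d P.n) {U : Set X}
    {u u' : X → ℂ} (hu : IsTest d U u') (hc : ∀ x, u' (γ • x) = u x) (x : X) :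
    P.applyD g' L u' (γ • x) = P.applyD g L u x := by
  have h1 : ∀ {u u' : X → ℂ}, IsTest d U u' → (∀ x, u' (γ • x) = u x) → ∀ x,
      P.opD1 g' u' (γ • x) = P.opD1 g u x := fun hu hc x =>
    complexify_equivariant (fun h h' hh hc => laplacian_equivariant hΓ hm hh hc) hu hc x
  have h2 : ∀ i β, ∀ {u u' : X → ℂ}, IsTest d U u' → (∀ x, u' (γ • x) = u x) → ∀ x,
      P.opD2 g' i β u' (γ • x) = P.opD2 g i β u x := fun i β _ _ hu hc x =>
    complexify_equivariant (D := P.realD2 g i β) (D' := P.realD2 g' i β)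
      (fun h h' hh hc => realD2_equivariant hΓ P hm i β hh hc) hu hc x
  cases L with
  | id => exact hc x
  | D1 => exact h1 hu hc x
  | D2 i β => exact h2 i β hu hc x
  | D3 i β => exact h1 (P.isTest_opD2 g' i β hu).1 (h2 i β hu hc) x
  | D4 i β j μ => exact h2 j μ (P.isTest_opD2 g' i β hu).1 (h2 i β hu hc) x

theorem applyWord_equivariant (hΓ : PeriodicAction Γ g₀) (P : PeriodicFrame Γ g₀)
    (hm : IsMetricMap g g' fun x => γ • x) (D : List (DLabel d P.n))
    {U : Set X} {u u' : X → ℂ} (hu : IsTest d U u') (hc : ∀ x, u' (γ • x) = u x) :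
    (IsTest d U (P.applyWord g' D u')) ∧
      ∀ x, P.applyWord g' D u' (γ • x) = P.applyWord g D u x := by
  induction D with
  | nil => exact ⟨hu, hc⟩
  | cons L D ih => exact ⟨(P.isTest_applyD g' L ih.1).1, applyD_equivariant hΓ P hm L ih.1 ih.2⟩

theorem divg_cut_equivariant (hΓ : PeriodicAction Γ g₀) (P : PeriodicFrame Γ g₀)
    (hm : IsMetricMap g g' fun x => γ • x) (i : Fin d) (β : Fin P.n)
    (x : X) : divg g' (P.cut i β) (γ • x) = divg g (P.cut i β) x := by
  refine divg_pushForward (φ := hΓ.homeo γ) hm (hΓ.isometric γ⁻¹).smooth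
    (P.smoothField_cut i β) (fun x => ?_) x
  change P.cut i β (γ • x) = mfderiv 𝓘(ℝ, Coord d) 𝓘(ℝ, Coord d) (fun z => γ • z) x (P.cut i β x)
  rw [PeriodicFrame.cut, PeriodicFrame.cut, map_smul, P.vec_periodic, P.ψ_periodic]

end Equivariance

/-! ### Tensoriality of the covariant derivative -/

section Christoffel

variable {d : ℕ} {X : Type*} [TopologicalSpace X] [ChartedSpace (Coord d) X]
  [IsManifold 𝓘(ℝ, Coord d) (⊤ : ℕ∞) X] {e e' : OpenPartialHomeomorph X (Coord d)}

theorem metricE_add_left (g : SmoothMetric d X) (e : OpenPartialHomeomorph X (Coord d))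
    (y v v' w : Coord d) : metricE g e y (v + v') w = metricE g e y v w + metricE g e y v' w := by
  simp only [metricE, map_add, add_apply]

theorem metricE_sub_left (g : SmoothMetric d X) (e : OpenPartialHomeomorph X (Coord d))
    (y v v' w : Coord d) : metricE g e y (v - v') w = metricE g e y v w - metricE g e y v' w := by
  simp only [metricE, map_sub, sub_apply]

theorem fderiv_metricE_comp (g : SmoothMetric d X) (he : e ∈ SmoothCharts d X)
    {p a b : Coord d → Coord d} {y : Coord d} (hy : p y ∈ e.target)
    (hp : DifferentiableAt ℝ p y) (ha : DifferentiableAt ℝ a y) (hb : DifferentiableAt ℝ b y)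
    (v : Coord d) :
    fderiv ℝ (fun z => metricE g e (p z) (a z) (b z)) y v =
      fderiv ℝ (fun q => metricE g e q (a y) (b y)) (p y) (fderiv ℝ p y v) +
      metricE g e (p y) (fderiv ℝ a y v) (b y) + metricE g e (p y) (a y) (fderiv ℝ b y v) := by
  have hG : ∀ i j, DifferentiableAt ℝ (fun q => gramE g e q i j) (p y) := fun i j =>
    contDiffOn_differentiableAt e.open_target (contDiffOn_gramE g he i j) hy
  have hai : ∀ i, HasFDerivAt (fun z => a z i)
      ((EuclideanSpace.proj i : Coord d →L[ℝ] ℝ).comp (fderiv ℝ a y)) y := fun i =>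
    (EuclideanSpace.proj i : Coord d →L[ℝ] ℝ).hasFDerivAt.comp y ha.hasFDerivAt
  have hbi : ∀ i, HasFDerivAt (fun z => b z i)
      ((EuclideanSpace.proj i : Coord d →L[ℝ] ℝ).comp (fderiv ℝ b y)) y := fun i =>
    (EuclideanSpace.proj i : Coord d →L[ℝ] ℝ).hasFDerivAt.comp y hb.hasFDerivAt
  have h1 := HasFDerivAt.fun_sum (u := Finset.univ) fun i _ =>
    HasFDerivAt.fun_sum (u := Finset.univ) fun j _ =>
      ((hai i).mul (hbi j)).mul ((hG i j).hasFDerivAt.comp y hp.hasFDerivAt)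
  have h2 := HasFDerivAt.fun_sum (u := Finset.univ) fun i _ =>
    HasFDerivAt.fun_sum (u := Finset.univ) fun j _ =>
      ((hG i j).hasFDerivAt.const_mul (a y i * b y j))
  have e1 : (fun z => metricE g e (p z) (a z) (b z)) =
      fun z => ∑ i, ∑ j, a z i * b z j * gramE g e (p z) i j :=
    funext fun z => metricE_eq_sum g e _ _ _
  have e2 : (fun q => metricE g e q (a y) (b y)) =
      fun q => ∑ i, ∑ j, a y i * b y j * gramE g e q i j :=
    funext fun z => metricE_eq_sum g e _ _ _
  have h1' := h1.fderiv
  simp only [Function.comp_apply] at h1'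
  rw [e1, e2, h2.fderiv]
  erw [h1']
  rw [metricE_eq_sum, metricE_eq_sum]
  simp only [sum_apply, ← Finset.sum_add_distrib]
  refine Finset.sum_congr rfl fun i _ => Finset.sum_congr rfl fun j _ => ?_
  simp
  ring

/-- The vector with the components `Γ^a_{bc} v^b w^c`. -/
noncomputable def chr (g : SmoothMetric d X) (x₀ : X) (y v w : Coord d) : Coord d :=
  WithLp.toLp 2 fun a => ∑ b, ∑ c, christoffel g x₀ a b c y * v b * w c

theorem fderiv_metricE_eq_sum (g : SmoothMetric d X) (he : e ∈ SmoothCharts d X) {y : Coord d}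
    (hy : y ∈ e.target) (v w z : Coord d) :
    fderiv ℝ (fun q => metricE g e q w z) y v =
      ∑ b, ∑ c, ∑ f, v b * w c * z f * pderiv b (fun q => gramE g e q c f) y := by
  have hG : ∀ c f, DifferentiableAt ℝ (fun q => gramE g e q c f) y := fun c f =>
    contDiffOn_differentiableAt e.open_target (contDiffOn_gramE g he c f) hy
  rw [fderiv_eq_sum_pderiv]
  refine Finset.sum_congr rfl fun b _ => ?_
  have h1 : pderiv b (fun q => metricE g e q w z) y =
      ∑ c, ∑ f, w c * z f * pderiv b (fun q => gramE g e q c f) y := by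
    simp only [pderiv, metricE_eq_sum]
    rw [fderiv_fun_sum fun c _ => DifferentiableAt.fun_sum fun f _ => (hG c f).const_mul _]
    simp only [sum_apply]
    refine Finset.sum_congr rfl fun c _ => ?_
    rw [fderiv_fun_sum fun f _ => (hG c f).const_mul _]
    simp only [sum_apply]
    refine Finset.sum_congr rfl fun f _ => ?_
    rw [fderiv_const_mul (hG c f)]
    simp
  rw [h1, Finset.mul_sum]
  refine Finset.sum_congr rfl fun c _ => ?_
  rw [Finset.mul_sum]
  exact Finset.sum_congr rfl fun f _ => by ring

theorem gramE_mul_christoffel (g : SmoothMetric d X) (x₀ : X) {y : Coord d}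
    (hy : y ∈ (chartAt (Coord d) x₀).target) (f b c : Fin d) :
    ∑ a, gramE g (chartAt (Coord d) x₀) y f a * christoffel g x₀ a b c y =
      (1 / 2) * (pderiv b (fun z => gramE g (chartAt (Coord d) x₀) z f c) y
        + pderiv c (fun z => gramE g (chartAt (Coord d) x₀) z f b) y
        - pderiv f (fun z => gramE g (chartAt (Coord d) x₀) z b c) y) := by
  set G := gramE g (chartAt (Coord d) x₀) with hG
  have hdet : IsUnit (G y).det := (posDef_gramE g (chartAt_mem x₀) hy).det_pos.ne'.isUnit
  set S : Fin d → ℝ := fun e => pderiv b (fun z => G z e c) y + pderiv c (fun z => G z e b) y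
      - pderiv e (fun z => G z b c) y with hS
  have h1 : ∀ a, christoffel g x₀ a b c y = (1 / 2) * ((G y)⁻¹.mulVec S) a := fun a => rfl
  have h2 : ∑ a, G y f a * christoffel g x₀ a b c y =
      (1 / 2) * ((G y).mulVec ((G y)⁻¹.mulVec S)) f := by
    simp only [h1, Matrix.mulVec, dotProduct, Finset.mul_sum]
    refine Finset.sum_congr rfl fun a _ => Finset.sum_congr rfl fun e _ => by ring
  rw [h2, Matrix.mulVec_mulVec, Matrix.mul_nonsing_inv _ hdet, Matrix.one_mulVec]

/-- The Koszul formula for constant coordinate fields. It determines `chr` through the metric alone,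
so that the transformation law can be derived from that of the metric. -/
theorem metricE_chr (g : SmoothMetric d X) (x₀ : X) {y : Coord d}
    (hy : y ∈ (chartAt (Coord d) x₀).target) (v w z : Coord d) :
    2 * metricE g (chartAt (Coord d) x₀) y (chr g x₀ y v w) z =
      fderiv ℝ (fun q => metricE g (chartAt (Coord d) x₀) q w z) y v
      + fderiv ℝ (fun q => metricE g (chartAt (Coord d) x₀) q v z) y w
      - fderiv ℝ (fun q => metricE g (chartAt (Coord d) x₀) q v w) y z := by
  have he := chartAt_mem (d := d) x₀
  set e := chartAt (Coord d) x₀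
  have h1 : 2 * metricE g e y (chr g x₀ y v w) z = ∑ b, ∑ c, ∑ f, v b * w c * z f *
      (2 * ∑ a, gramE g e y f a * christoffel g x₀ a b c y) := by
    rw [metricE_symm, metricE_eq_sum]
    simp only [chr, Finset.mul_sum, Finset.sum_mul]
    calc _ = ∑ f, ∑ b, ∑ c, ∑ a, 2 * (z f * (christoffel g x₀ a b c y * v b * w c) *
          gramE g e y f a) := by
          refine Finset.sum_congr rfl fun f _ => ?_
          rw [Finset.sum_comm]
          refine Finset.sum_congr rfl fun b _ => ?_
          rw [Finset.sum_comm]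
      _ = ∑ b, ∑ f, ∑ c, ∑ a, 2 * (z f * (christoffel g x₀ a b c y * v b * w c) *
          gramE g e y f a) := Finset.sum_comm
      _ = _ := by
          refine Finset.sum_congr rfl fun b _ => ?_
          rw [Finset.sum_comm]
          refine Finset.sum_congr rfl fun c _ => Finset.sum_congr rfl fun f _ =>
            Finset.sum_congr rfl fun a _ => by ring
  rw [h1, fderiv_metricE_eq_sum g he hy, fderiv_metricE_eq_sum g he hy,
    fderiv_metricE_eq_sum g he hy]
  have h2 : ∑ b, ∑ c, ∑ f, w b * v c * z f * pderiv b (fun q => gramE g e q c f) y =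
      ∑ b, ∑ c, ∑ f, v b * w c * z f * pderiv c (fun q => gramE g e q f b) y := by
    rw [Finset.sum_comm]
    refine Finset.sum_congr rfl fun b _ => Finset.sum_congr rfl fun c _ =>
      Finset.sum_congr rfl fun f _ => ?_
    simp only [gramE_symm g e _ f b]
    ring
  have h3 : ∑ b, ∑ c, ∑ f, z b * v c * w f * pderiv b (fun q => gramE g e q c f) y =
      ∑ b, ∑ c, ∑ f, v b * w c * z f * pderiv f (fun q => gramE g e q b c) y := by
    rw [Finset.sum_comm]
    refine Finset.sum_congr rfl fun b _ => ?_
    rw [Finset.sum_comm]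
    exact Finset.sum_congr rfl fun c _ => Finset.sum_congr rfl fun f _ => by ring
  rw [h2, h3, ← Finset.sum_add_distrib, ← Finset.sum_sub_distrib]
  refine Finset.sum_congr rfl fun b _ => ?_
  rw [← Finset.sum_add_distrib, ← Finset.sum_sub_distrib]
  refine Finset.sum_congr rfl fun c _ => ?_
  rw [← Finset.sum_add_distrib, ← Finset.sum_sub_distrib]
  refine Finset.sum_congr rfl fun f _ => ?_
  rw [gramE_mul_christoffel g x₀ hy]
  simp only [gramE_symm g e _ c f]
  ring

theorem contDiffOn_fderiv_transit (he : e ∈ SmoothCharts d X) (he' : e' ∈ SmoothCharts d X) :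
    ContDiffOn ℝ (⊤ : ℕ∞) (fderiv ℝ (transit e e')) (overlap e e') :=
  (contDiffOn_transit he he').fderiv_of_isOpen (isOpen_overlap e e') (by simp)

/-- The transformation law of the Christoffel symbols. -/
theorem chr_transit (g : SmoothMetric d X) (x₀ x₁ : X) {y : Coord d}
    (hy : y ∈ overlap (chartAt (Coord d) x₀) (chartAt (Coord d) x₁)) (v w : Coord d) :
    fderiv ℝ (transit (chartAt (Coord d) x₀) (chartAt (Coord d) x₁)) y (chr g x₀ y v w) =
      chr g x₁ (transit (chartAt (Coord d) x₀) (chartAt (Coord d) x₁) y)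
        (fderiv ℝ (transit (chartAt (Coord d) x₀) (chartAt (Coord d) x₁)) y v)
        (fderiv ℝ (transit (chartAt (Coord d) x₀) (chartAt (Coord d) x₁)) y w) +
      fderiv ℝ (fderiv ℝ (transit (chartAt (Coord d) x₀) (chartAt (Coord d) x₁))) y v w := by
  have he := chartAt_mem (d := d) x₀
  have he' := chartAt_mem (d := d) x₁
  set e := chartAt (Coord d) x₀
  set e' := chartAt (Coord d) x₁
  set τ := transit e e' with hτ
  set J := fderiv ℝ τ y with hJ
  set S := fderiv ℝ (fderiv ℝ τ) y with hS
  have hO := isOpen_overlap e e'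
  have hy' := (transit_mem e e' hy).1
  have hτd : DifferentiableAt ℝ τ y := differentiableAt_transit he he' hy
  have hJd : DifferentiableAt ℝ (fderiv ℝ τ) y :=
    contDiffOn_differentiableAt hO (contDiffOn_fderiv_transit he he') hy
  have hJv : ∀ u, DifferentiableAt ℝ (fun z => fderiv ℝ τ z u) y := fun u =>
    hJd.clm_apply (differentiableAt_const u)
  have hJv' : ∀ u v, fderiv ℝ (fun z => fderiv ℝ τ z u) y v = S v u := fun u v => by
    rw [fderiv_clm_apply hJd (differentiableAt_const u)]
    simp [hS]
  have hsymm : ∀ u v, S u v = S v u := by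
    have h1 : ContDiffAt ℝ (⊤ : ℕ∞) τ y := (contDiffOn_transit he he').contDiffAt (hO.mem_nhds hy)
    exact fun u v => h1.isSymmSndFDerivAt (by
      rw [minSmoothness_of_isRCLikeNormedField]; exact WithTop.coe_le_coe.2 le_top) u v
  -- The derivative of the transformation law of the metric; each vector argument contributes a term
  -- with the second derivative `S` of the transition map.
  have hG : ∀ a b u, fderiv ℝ (fun q => metricE g e q a b) y u =
      fderiv ℝ (fun q => metricE g e' q (J a) (J b)) (τ y) (J u) +
      metricE g e' (τ y) (S u a) (J b) + metricE g e' (τ y) (J a) (S u b) := by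
    intro a b u
    have h1 : (fun q => metricE g e q a b) =ᶠ[𝓝 y]
        fun q => metricE g e' (τ q) (fderiv ℝ τ q a) (fderiv ℝ τ q b) := by
      filter_upwards [hO.mem_nhds hy] with q hq
      exact (metricE_transit g he he' hq a b).symm
    rw [h1.fderiv_eq, fderiv_metricE_comp g he' hy' hτd (hJv a) (hJv b), hJv', hJv']
  -- In the Koszul combination the four terms in which `S` acts on `z` cancel in pairs, by symmetry
  -- of `S`, and `2 g'(S v w, J z)` is left.
  have key : ∀ z, metricE g e' (τ y) (J (chr g x₀ y v w)) (J z) =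
      metricE g e' (τ y) (chr g x₁ (τ y) (J v) (J w) + S v w) (J z) := by
    intro z
    have h1 := metricE_chr g x₀ hy.1 v w z
    have h2 := metricE_chr g x₁ hy' (J v) (J w) (J z)
    have h3 := metricE_transit g he he' hy (chr g x₀ y v w) z
    rw [hG, hG, hG, hsymm w v, hsymm z w, hsymm z v,
      metricE_symm g e' (τ y) (J w) (S v z), metricE_symm g e' (τ y) (J v) (S w z)] at h1
    rw [metricE_add_left, h3]
    linarith [metricE_symm g e' (τ y) (S v z) (J w)]
  -- Since `J` is onto, `J z` can be chosen to be the difference of the two sides, and definiteness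
  -- applies.
  by_contra hne
  have h1 := metricE_pos g he' hy' (sub_ne_zero.2 hne)
  set D := J (chr g x₀ y v w) - (chr g x₁ (τ y) (J v) (J w) + S v w) with hD
  have hsurj : J (fderiv ℝ (transit e' e) (τ y) D) = D := by
    have := fderiv_transit_transit he' he (transit_mem e e' hy) D
    rw [transit_transit e e' hy] at this
    exact this
  have h2 := key (fderiv ℝ (transit e' e) (τ y) D)
  rw [hsurj, ← sub_eq_zero] at h2
  have h3 : metricE g e' (τ y) D D = metricE g e' (τ y) (J (chr g x₀ y v w)) D -
      metricE g e' (τ y) (chr g x₁ (τ y) (J v) (J w) + S v w) D :=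
    metricE_sub_left g e' _ _ _ _
  rw [h3, h2] at h1
  exact lt_irrefl _ h1

end Christoffel

/-! ### The covariant derivative of a tensor does not depend on the chart. -/

section Tensors

variable {d : ℕ}

/-- A tensor with one upper and `n` lower indices, applied to `n` vectors. -/
noncomputable def tens {n : ℕ} (T : TensorComp d n) (y : Coord d) (v : Fin n → Coord d) :
    Coord d :=
  WithLp.toLp 2 fun a => ∑ b : Fin n → Fin d, (∏ i, v i (b i)) * T a b y

theorem tens_basis {n : ℕ} (T : TensorComp d n) (y : Coord d) (b : Fin n → Fin d) (a : Fin d) :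
    tens T y (fun i => EuclideanSpace.single (b i) 1) a = T a b y := by
  simp only [tens]
  rw [Finset.sum_eq_single b]
  · simp
  · intro c _ hc
    obtain ⟨i, hi⟩ := Function.ne_iff.1 hc
    rw [Finset.prod_eq_zero (Finset.mem_univ i), zero_mul]
    simp [hi]
  · simp

theorem hasFDerivAt_prod_clm {E : Type*} [NormedAddCommGroup E] [NormedSpace ℝ E] {n : ℕ}
    (q : Fin n → E →L[ℝ] ℝ) (p : E) :
    HasFDerivAt (fun p => ∏ i, q i p) (∑ i, (∏ j ∈ Finset.univ.erase i, q j p) • q i) p :=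
  HasFDerivAt.finsetProd fun i _ => (q i).hasFDerivAt

/-- The tensor is treated as one function of the base point and of its vector arguments jointly. The
covariant derivative is then a directional derivative of this function plus one correction, and the
chain rule handles changes of charts. -/
theorem hasFDerivAt_tens {n : ℕ} {T : TensorComp d n} {y : Coord d}
    (hT : ∀ a b, DifferentiableAt ℝ (T a b) y) (v : Fin n → Coord d) :
    ∃ L : (Coord d × (Fin n → Coord d)) →L[ℝ] Coord d,
      HasFDerivAt (fun p : Coord d × (Fin n → Coord d) => tens T p.1 p.2) L (y, v) ∧
      ∀ w u a, L (w, u) a = ∑ b : Fin n → Fin d, (∏ i, v i (b i)) * fderiv ℝ (T a b) y w +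
        ∑ b : Fin n → Fin d, (∑ i, (∏ j ∈ Finset.univ.erase i, v j (b j)) * u i (b i)) *
          T a b y := by
  classical
  let q : ∀ (i : Fin n) (c : Fin d), (Coord d × (Fin n → Coord d)) →L[ℝ] ℝ := fun i c =>
    (EuclideanSpace.proj c : Coord d →L[ℝ] ℝ).comp
      ((ContinuousLinearMap.proj i : (Fin n → Coord d) →L[ℝ] Coord d).comp
        (ContinuousLinearMap.snd ℝ (Coord d) (Fin n → Coord d)))
  have hprod : ∀ b : Fin n → Fin d, HasFDerivAt
      (fun p : Coord d × (Fin n → Coord d) => ∏ i, p.2 i (b i))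
      (∑ i, (∏ j ∈ Finset.univ.erase i, v j (b j)) • q i (b i)) (y, v) := fun b =>
    hasFDerivAt_prod_clm (fun i => q i (b i)) (y, v)
  have hcomp : ∀ a b, HasFDerivAt (fun p : Coord d × (Fin n → Coord d) => T a b p.1)
      ((fderiv ℝ (T a b) y).comp (ContinuousLinearMap.fst ℝ (Coord d) (Fin n → Coord d))) (y, v) :=
    fun a b => HasFDerivAt.comp (y, v) (f := Prod.fst) (g := T a b) (hT a b).hasFDerivAt
      (ContinuousLinearMap.fst ℝ (Coord d) (Fin n → Coord d)).hasFDerivAt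
  let L0 : Fin d → (Coord d × (Fin n → Coord d)) →L[ℝ] ℝ := fun a =>
    ∑ b : Fin n → Fin d, ((∏ i, v i (b i)) •
      ((fderiv ℝ (T a b) y).comp (ContinuousLinearMap.fst ℝ (Coord d) (Fin n → Coord d))) +
      T a b y • ∑ i, (∏ j ∈ Finset.univ.erase i, v j (b j)) • q i (b i))
  have hL0 : ∀ a, HasFDerivAt (fun p : Coord d × (Fin n → Coord d) =>
      ∑ b : Fin n → Fin d, (∏ i, p.2 i (b i)) * T a b p.1) (L0 a) (y, v) := fun a =>
    HasFDerivAt.fun_sum fun b _ => (hprod b).mul (hcomp a b)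
  refine ⟨(PiLp.continuousLinearEquiv 2 ℝ fun _ : Fin d => ℝ).symm.toContinuousLinearMap.comp
    (ContinuousLinearMap.pi L0), ?_, ?_⟩
  · exact ((PiLp.continuousLinearEquiv 2 ℝ fun _ : Fin d => ℝ).symm.toContinuousLinearMap
      |>.hasFDerivAt).comp _ (hasFDerivAt_pi.2 hL0)
  · intro w u a
    have : ∀ b : Fin n → Fin d, (∑ i, (∏ j ∈ Finset.univ.erase i, v j (b j)) • q i (b i)) (w, u) =
        ∑ i, (∏ j ∈ Finset.univ.erase i, v j (b j)) * u i (b i) := fun b => by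
      simp [q]
    change L0 a (w, u) = _
    rw [← Finset.sum_add_distrib]
    simp only [L0, sum_apply, add_apply, smul_apply, smul_eq_mul]
    refine Finset.sum_congr rfl fun b _ => ?_
    have h2 := this b
    simp only [sum_apply, smul_apply, smul_eq_mul] at h2
    rw [h2, mul_comm (T a b y)]
    rfl

theorem sum_cons {M : Type*} [AddCommMonoid M] {n : ℕ} (F : (Fin (n + 1) → Fin d) → M) :
    ∑ b, F b = ∑ c, ∑ b : Fin n → Fin d, F (Fin.cons c b) := by
  rw [← Fintype.sum_prod_type', ← (Fin.consEquiv fun _ => Fin d).sum_comp]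
  rfl

/-- Exchanging the `i`-th entry of `b` with the separate index is an involution of the index set. -/
theorem sum_update {n : ℕ} (i : Fin n) (F : (Fin n → Fin d) → Fin d → ℝ) :
    ∑ b : Fin n → Fin d, ∑ c, F b c =
      ∑ b : Fin n → Fin d, ∑ c, F (Function.update b i c) (b i) := by
  rw [← Fintype.sum_prod_type', ← Fintype.sum_prod_type']
  let σ : (Fin n → Fin d) × Fin d → (Fin n → Fin d) × Fin d :=
    fun p => (Function.update p.1 i p.2, p.1 i)
  have hσ : Function.Involutive σ := fun p => by simp [σ]
  exact (Equiv.sum_comp hσ.toPerm fun p : (Fin n → Fin d) × Fin d => F p.1 p.2).symm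

variable {X : Type*} [TopologicalSpace X] [ChartedSpace (Coord d) X]
  [IsManifold 𝓘(ℝ, Coord d) (⊤ : ℕ∞) X]

/-- The lower indices are accounted for by moving each argument with velocity `-chr w (v i)` while
the base point moves along `w`; the upper index gives the added Christoffel term. -/
theorem tens_covDeriv (g : SmoothMetric d X) (x₀ : X) {n : ℕ} {T : TensorComp d n} {y : Coord d}
    (hT : ∀ a b, DifferentiableAt ℝ (T a b) y) (w : Coord d) (v : Fin n → Coord d) :
    tens (covDeriv g x₀ T) y (Fin.cons w v) =
      fderiv ℝ (fun p : Coord d × (Fin n → Coord d) => tens T p.1 p.2) (y, v)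
        (w, fun i => - chr g x₀ y w (v i)) + chr g x₀ y w (tens T y v) := by
  classical
  obtain ⟨L, hL, hLa⟩ := hasFDerivAt_tens hT v
  rw [hL.fderiv]
  ext a
  rw [PiLp.add_apply, hLa]
  have e1 : tens (covDeriv g x₀ T) y (Fin.cons w v) a =
      ∑ b : Fin n → Fin d, ∑ c, (w c * ∏ i, v i (b i)) * pderiv c (T a b) y +
      ∑ b : Fin n → Fin d, ∑ c, (w c * ∏ i, v i (b i)) *
        ∑ e, christoffel g x₀ a c e y * T e b y -
      ∑ i, ∑ b : Fin n → Fin d, ∑ e, (∏ j, v j (b j)) * (∑ c, w c * christoffel g x₀ e c (b i) y) *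
        T a (Function.update b i e) y := by
    have h1 : ∑ i, ∑ b : Fin n → Fin d, ∑ e, (∏ j, v j (b j)) *
        (∑ c, w c * christoffel g x₀ e c (b i) y) * T a (Function.update b i e) y =
        ∑ b : Fin n → Fin d, ∑ c, (w c * ∏ i, v i (b i)) * ∑ i, ∑ e,
          christoffel g x₀ e c (b i) y * T a (Function.update b i e) y := by
      rw [Finset.sum_comm]
      refine Finset.sum_congr rfl fun b _ => ?_
      simp only [Finset.mul_sum, Finset.sum_mul]
      calc _ = ∑ i, ∑ c, ∑ e, (∏ j, v j (b j)) * (w c * christoffel g x₀ e c (b i) y) *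
            T a (Function.update b i e) y := Finset.sum_congr rfl fun i _ => Finset.sum_comm
        _ = _ := by
          rw [Finset.sum_comm]
          refine Finset.sum_congr rfl fun c _ => Finset.sum_congr rfl fun i _ =>
            Finset.sum_congr rfl fun e _ => by ring
    rw [h1, ← Finset.sum_add_distrib, ← Finset.sum_sub_distrib]
    simp only [tens]
    rw [sum_cons, Finset.sum_comm]
    refine Finset.sum_congr rfl fun b _ => ?_
    rw [← Finset.sum_add_distrib, ← Finset.sum_sub_distrib]
    refine Finset.sum_congr rfl fun c _ => ?_
    simp only [Fin.prod_univ_succ, Fin.cons_zero, Fin.cons_succ, covDeriv, Fin.tail_cons]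
    ring
  have e2 : ∑ b : Fin n → Fin d, (∏ i, v i (b i)) * fderiv ℝ (T a b) y w =
      ∑ b : Fin n → Fin d, ∑ c, (w c * ∏ i, v i (b i)) * pderiv c (T a b) y := by
    refine Finset.sum_congr rfl fun b _ => ?_
    rw [fderiv_eq_sum_pderiv, Finset.mul_sum]
    exact Finset.sum_congr rfl fun c _ => by ring
  have e3 : chr g x₀ y w (tens T y v) a = ∑ b : Fin n → Fin d, ∑ c, (w c * ∏ i, v i (b i)) *
        ∑ e, christoffel g x₀ a c e y * T e b y := by
    simp only [chr, tens, Finset.mul_sum]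
    rw [Finset.sum_comm (s := (Finset.univ : Finset (Fin n → Fin d)))]
    refine Finset.sum_congr rfl fun c _ => ?_
    rw [Finset.sum_comm]
    exact Finset.sum_congr rfl fun b _ => Finset.sum_congr rfl fun e _ => by ring
  have e4 : ∑ b : Fin n → Fin d,
      (∑ i, (∏ j ∈ Finset.univ.erase i, v j (b j)) * (-chr g x₀ y w (v i)) (b i)) * T a b y =
      - ∑ i, ∑ b : Fin n → Fin d, ∑ e, (∏ j, v j (b j)) *
        (∑ c, w c * christoffel g x₀ e c (b i) y) * T a (Function.update b i e) y := by
    simp only [Finset.sum_mul]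
    rw [Finset.sum_comm, ← Finset.sum_neg_distrib]
    refine Finset.sum_congr rfl fun i _ => ?_
    rw [sum_update i, ← Finset.sum_neg_distrib]
    refine Finset.sum_congr rfl fun b _ => ?_
    have h1 : ∀ e, ∏ j, v j (Function.update b i e j) =
        v i e * ∏ j ∈ Finset.univ.erase i, v j (b j) := fun e => by
      rw [← Finset.mul_prod_erase Finset.univ _ (Finset.mem_univ i), Function.update_self]
      congr 1
      refine Finset.prod_congr rfl fun j hj => ?_
      rw [Function.update_of_ne (Finset.ne_of_mem_erase hj)]
    simp only [h1, Function.update_self, Function.update_idem, Function.update_eq_self, PiLp.neg_apply,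
      chr, Finset.mul_sum, Finset.sum_mul, mul_neg, neg_mul]
    rw [neg_inj, Finset.sum_comm]
    exact Finset.sum_congr rfl fun e _ => Finset.sum_congr rfl fun c _ => by ring
  rw [e1, e2, e3, e4]
  ring

/-- Two tensor fields in the charts at `x₀` and `x₁` agree on the overlap of these charts. -/
def SameTensor (x₀ x₁ : X) {n : ℕ} (T T' : TensorComp d n) : Prop :=
  ∀ y ∈ overlap (chartAt (Coord d) x₀) (chartAt (Coord d) x₁), ∀ v : Fin n → Coord d,
    fderiv ℝ (transit (chartAt (Coord d) x₀) (chartAt (Coord d) x₁)) y (tens T y v) =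
      tens T' (transit (chartAt (Coord d) x₀) (chartAt (Coord d) x₁) y)
        (fun i => fderiv ℝ (transit (chartAt (Coord d) x₀) (chartAt (Coord d) x₁)) y (v i))

/-- Tensor fields with smooth components in the chart at `x₀`. -/
def SmoothTensor (x₀ : X) {n : ℕ} (T : TensorComp d n) : Prop :=
  ∀ a b, ContDiffOn ℝ (⊤ : ℕ∞) (T a b) (chartAt (Coord d) x₀).target

/-- The relation `J (T v) = T' (J v)` is differentiated jointly in the base point and the vectors.
The second derivatives of the transition map that appear on both sides are exactly the inhomogeneous
terms in the transformation law of the Christoffel symbols. -/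
theorem SameTensor.covDeriv (g : SmoothMetric d X) {x₀ x₁ : X} {n : ℕ} {T T' : TensorComp d n}
    (hT : SmoothTensor x₀ T) (hT' : SmoothTensor x₁ T') (h : SameTensor x₀ x₁ T T') :
    SameTensor x₀ x₁ (covDeriv g x₀ T) (covDeriv g x₁ T') := by
  intro y hy v
  have hΓ := chr_transit g x₀ x₁ hy
  have he := chartAt_mem (d := d) x₀
  have he' := chartAt_mem (d := d) x₁
  set e := chartAt (Coord d) x₀ with hedef
  set e' := chartAt (Coord d) x₁ with hedef'
  set τ := transit e e' with hτ
  have hO := isOpen_overlap e e'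
  have hy' := (transit_mem e e' hy).1
  have hτd : HasFDerivAt τ (fderiv ℝ τ y) y := (differentiableAt_transit he he' hy).hasFDerivAt
  have hJd : HasFDerivAt (fderiv ℝ τ) (fderiv ℝ (fderiv ℝ τ) y) y :=
    (contDiffOn_differentiableAt hO (contDiffOn_fderiv_transit he he') hy).hasFDerivAt
  have hTd : ∀ a b, DifferentiableAt ℝ (T a b) y := fun a b =>
    contDiffOn_differentiableAt e.open_target (hT a b) hy.1
  have hTd' : ∀ a b, DifferentiableAt ℝ (T' a b) (τ y) := fun a b =>
    contDiffOn_differentiableAt e'.open_target (hT' a b) hy'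
  rw [← Fin.cons_self_tail v]
  set w := v 0
  set u := Fin.tail v
  have hcons : (fun i => fderiv ℝ τ y ((Fin.cons w u : Fin (n + 1) → Coord d) i)) =
      Fin.cons (fderiv ℝ τ y w) fun i => fderiv ℝ τ y (u i) := by
    ext i : 1
    refine Fin.cases ?_ (fun i => ?_) i <;> simp
  rw [hcons, tens_covDeriv g x₀ hTd, tens_covDeriv g x₁ hTd', map_add, hΓ, h y hy u]
  set J := fderiv ℝ τ y with hJ
  set S := fderiv ℝ (fderiv ℝ τ) y with hS
  obtain ⟨L, hL, -⟩ := hasFDerivAt_tens hTd u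
  obtain ⟨L', hL', -⟩ := hasFDerivAt_tens hTd' fun i => J (u i)
  rw [hL.fderiv, hL'.fderiv]
  have hfst := (ContinuousLinearMap.fst ℝ (Coord d) (Fin n → Coord d)).hasFDerivAt (x := (y, u))
  have hsnd : ∀ i, HasFDerivAt (fun p : Coord d × (Fin n → Coord d) => p.2 i)
      ((ContinuousLinearMap.proj i : (Fin n → Coord d) →L[ℝ] Coord d).comp
        (ContinuousLinearMap.snd ℝ (Coord d) (Fin n → Coord d))) (y, u) := fun i =>
    ((ContinuousLinearMap.proj i : (Fin n → Coord d) →L[ℝ] Coord d).comp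
        (ContinuousLinearMap.snd ℝ (Coord d) (Fin n → Coord d))).hasFDerivAt
  have hJ1 : HasFDerivAt (fun p : Coord d × (Fin n → Coord d) => fderiv ℝ τ p.1)
      (S.comp (ContinuousLinearMap.fst ℝ (Coord d) (Fin n → Coord d))) (y, u) :=
    HasFDerivAt.comp (y, u) (g := fderiv ℝ τ) (f := Prod.fst) hJd hfst
  have hτ1 : HasFDerivAt (fun p : Coord d × (Fin n → Coord d) => τ p.1)
      (J.comp (ContinuousLinearMap.fst ℝ (Coord d) (Fin n → Coord d))) (y, u) :=
    HasFDerivAt.comp (y, u) (g := τ) (f := Prod.fst) hτd hfst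
  have hl := hJ1.clm_apply hL
  have hΦ := hτ1.prodMk (hasFDerivAt_pi.2 fun i => hJ1.clm_apply (hsnd i))
  have hr := HasFDerivAt.comp (y, u) (g := fun p : Coord d × (Fin n → Coord d) => tens T' p.1 p.2)
    hL' hΦ
  have hev : (fun p : Coord d × (Fin n → Coord d) => fderiv ℝ τ p.1 (tens T p.1 p.2)) =ᶠ[𝓝 (y, u)]
      (fun p : Coord d × (Fin n → Coord d) => tens T' p.1 p.2) ∘
        fun p : Coord d × (Fin n → Coord d) => (τ p.1, fun i => fderiv ℝ τ p.1 (p.2 i)) := by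
    have hmem : overlap e e' ×ˢ (Set.univ : Set (Fin n → Coord d)) ∈ 𝓝 (y, u) :=
      (hO.prod isOpen_univ).mem_nhds ⟨hy, trivial⟩
    filter_upwards [hmem] with p hp using h p.1 hp.1 p.2
  have huniq := DFunLike.congr_fun (hl.unique (hr.congr_of_eventuallyEq hev))
    (w, fun i => - chr g x₀ y w (u i))
  simp only [add_apply, ContinuousLinearMap.comp_apply, ContinuousLinearMap.coe_fst',
    ContinuousLinearMap.flip_apply, ContinuousLinearMap.prod_apply] at huniq
  -- The direction prescribed by `tens_covDeriv` in the first chart is carried to the one prescribed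
  -- in the second: `S w (u i)` from the product rule cancels the same term from `chr_transit`.
  have harg : ((J w, (ContinuousLinearMap.pi fun i =>
      (fderiv ℝ τ y).comp ((ContinuousLinearMap.proj i : (Fin n → Coord d) →L[ℝ] Coord d).comp
        (ContinuousLinearMap.snd ℝ (Coord d) (Fin n → Coord d))) +
      (S.comp (ContinuousLinearMap.fst ℝ (Coord d) (Fin n → Coord d))).flip (u i))
        (w, fun i => - chr g x₀ y w (u i))) : Coord d × (Fin n → Coord d)) =
      (J w, fun i => - chr g x₁ (τ y) (J w) (J (u i))) := by
    congr 1
    ext i : 1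
    simp only [ContinuousLinearMap.coe_pi', add_apply, ContinuousLinearMap.comp_apply,
      ContinuousLinearMap.flip_apply, ContinuousLinearMap.coe_fst', ContinuousLinearMap.coe_snd',
      ContinuousLinearMap.proj_apply, map_neg, ← hJ, hΓ]
    abel
  rw [harg] at huniq
  rw [← huniq]
  abel

end Tensors

/-! ### Pointwise norms of tensors -/

section TensorNorm

variable {d : ℕ}

theorem prod_sum_eq {n : ℕ} (F : Fin n → Fin d → ℝ) :
    ∏ i, ∑ m, F i m = ∑ m : Fin n → Fin d, ∏ i, F i (m i) := by
  rw [Finset.prod_univ_sum, Fintype.piFinset_univ]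

-- Passage to an orthonormal frame: `B` converts components with respect to the coordinate basis
-- into components with respect to a `G`-orthonormal one, and `N` is its inverse. Contractions with
-- `G` and `G⁻¹` become sums of squares.
open scoped MatrixOrder in
theorem exists_factor {G : Matrix (Fin d) (Fin d) ℝ} (hG : G.PosDef) :
    ∃ B N : Matrix (Fin d) (Fin d) ℝ, (∀ a a', G a a' = ∑ c, B c a * B c a') ∧
      (∀ b b', G⁻¹ b b' = ∑ m, N b m * N b' m) ∧ N * B = 1 := by
  obtain ⟨B, hB⟩ := CStarAlgebra.nonneg_iff_eq_star_mul_self.1 hG.posSemidef.nonneg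
  rw [Matrix.star_eq_conjTranspose] at hB
  have hdet : IsUnit B.det := by
    have h := hG.det_pos.ne'
    rw [hB, Matrix.det_mul] at h
    exact (right_ne_zero_of_mul h).isUnit
  have hB' : G = B.transpose * B := by simpa [Matrix.conjTranspose_eq_transpose_of_trivial] using hB
  refine ⟨B, B⁻¹, fun a a' => ?_, fun b b' => ?_, Matrix.nonsing_inv_mul _ hdet⟩
  · conv_lhs => rw [hB']
    simp [Matrix.mul_apply]
  · rw [hB', Matrix.mul_inv_rev, ← Matrix.transpose_nonsing_inv]
    simp [Matrix.mul_apply]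

theorem quad_eq_sum_sq {G B : Matrix (Fin d) (Fin d) ℝ}
    (hB : ∀ a a', G a a' = ∑ c, B c a * B c a') (v : Fin d → ℝ) :
    ∑ i, ∑ j, v i * v j * G i j = ∑ c, (∑ a, B c a * v a) ^ 2 := by
  have h : ∀ c, (∑ a, B c a * v a) ^ 2 = ∑ i, ∑ j, (B c i * v i) * (B c j * v j) := fun c => by
    rw [sq, Finset.sum_mul_sum]
  simp only [hB, h, Finset.mul_sum]
  calc _ = ∑ i, ∑ c, ∑ j, v i * v j * (B c i * B c j) :=
        Finset.sum_congr rfl fun i _ => Finset.sum_comm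
    _ = _ := by
      rw [Finset.sum_comm]
      exact Finset.sum_congr rfl fun c _ => Finset.sum_congr rfl fun i _ =>
        Finset.sum_congr rfl fun j _ => by ring

theorem eq_sum_of_mul_eq_one {N B : Matrix (Fin d) (Fin d) ℝ} (h : N * B = 1) (v : Fin d → ℝ)
    (a : Fin d) : v a = ∑ m, N a m * ∑ c, B m c * v c := by
  have := congrFun (congrArg (fun M => Matrix.mulVec M v) h) a
  simp only [Matrix.one_mulVec, ← Matrix.mulVec_mulVec] at this
  exact this.symm

/-- The component `v a` is the pairing of `v` with a dual basis vector whose squared dual norm is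
`G⁻¹ a a`; Cauchy–Schwarz follows in the orthonormal frame. -/
theorem sq_le_inv_mul_quad {G : Matrix (Fin d) (Fin d) ℝ} (hG : G.PosDef) (v : Fin d → ℝ)
    (a : Fin d) : v a ^ 2 ≤ G⁻¹ a a * ∑ i, ∑ j, v i * v j * G i j := by
  obtain ⟨B, N, hB, hN, hNB⟩ := exists_factor hG
  rw [quad_eq_sum_sq hB, hN, eq_sum_of_mul_eq_one hNB v a]
  refine (Finset.sum_mul_sq_le_sq_mul_sq _ _ _).trans_eq ?_
  simp only [sq]

/-- The Cauchy–Schwarz inequality for tensors. -/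
theorem quad_tensor_le {G : Matrix (Fin d) (Fin d) ℝ} (hG : G.PosDef) {n : ℕ}
    (T : Fin d → (Fin n → Fin d) → ℝ) (v : Fin n → Fin d → ℝ) :
    ∑ i, ∑ j, (∑ b : Fin n → Fin d, (∏ k, v k (b k)) * T i b) *
      (∑ b : Fin n → Fin d, (∏ k, v k (b k)) * T j b) * G i j ≤
    (∑ a : Fin d, ∑ a' : Fin d, ∑ b : Fin n → Fin d, ∑ b' : Fin n → Fin d,
      G a a' * (∏ i : Fin n, G⁻¹ (b i) (b' i)) * T a b * T a' b') *
      ∏ k, ∑ i, ∑ j, v k i * v k j * G i j := by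
  obtain ⟨B, N, hB, hN, hNB⟩ := exists_factor hG
  -- The components of `T` in the orthonormal frame. In it the tensor norm is Euclidean (`h1`) and
  -- evaluation on vectors is a Euclidean contraction (`h2`).
  let U : Fin d → (Fin n → Fin d) → ℝ := fun c m =>
    ∑ a, ∑ b : Fin n → Fin d, (B c a * ∏ i, N (b i) (m i)) * T a b
  have h1 : (∑ a : Fin d, ∑ a' : Fin d, ∑ b : Fin n → Fin d, ∑ b' : Fin n → Fin d,
      G a a' * (∏ i : Fin n, G⁻¹ (b i) (b' i)) * T a b * T a' b') =
      ∑ c, ∑ m, U c m ^ 2 := by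
    have hU : ∀ c m, U c m ^ 2 = ∑ a, ∑ a', ∑ b : Fin n → Fin d, ∑ b' : Fin n → Fin d,
        (B c a * B c a') * ((∏ i, N (b i) (m i)) * ∏ i, N (b' i) (m i)) * T a b * T a' b' := by
      intro c m
      simp only [U, sq, Finset.sum_mul_sum]
      exact Finset.sum_congr rfl fun a _ => Finset.sum_congr rfl fun a' _ =>
        Finset.sum_congr rfl fun b _ => Finset.sum_congr rfl fun b' _ => by ring
    simp only [hU, hB, hN, prod_sum_eq, Finset.prod_mul_distrib]
    calc _ = ∑ a, ∑ a', ∑ b : Fin n → Fin d, ∑ b' : Fin n → Fin d, ∑ c, ∑ m : Fin n → Fin d,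
        (B c a * B c a') * ((∏ i, N (b i) (m i)) * ∏ i, N (b' i) (m i)) * T a b * T a' b' := by
          refine Finset.sum_congr rfl fun a _ => Finset.sum_congr rfl fun a' _ =>
            Finset.sum_congr rfl fun b _ => Finset.sum_congr rfl fun b' _ => ?_
          rw [Finset.sum_mul_sum, Finset.sum_mul, Finset.sum_mul]
          simp only [Finset.sum_mul]
      _ = ∑ p : (Fin d × Fin d) × (Fin n → Fin d) × (Fin n → Fin d),
            ∑ q : Fin d × (Fin n → Fin d),
            (B q.1 p.1.1 * B q.1 p.1.2) * ((∏ i, N (p.2.1 i) (q.2 i)) * ∏ i, N (p.2.2 i) (q.2 i))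
              * T p.1.1 p.2.1 * T p.1.2 p.2.2 := by
          simp only [Fintype.sum_prod_type]
      _ = ∑ q : Fin d × (Fin n → Fin d),
          ∑ p : (Fin d × Fin d) × (Fin n → Fin d) × (Fin n → Fin d),
            (B q.1 p.1.1 * B q.1 p.1.2) * ((∏ i, N (p.2.1 i) (q.2 i)) * ∏ i, N (p.2.2 i) (q.2 i))
              * T p.1.1 p.2.1 * T p.1.2 p.2.2 := Finset.sum_comm
      _ = _ := by simp only [Fintype.sum_prod_type]
  have h2 : ∀ c, ∑ a, B c a * ∑ b : Fin n → Fin d, (∏ k, v k (b k)) * T a b =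
      ∑ m : Fin n → Fin d, (∏ k, ∑ a, B (m k) a * v k a) * U c m := by
    intro c
    have hv : ∀ b : Fin n → Fin d, ∏ k, v k (b k) =
        ∑ m : Fin n → Fin d, (∏ k, N (b k) (m k)) * ∏ k, ∑ a, B (m k) a * v k a := fun b => by
      rw [Finset.prod_congr rfl fun k _ => eq_sum_of_mul_eq_one hNB (v k) (b k), prod_sum_eq]
      simp only [Finset.prod_mul_distrib]
    simp only [hv, U, Finset.mul_sum, Finset.sum_mul]
    calc _ = ∑ a, ∑ m : Fin n → Fin d, ∑ b : Fin n → Fin d, B c a *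
          ((∏ k, N (b k) (m k)) * (∏ k, ∑ a, B (m k) a * v k a) * T a b) :=
          Finset.sum_congr rfl fun a _ => Finset.sum_comm
      _ = _ := by
          rw [Finset.sum_comm]
          exact Finset.sum_congr rfl fun m _ => Finset.sum_congr rfl fun a _ =>
            Finset.sum_congr rfl fun b _ => by ring
  rw [quad_eq_sum_sq hB, h1, Finset.sum_mul]
  refine Finset.sum_le_sum fun c _ => ?_
  rw [h2]
  refine (Finset.sum_mul_sq_le_sq_mul_sq _ _ _).trans_eq ?_
  rw [mul_comm]
  congr 1
  rw [Finset.prod_congr rfl fun k _ => quad_eq_sum_sq hB (v k), prod_sum_eq]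
  exact Finset.sum_congr rfl fun m _ => (Finset.prod_pow _ _ _).symm

end TensorNorm

/-! ### Families of functions with uniformly bounded derivatives: closure under algebraic
operations. -/

section UniformBounds

variable {d : ℕ} {Ω : Type*}

/-- Families of functions whose derivatives up to order `m` are uniformly bounded on `K`. -/
def UBound (K : Set (Coord d)) : ℕ → (Ω → Coord d → ℝ) → Prop
  | 0, h => ∃ C : ℝ, ∀ ω, ∀ y ∈ K, |h ω y| ≤ C
  | m + 1, h => (∃ C : ℝ, ∀ ω, ∀ y ∈ K, |h ω y| ≤ C) ∧ ∀ i, UBound K m fun ω => pderiv i (h ω)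

variable {U K : Set (Coord d)} {h h' : Ω → Coord d → ℝ}

theorem UBound.zero {m : ℕ} (hh : UBound K m h) : ∃ C : ℝ, ∀ ω, ∀ y ∈ K, |h ω y| ≤ C := by
  cases m with
  | zero => exact hh
  | succ m => exact hh.1

theorem UBound.of_succ {m : ℕ} (hh : UBound K (m + 1) h) : UBound K m h := by
  induction m generalizing h with
  | zero => exact hh.1
  | succ m ih => exact ⟨hh.1, fun i => ih (hh.2 i)⟩

theorem UBound.congr (hU : IsOpen U) (hK : K ⊆ U) {m : ℕ} (hh : UBound K m h)
    (he : ∀ ω, Set.EqOn (h' ω) (h ω) U) : UBound K m h' := by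
  induction m generalizing h h' with
  | zero =>
    obtain ⟨C, hC⟩ := hh
    exact ⟨C, fun ω y hy => by rw [he ω (hK hy)]; exact hC ω y hy⟩
  | succ m ih =>
    obtain ⟨⟨C, hC⟩, h2⟩ := hh
    exact ⟨⟨C, fun ω y hy => by rw [he ω (hK hy)]; exact hC ω y hy⟩,
      fun i => ih (h2 i) fun ω y hy => pderiv_congr hU (he ω) i hy⟩

/-- Families of functions that are smooth on `U` and whose derivatives up to order `m` are
uniformly bounded on `K`. -/
structure SUBound (U K : Set (Coord d)) (m : ℕ) (h : Ω → Coord d → ℝ) : Prop where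
  smooth : ∀ ω, ContDiffOn ℝ (⊤ : ℕ∞) (h ω) U
  bound : UBound K m h

theorem SUBound.congr (hU : IsOpen U) (hK : K ⊆ U) {m : ℕ} (hh : SUBound U K m h)
    (he : ∀ ω, Set.EqOn (h' ω) (h ω) U) : SUBound U K m h' :=
  ⟨fun ω => (hh.smooth ω).congr (he ω), hh.bound.congr hU hK he⟩

theorem SUBound.of_succ {m : ℕ} (hh : SUBound U K (m + 1) h) : SUBound U K m h :=
  ⟨hh.smooth, hh.bound.of_succ⟩

theorem SUBound.pderiv (hU : IsOpen U) {m : ℕ} (hh : SUBound U K (m + 1) h) (i : Fin d) :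
    SUBound U K m fun ω => RandomSchroedinger.pderiv i (h ω) :=
  ⟨fun ω => contDiffOn_pderiv hU (hh.smooth ω) i, hh.bound.2 i⟩

theorem SUBound.succ_of {m : ℕ} (hh : ∀ ω, ContDiffOn ℝ (⊤ : ℕ∞) (h ω) U)
    (h0 : ∃ C : ℝ, ∀ ω, ∀ y ∈ K, |h ω y| ≤ C)
    (h1 : ∀ i, SUBound U K m fun ω => RandomSchroedinger.pderiv i (h ω)) :
    SUBound U K (m + 1) h := ⟨hh, h0, fun i => (h1 i).bound⟩

theorem SUBound.const_family (hU : IsOpen U) (hK : K ⊆ U) (hKc : IsCompact K) {u : Coord d → ℝ}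
    (hu : ContDiffOn ℝ (⊤ : ℕ∞) u U) (m : ℕ) : SUBound U K m fun _ : Ω => u := by
  have hb : ∀ u : Coord d → ℝ, ContDiffOn ℝ (⊤ : ℕ∞) u U →
      ∃ C : ℝ, ∀ _ : Ω, ∀ y ∈ K, |u y| ≤ C := fun u hu => by
    obtain ⟨C, hC⟩ := hKc.exists_bound_of_continuousOn (hu.continuousOn.mono hK)
    exact ⟨C, fun _ y hy => hC y hy⟩
  refine ⟨fun _ => hu, ?_⟩
  induction m generalizing u with
  | zero => exact hb u hu
  | succ m ih => exact ⟨hb u hu, fun i => ih (contDiffOn_pderiv hU hu i)⟩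

theorem pderiv_add' (hU : IsOpen U) {u v : Coord d → ℝ} (hu : ContDiffOn ℝ (⊤ : ℕ∞) u U)
    (hv : ContDiffOn ℝ (⊤ : ℕ∞) v U) (i : Fin d) {y : Coord d} (hy : y ∈ U) :
    pderiv i (fun y => u y + v y) y = pderiv i u y + pderiv i v y := by
  unfold pderiv
  rw [fderiv_fun_add (contDiffOn_differentiableAt hU hu hy) (contDiffOn_differentiableAt hU hv hy)]
  rfl

theorem pderiv_mul' (hU : IsOpen U) {u v : Coord d → ℝ} (hu : ContDiffOn ℝ (⊤ : ℕ∞) u U)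
    (hv : ContDiffOn ℝ (⊤ : ℕ∞) v U) (i : Fin d) {y : Coord d} (hy : y ∈ U) :
    pderiv i (fun y => u y * v y) y = u y * pderiv i v y + pderiv i u y * v y := by
  unfold pderiv
  rw [fderiv_fun_mul (contDiffOn_differentiableAt hU hu hy) (contDiffOn_differentiableAt hU hv hy)]
  simp [mul_comm]

theorem SUBound.add (hU : IsOpen U) (hK : K ⊆ U) {m : ℕ} (hh : SUBound U K m h)
    (hh' : SUBound U K m h') : SUBound U K m fun ω y => h ω y + h' ω y := by
  refine ⟨fun ω => (hh.smooth ω).add (hh'.smooth ω), ?_⟩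
  have hb : ∀ {m : ℕ} {h h' : Ω → Coord d → ℝ}, UBound K m h → UBound K m h' →
      ∃ C : ℝ, ∀ ω, ∀ y ∈ K, |h ω y + h' ω y| ≤ C := fun h1 h2 => by
    obtain ⟨C, hC⟩ := h1.zero
    obtain ⟨C', hC'⟩ := h2.zero
    exact ⟨C + C', fun ω y hy => (abs_add_le _ _).trans (add_le_add (hC ω y hy) (hC' ω y hy))⟩
  induction m generalizing h h' with
  | zero => exact hb hh.bound hh'.bound
  | succ m ih =>
    exact ⟨hb hh.bound hh'.bound, fun i => (ih (hh.pderiv hU i) (hh'.pderiv hU i)).congr hU hK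
      fun ω y hy => pderiv_add' hU (hh.smooth ω) (hh'.smooth ω) i hy⟩

theorem SUBound.mul (hU : IsOpen U) (hK : K ⊆ U) {m : ℕ} (hh : SUBound U K m h)
    (hh' : SUBound U K m h') : SUBound U K m fun ω y => h ω y * h' ω y := by
  refine ⟨fun ω => (hh.smooth ω).mul (hh'.smooth ω), ?_⟩
  have hb : ∀ {m : ℕ} {h h' : Ω → Coord d → ℝ}, UBound K m h → UBound K m h' →
      ∃ C : ℝ, ∀ ω, ∀ y ∈ K, |h ω y * h' ω y| ≤ C := fun h1 h2 => by
    obtain ⟨C, hC⟩ := h1.zero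
    obtain ⟨C', hC'⟩ := h2.zero
    refine ⟨C * C', fun ω y hy => ?_⟩
    rw [abs_mul]
    exact mul_le_mul (hC ω y hy) (hC' ω y hy) (abs_nonneg _) ((abs_nonneg _).trans (hC ω y hy))
  induction m generalizing h h' with
  | zero => exact hb hh.bound hh'.bound
  | succ m ih =>
    refine ⟨hb hh.bound hh'.bound, fun i => ?_⟩
    have h1 := ih hh.of_succ (hh'.pderiv hU i)
    have h2 := ih (hh.pderiv hU i) hh'.of_succ
    refine (SUBound.add hU hK ⟨fun ω => ?_, h1⟩ ⟨fun ω => ?_, h2⟩).bound.congr hU hK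
      fun ω y hy => pderiv_mul' hU (hh.smooth ω) (hh'.smooth ω) i hy
    · exact (hh.smooth ω).mul (contDiffOn_pderiv hU (hh'.smooth ω) i)
    · exact (contDiffOn_pderiv hU (hh.smooth ω) i).mul (hh'.smooth ω)

theorem SUBound.const_mul (hU : IsOpen U) (hK : K ⊆ U) {m : ℕ} (hh : SUBound U K m h)
    (hKc : IsCompact K) (c : ℝ) : SUBound U K m fun ω y => c * h ω y :=
  SUBound.mul hU hK (SUBound.const_family hU hK hKc (u := fun _ => c) contDiffOn_const m) hh

theorem SUBound.sum (hU : IsOpen U) (hK : K ⊆ U) (hKc : IsCompact K) {ι : Type*} {m : ℕ}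
    (s : Finset ι) {h : ι → Ω → Coord d → ℝ} (hh : ∀ j, SUBound U K m (h j)) :
    SUBound U K m fun ω y => ∑ j ∈ s, h j ω y := by
  classical
  induction s using Finset.induction_on with
  | empty =>
    simp only [Finset.sum_empty]
    exact SUBound.const_family hU hK hKc contDiffOn_const m
  | insert a s ha ih =>
    simp only [Finset.sum_insert ha]
    exact (hh a).add hU hK ih

theorem SUBound.prod (hU : IsOpen U) (hK : K ⊆ U) (hKc : IsCompact K) {ι : Type*} {m : ℕ}
    (s : Finset ι) {h : ι → Ω → Coord d → ℝ} (hh : ∀ j, SUBound U K m (h j)) :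
    SUBound U K m fun ω y => ∏ j ∈ s, h j ω y := by
  classical
  induction s using Finset.induction_on with
  | empty =>
    simp only [Finset.prod_empty]
    exact SUBound.const_family hU hK hKc contDiffOn_const m
  | insert a s ha ih =>
    simp only [Finset.prod_insert ha]
    exact (hh a).mul hU hK ih

theorem SUBound.det (hU : IsOpen U) (hK : K ⊆ U) (hKc : IsCompact K) {n m : ℕ}
    {M : Ω → Coord d → Matrix (Fin n) (Fin n) ℝ}
    (hM : ∀ i j, SUBound U K m fun ω y => M ω y i j) :
    SUBound U K m fun ω y => (M ω y).det := by
  simp only [Matrix.det_apply']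
  exact SUBound.sum hU hK hKc _ fun σ => SUBound.const_mul hU hK
    (SUBound.prod hU hK hKc _ fun i => hM _ _) hKc _

/-- The derivative is `-h⁻¹ h⁻¹ ∂h`, with the reciprocal at one order less, so a bound of order zero
on the reciprocals propagates to every order for which `h` is controlled. -/
theorem SUBound.inv (hU : IsOpen U) (hK : K ⊆ U) (hKc : IsCompact K) {m : ℕ}
    (hh : SUBound U K m h) (h0 : ∀ ω, ∀ y ∈ U, h ω y ≠ 0)
    (hb : ∃ C : ℝ, ∀ ω, ∀ y ∈ K, |(h ω y)⁻¹| ≤ C) : SUBound U K m fun ω y => (h ω y)⁻¹ := by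
  have hs : ∀ ω, ContDiffOn ℝ (⊤ : ℕ∞) (fun y => (h ω y)⁻¹) U :=
    fun ω => (hh.smooth ω).inv (h0 ω)
  induction m with
  | zero => exact ⟨hs, hb⟩
  | succ m ih =>
    have h1 := ih hh.of_succ
    refine SUBound.succ_of hs hb fun i => ?_
    refine ((((hh.pderiv hU i).mul hU hK h1).mul hU hK h1).const_mul hU hK hKc (-1)).congr hU hK
      fun ω y hy => ?_
    have hd := (contDiffOn_differentiableAt hU (hh.smooth ω) hy)
    have h2 := ((hasDerivAt_inv (h0 ω y hy)).comp_hasFDerivAt y hd.hasFDerivAt).fderiv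
    have h3 : RandomSchroedinger.pderiv i (fun y => (h ω y)⁻¹) y =
        (-(h ω y ^ 2)⁻¹ • fderiv ℝ (h ω) y) (EuclideanSpace.single i 1) := by
      rw [← h2]; rfl
    rw [h3]
    simp only [RandomSchroedinger.pderiv, smul_apply, smul_eq_mul]
    field_simp

theorem SUBound.matrix_inv (hU : IsOpen U) (hK : K ⊆ U) (hKc : IsCompact K) {n m : ℕ}
    {M : Ω → Coord d → Matrix (Fin n) (Fin n) ℝ}
    (hM : ∀ i j, SUBound U K m fun ω y => M ω y i j) (h0 : ∀ ω, ∀ y ∈ U, (M ω y).det ≠ 0)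
    (hb : ∃ C : ℝ, ∀ ω, ∀ y ∈ K, |((M ω y).det)⁻¹| ≤ C) (i j : Fin n) :
    SUBound U K m fun ω y => (M ω y)⁻¹ i j := by
  have h : ∀ ω y, (M ω y)⁻¹ i j =
      (M ω y).det⁻¹ * ((M ω y).updateRow j (Pi.single i 1)).det := fun ω y => by
    rw [Matrix.inv_def, Matrix.smul_apply, Matrix.adjugate_apply, Ring.inverse_eq_inv', smul_eq_mul]
  simp only [h]
  refine SUBound.mul hU hK ((SUBound.det hU hK hKc hM).inv hU hK hKc h0 hb)
    (SUBound.det hU hK hKc fun a b => ?_)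
  by_cases ha : a = j
  · subst ha
    simp only [Matrix.updateRow_self]
    exact SUBound.const_family hU hK hKc contDiffOn_const m
  · simp only [Matrix.updateRow_ne ha]
    exact hM a b

end UniformBounds

/-! ### Uniform bounds for relatively bounded families of metrics -/

section Endomorphisms

variable {d : ℕ} {X : Type*} [TopologicalSpace X] [ChartedSpace (Coord d) X]
  [IsManifold 𝓘(ℝ, Coord d) (⊤ : ℕ∞) X]

/-- An endomorphism field in a chart. -/
noncomputable def endoE (e : OpenPartialHomeomorph X (Coord d))
    (A : (x : X) → (Tan d x →L[ℝ] Tan d x)) (y : Coord d) : Coord d →L[ℝ] Coord d :=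
  (dChart e (e.symm y)).comp ((A (e.symm y)).comp (dInv e y))

theorem endoComp_eq (x₀ : X) (A : (x : X) → (Tan d x →L[ℝ] Tan d x)) (a : Fin d)
    (b : Fin 1 → Fin d) (y : Coord d) :
    endoComp x₀ A a b y = endoE (chartAt (Coord d) x₀) A y (EuclideanSpace.single (b 0) 1) a := rfl

theorem tens_endoComp (x₀ : X) (A : (x : X) → (Tan d x →L[ℝ] Tan d x)) (y : Coord d)
    (v : Fin 1 → Coord d) :
    tens (endoComp x₀ A) y v = endoE (chartAt (Coord d) x₀) A y (v 0) := by
  ext a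
  have h : endoE (chartAt (Coord d) x₀) A y (v 0) a =
      ∑ c, v 0 c * endoE (chartAt (Coord d) x₀) A y (EuclideanSpace.single c 1) a := by
    conv_lhs => rw [coord_eq_sum (v 0)]
    simp
  rw [h]
  simp only [tens]
  rw [sum_cons]
  refine Finset.sum_congr rfl fun c _ => ?_
  simp [endoComp_eq]

theorem sameTensor_endoComp (x₀ x₁ : X) (A : (x : X) → (Tan d x →L[ℝ] Tan d x)) :
    SameTensor x₀ x₁ (endoComp x₀ A) (endoComp x₁ A) := by
  intro y hy v
  have he := chartAt_mem (d := d) x₀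
  have he' := chartAt_mem (d := d) x₁
  rw [tens_endoComp, tens_endoComp]
  set e := chartAt (Coord d) x₀
  set e' := chartAt (Coord d) x₁
  have key : ∀ (p q : X) (_ : p = q) (a a' : Coord d), a = a' →
      dChart e' p (A p a) = dChart e' q (A q a') := by
    rintro p _ rfl a _ rfl; rfl
  have h1 := dChart_transit he he' hy (A (e.symm y) (dInv e y (v 0)))
  exact h1.symm.trans (key _ _ (symm_transit e e' hy).symm _ _ (dInv_transit he he' hy (v 0)).symm)

theorem contDiffOn_christoffel (g : SmoothMetric d X) (x₀ : X) (a b c : Fin d) :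
    ContDiffOn ℝ (⊤ : ℕ∞) (christoffel g x₀ a b c) (chartAt (Coord d) x₀).target := by
  have hO := (chartAt (Coord d) x₀).open_target
  have hG : ∀ i j, ContDiffOn ℝ (⊤ : ℕ∞) (fun y => gram g x₀ y i j) _ :=
    contDiffOn_gramE g (chartAt_mem x₀)
  exact contDiffOn_const.mul (ContDiffOn.sum fun f _ =>
    (contDiffOn_gramE_inv g (chartAt_mem x₀) a f).mul
    (((contDiffOn_pderiv hO (hG f c) b).add (contDiffOn_pderiv hO (hG f b) c)).sub
      (contDiffOn_pderiv hO (hG b c) f)))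

theorem SmoothTensor.covDeriv (g : SmoothMetric d X) {x₀ : X} {n : ℕ} {T : TensorComp d n}
    (hT : SmoothTensor x₀ T) : SmoothTensor x₀ (covDeriv g x₀ T) := fun a b => by
  have hO := (chartAt (Coord d) x₀).open_target
  exact ((contDiffOn_pderiv hO (hT _ _) _).add (ContDiffOn.sum fun f _ =>
    (contDiffOn_christoffel g x₀ _ _ _).mul (hT _ _))).sub (ContDiffOn.sum fun i _ =>
      ContDiffOn.sum fun f _ => (contDiffOn_christoffel g x₀ _ _ _).mul (hT _ _))

variable {g₀ g : SmoothMetric d X}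

theorem metricE_relEndo {e : OpenPartialHomeomorph X (Coord d)} (he : e ∈ SmoothCharts d X)
    {y : Coord d} (hy : y ∈ e.target) (v w : Coord d) :
    metricE g e y v w = metricE g₀ e y (endoE e (relEndo g₀ g) y v) w := by
  have h1 : dInv e y (endoE e (relEndo g₀ g) y v) = relEndo g₀ g (e.symm y) (dInv e y v) :=
    dInv_dChart he hy _
  simp only [metricE, h1]
  exact (inner_inverse g₀ _ (g.inner (e.symm y) (dInv e y v)) (dInv e y w)).symm

theorem gramE_eq_relEndo (x₀ : X) {y : Coord d} (hy : y ∈ (chartAt (Coord d) x₀).target)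
    (b c : Fin d) : gramE g (chartAt (Coord d) x₀) y b c =
      ∑ a, gramE g₀ (chartAt (Coord d) x₀) y c a *
        endoComp x₀ (relEndo g₀ g) a (fun _ => b) y := by
  have h := metricE_relEndo (g₀ := g₀) (g := g) (chartAt_mem x₀) hy
    (EuclideanSpace.single b 1) (EuclideanSpace.single c 1)
  rw [metricE_symm g₀, metricE_eq_sum g₀] at h
  refine h.trans ?_
  rw [Finset.sum_eq_single c]
  · refine Finset.sum_congr rfl fun a _ => ?_
    simp [endoComp_eq, mul_comm]
  · intro i _ hi
    simp [hi]
  · simp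

theorem endoComp_relEndo_eq (x₀ : X) {y : Coord d} (hy : y ∈ (chartAt (Coord d) x₀).target)
    (a : Fin d) (b : Fin 1 → Fin d) : endoComp x₀ (relEndo g₀ g) a b y =
      ∑ c, (gramE g₀ (chartAt (Coord d) x₀) y)⁻¹ a c * gramE g (chartAt (Coord d) x₀) y (b 0) c := by
  have hdet : IsUnit (gramE g₀ (chartAt (Coord d) x₀) y).det :=
    (posDef_gramE g₀ (chartAt_mem x₀) hy).det_pos.ne'.isUnit
  have h1 : (fun c => gramE g (chartAt (Coord d) x₀) y (b 0) c) =
      (gramE g₀ (chartAt (Coord d) x₀) y).mulVec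
        fun a => endoComp x₀ (relEndo g₀ g) a (fun _ => b 0) y :=
    funext fun c => gramE_eq_relEndo x₀ hy (b 0) c
  have h2 : b = fun _ => b 0 := funext fun i => by rw [Subsingleton.elim i 0]
  change _ = ((gramE g₀ (chartAt (Coord d) x₀) y)⁻¹.mulVec
    fun c => gramE g (chartAt (Coord d) x₀) y (b 0) c) a
  rw [h1, Matrix.mulVec_mulVec, Matrix.nonsing_inv_mul _ hdet, Matrix.one_mulVec, ← h2]

theorem smoothTensor_iterCovDeriv (g₀ g : SmoothMetric d X) (x₀ : X) (k : ℕ) :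
    SmoothTensor x₀ (iterCovDeriv g₀ x₀ (relEndo g₀ g) k) := by
  induction k with
  | zero =>
    intro a b
    refine (ContDiffOn.sum (s := Finset.univ) fun c _ =>
      (contDiffOn_gramE_inv g₀ (chartAt_mem x₀) a c).mul
      (contDiffOn_gramE g (chartAt_mem x₀) (b 0) c)).congr fun y hy => ?_
    exact endoComp_relEndo_eq x₀ hy a b
  | succ k ih => exact ih.covDeriv g₀

theorem sameTensor_iterCovDeriv (g₀ g : SmoothMetric d X) (x₀ x₁ : X) (k : ℕ) :
    SameTensor x₀ x₁ (iterCovDeriv g₀ x₀ (relEndo g₀ g) k)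
      (iterCovDeriv g₀ x₁ (relEndo g₀ g) k) := by
  induction k with
  | zero => exact sameTensor_endoComp x₀ x₁ _
  | succ k ih =>
    exact ih.covDeriv g₀ (smoothTensor_iterCovDeriv g₀ g x₀ k) (smoothTensor_iterCovDeriv g₀ g x₁ k)

/-- `covDerivNorm` is evaluated at each point in the chart centred there. Tensoriality carries the
bound to the fixed chart at `x₀`, evaluation on coordinate vectors isolates the components, and the
remaining factors involve only `g₀`. -/
theorem iterCovDeriv_sq_le {k : ℕ} {C : ℝ} (x₀ : X)
    (hC : ∀ x, covDerivNorm g₀ (relEndo g₀ g) k x ≤ C) {y : Coord d}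
    (hy : y ∈ (chartAt (Coord d) x₀).target) (a : Fin d) (b : Fin (k + 1) → Fin d) :
    iterCovDeriv g₀ x₀ (relEndo g₀ g) k a b y ^ 2 ≤
      (gramE g₀ (chartAt (Coord d) x₀) y)⁻¹ a a *
        (C ^ 2 * ∏ i, gramE g₀ (chartAt (Coord d) x₀) y (b i) (b i)) := by
  have he := chartAt_mem (d := d) x₀
  have hst := sameTensor_iterCovDeriv g₀ g x₀ ((chartAt (Coord d) x₀).symm y) k
  have hN := hC ((chartAt (Coord d) x₀).symm y)
  unfold covDerivNorm at hN
  set T := iterCovDeriv g₀ x₀ (relEndo g₀ g) k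
  set e := chartAt (Coord d) x₀
  have he' := chartAt_mem (d := d) (e.symm y)
  set T' := iterCovDeriv g₀ (e.symm y) (relEndo g₀ g) k
  have hy' : y ∈ overlap e (chartAt (Coord d) (e.symm y)) := ⟨hy, mem_chart_source _ _⟩
  let v : Fin (k + 1) → Coord d := fun i => EuclideanSpace.single (b i) 1
  have h1 := hst y hy' v
  set e' := chartAt (Coord d) (e.symm y)
  set J := fderiv ℝ (transit e e') y
  have hpos := posDef_gramE g₀ he' (transit_mem e e' hy').1
  have hN2 : tensorNormSq g₀ (e.symm y) T' (transit e e' y) ≤ C ^ 2 := (Real.sqrt_le_iff.1 hN).2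
  have h2 : metricE g₀ e y (tens T y v) (tens T y v) ≤
      C ^ 2 * ∏ i, gramE g₀ e y (b i) (b i) := by
    have h3 := quad_tensor_le hpos (fun a b => T' a b (transit e e' y)) (fun i => J (v i))
    have h4 : ∀ i, ∑ j, ∑ l, J (v i) j * J (v i) l * gramE g₀ e' (transit e e' y) j l =
        gramE g₀ e y (b i) (b i) := fun i => by
      rw [← metricE_eq_sum, metricE_transit g₀ he he' hy']
      rfl
    rw [← metricE_transit g₀ he he' hy', h1, metricE_eq_sum]
    refine h3.trans ?_
    rw [Finset.prod_congr rfl fun i _ => h4 i]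
    exact mul_le_mul_of_nonneg_right hN2
      (Finset.prod_nonneg fun i _ => (posDef_gramE g₀ he hy).diag_pos.le)
  have h5 := sq_le_inv_mul_quad (posDef_gramE g₀ he hy) (fun a => tens T y v a) a
  rw [← metricE_eq_sum g₀ e y (tens T y v) (tens T y v)] at h5
  rw [tens_basis] at h5
  exact h5.trans (mul_le_mul_of_nonneg_left h2 (posDef_gramE g₀ he hy).inv.diag_pos.le)

end Endomorphisms

/-! ### Uniform coordinate bounds for the metrics of a relatively bounded family. -/

section UniformMetric

variable {d : ℕ} {X : Type*} [TopologicalSpace X] [ChartedSpace (Coord d) X]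
  [IsManifold 𝓘(ℝ, Coord d) (⊤ : ℕ∞) X] {Ω : Type*}

theorem exists_bound_of_sq_le {K : Set (Coord d)} (hK : IsCompact K) {h : Ω → Coord d → ℝ}
    {q : Coord d → ℝ} (hq : ContinuousOn q K) (hh : ∀ ω, ∀ y ∈ K, h ω y ^ 2 ≤ q y) :
    ∃ C : ℝ, ∀ ω, ∀ y ∈ K, |h ω y| ≤ C := by
  obtain ⟨C, hC⟩ := hK.exists_bound_of_continuousOn hq
  refine ⟨C + 1, fun ω y hy => abs_le_of_sq_le_sq ?_ ?_⟩
  · have h1 := (Real.norm_eq_abs _ ▸ hC y hy)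
    nlinarith [hh ω y hy, le_abs_self (q y), abs_nonneg (q y)]
  · linarith [(norm_nonneg _).trans (hC y hy)]

theorem SUBound.neg {U K : Set (Coord d)} (hU : IsOpen U) (hK : K ⊆ U) (hKc : IsCompact K) {m : ℕ}
    {h : Ω → Coord d → ℝ} (hh : SUBound U K m h) : SUBound U K m fun ω y => -h ω y := by
  have := hh.const_mul hU hK hKc (-1)
  simpa using this

theorem SUBound.sub {U K : Set (Coord d)} (hU : IsOpen U) (hK : K ⊆ U) (hKc : IsCompact K) {m : ℕ}
    {h h' : Ω → Coord d → ℝ} (hh : SUBound U K m h) (hh' : SUBound U K m h') :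
    SUBound U K m fun ω y => h ω y - h' ω y := by
  simpa only [sub_eq_add_neg] using hh.add hU hK (hh'.neg hU hK hKc)

/-- The square root of a positive family. -/
theorem SUBound.sqrt {U K : Set (Coord d)} (hU : IsOpen U) (hK : K ⊆ U) (hKc : IsCompact K) {m : ℕ}
    {h : Ω → Coord d → ℝ} (hh : SUBound U K m h) (h0 : ∀ ω, ∀ y ∈ U, 0 < h ω y)
    (hi : SUBound U K m fun ω y => (h ω y)⁻¹) : SUBound U K m fun ω y => Real.sqrt (h ω y) := by
  have hs : ∀ ω, ContDiffOn ℝ (⊤ : ℕ∞) (fun y => Real.sqrt (h ω y)) U :=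
    fun ω => (hh.smooth ω).sqrt fun y hy => (h0 ω y hy).ne'
  have hb : ∃ C : ℝ, ∀ ω, ∀ y ∈ K, |Real.sqrt (h ω y)| ≤ C := by
    obtain ⟨C, hC⟩ := hh.bound.zero
    refine ⟨C + 1, fun ω y hy => abs_le_of_sq_le_sq ?_ ?_⟩
    · rw [Real.sq_sqrt (h0 ω y (hK hy)).le]
      nlinarith [hC ω y hy, le_abs_self (h ω y), abs_nonneg (h ω y)]
    · linarith [(abs_nonneg _).trans (hC ω y hy)]
  induction m with
  | zero => exact ⟨hs, hb⟩
  | succ m ih =>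
    have h1 := ih hh.of_succ hi.of_succ
    refine SUBound.succ_of hs hb fun i => ?_
    -- Written as `(1/2) √h h⁻¹ ∂h`, the derivative involves only factors already bounded to order
    -- `m`.
    refine (((h1.mul hU hK hi.of_succ).mul hU hK (hh.pderiv hU i)).const_mul hU hK hKc
      (1 / 2)).congr hU hK fun ω y hy => ?_
    have hd := (contDiffOn_differentiableAt hU (hh.smooth ω) hy)
    have hp := h0 ω y hy
    have h2 := (hd.hasFDerivAt.sqrt hp.ne').fderiv
    have hsq := Real.mul_self_sqrt hp.le
    have hs0 := (Real.sqrt_pos.2 hp).ne'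
    simp only [RandomSchroedinger.pderiv]
    rw [h2]
    simp only [smul_apply, smul_eq_mul]
    have : Real.sqrt (h ω y) * (h ω y)⁻¹ = (Real.sqrt (h ω y))⁻¹ := by
      nth_rewrite 2 [← hsq]
      field_simp
    rw [this]
    field_simp

variable {g₀ : SmoothMetric d X} {g : Ω → SmoothMetric d X}

/-- A partial derivative of a component of `∇^k A` is a component of `∇^(k+1) A` corrected by
products of components of `∇^k A` with Christoffel symbols of `g₀`, which do not depend on `ω`.
Hence the induction on the order `m` of differentiation treats all `k` at once. -/
theorem subound_iterCovDeriv (hg : RelativelyBounded g₀ g) (x₀ : X) {K : Set (Coord d)}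
    (hK : K ⊆ (chartAt (Coord d) x₀).target) (hKc : IsCompact K) (m k : ℕ) (a : Fin d)
    (b : Fin (k + 1) → Fin d) : SUBound (chartAt (Coord d) x₀).target K m
      fun ω => iterCovDeriv g₀ x₀ (relEndo g₀ (g ω)) k a b := by
  obtain ⟨C, -, -, hC⟩ := hg
  have hU := (chartAt (Coord d) x₀).open_target
  have hb : ∀ k a (b : Fin (k + 1) → Fin d), ∃ M : ℝ, ∀ ω, ∀ y ∈ K,
      |iterCovDeriv g₀ x₀ (relEndo g₀ (g ω)) k a b y| ≤ M := fun k a b =>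
    exists_bound_of_sq_le hKc (q := fun y => (gramE g₀ (chartAt (Coord d) x₀) y)⁻¹ a a *
        (C k ^ 2 * ∏ i, gramE g₀ (chartAt (Coord d) x₀) y (b i) (b i)))
      (ContinuousOn.mono (((contDiffOn_gramE_inv g₀ (chartAt_mem x₀) a a).mul
        (contDiffOn_const.mul (contDiffOn_prod fun i _ =>
          contDiffOn_gramE g₀ (chartAt_mem x₀) (b i) (b i)))).continuousOn) hK)
      fun ω y hy => iterCovDeriv_sq_le x₀ (hC k ω) (hK hy) a b
  have hs := fun ω k a (b : Fin (k + 1) → Fin d) => smoothTensor_iterCovDeriv g₀ (g ω) x₀ k a b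
  induction m generalizing k a b with
  | zero => exact ⟨fun ω => hs ω k a b, hb k a b⟩
  | succ m ih =>
    refine SUBound.succ_of (fun ω => hs ω k a b) (hb k a b) fun c => ?_
    have hΓ : ∀ a b c, SUBound (chartAt (Coord d) x₀).target K m
        fun _ : Ω => christoffel g₀ x₀ a b c := fun a b c =>
      SUBound.const_family hU hK hKc (contDiffOn_christoffel g₀ x₀ a b c) m
    have h1 := ih (k + 1) a (Fin.cons c b)
    have h2 := SUBound.sum hU hK hKc Finset.univ fun f => (hΓ a c f).mul hU hK (ih k f b)
    have h3 := SUBound.sum hU hK hKc Finset.univ fun i => SUBound.sum hU hK hKc Finset.univ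
      fun f => (hΓ f c (b i)).mul hU hK (ih k a (Function.update b i f))
    refine ((h1.sub hU hK hKc h2).add hU hK h3).congr hU hK fun ω y hy => ?_
    simp only [iterCovDeriv, covDeriv, Fin.cons_zero, Fin.tail_cons]
    ring

theorem subound_gramE (hg : RelativelyBounded g₀ g) (x₀ : X) {K : Set (Coord d)}
    (hK : K ⊆ (chartAt (Coord d) x₀).target) (hKc : IsCompact K) (m : ℕ) (b c : Fin d) :
    SUBound (chartAt (Coord d) x₀).target K m
      fun ω y => gramE (g ω) (chartAt (Coord d) x₀) y b c := by
  have hU := (chartAt (Coord d) x₀).open_target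
  exact (SUBound.sum hU hK hKc Finset.univ fun a => (SUBound.const_family hU hK hKc
    (contDiffOn_gramE g₀ (chartAt_mem x₀) c a) m).mul hU hK
      (subound_iterCovDeriv hg x₀ hK hKc m 0 a fun _ => b)).congr hU hK
        fun ω y hy => gramE_eq_relEndo x₀ hy b c

/-- Let `u` be the column `a` of the inverse Gram matrix `G⁻¹` of `g`. Then `G(u, u) = u a`, and `G₀
≤ C G` with `sq_le_inv_mul_quad` gives `(u c)² ≤ (G₀⁻¹ c c) C (u a)`. The case `c = a` bounds `u a`,
and this bound is inserted back. -/
theorem gramE_inv_bound {C : ℝ} {g : SmoothMetric d X} (hC0 : 0 < C)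
    (hC : ∀ (x : X) (v : Tan d x), C⁻¹ * g₀.inner x v v ≤ g.inner x v v)
    {e : OpenPartialHomeomorph X (Coord d)} (he : e ∈ SmoothCharts d X) {y : Coord d}
    (hy : y ∈ e.target) (a c : Fin d) : ((gramE g e y)⁻¹ c a) ^ 2 ≤
      C ^ 2 * ((gramE g₀ e y)⁻¹ c c * (gramE g₀ e y)⁻¹ a a) := by
  have hG := posDef_gramE g he hy
  have hG₀ := posDef_gramE g₀ he hy
  have hdet : IsUnit (gramE g e y).det := hG.det_pos.ne'.isUnit
  set u : Fin d → ℝ := fun c => (gramE g e y)⁻¹ c a with hu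
  have h1 : ∀ v : Fin d → ℝ, ∑ i, ∑ j, v i * v j * gramE g₀ e y i j ≤
      C * ∑ i, ∑ j, v i * v j * gramE g e y i j := fun v => by
    have h2 := hC (e.symm y) (dInv e y (WithLp.toLp 2 v))
    have h3 := metricE_eq_sum g e y (WithLp.toLp 2 v) (WithLp.toLp 2 v)
    have h4 := metricE_eq_sum g₀ e y (WithLp.toLp 2 v) (WithLp.toLp 2 v)
    simp only at h3 h4
    rw [← h3, ← h4]
    exact (inv_mul_le_iff₀ hC0).1 h2
  have h2 : ∑ i, ∑ j, u i * u j * gramE g e y i j = u a := by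
    have h3 : ∀ i, ∑ j, gramE g e y i j * u j = if i = a then 1 else 0 := fun i => by
      have := congrFun (congrFun (Matrix.mul_nonsing_inv _ hdet) i) a
      rwa [Matrix.mul_apply, Matrix.one_apply] at this
    have h4 : ∀ i, ∑ j, u i * u j * gramE g e y i j = u i * if i = a then 1 else 0 := fun i => by
      rw [← h3, Finset.mul_sum]
      exact Finset.sum_congr rfl fun j _ => by ring
    simp [h4]
  have h3 : ∀ c, u c ^ 2 ≤ (gramE g₀ e y)⁻¹ c c * (C * u a) := fun c => by
    refine (sq_le_inv_mul_quad hG₀ u c).trans ?_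
    have := h1 u
    rw [h2] at this
    exact mul_le_mul_of_nonneg_left this hG₀.inv.diag_pos.le
  have h4 : 0 < u a := hG.inv.diag_pos
  have h5 : u a ≤ C * (gramE g₀ e y)⁻¹ a a := by
    have := h3 a
    rw [sq] at this
    exact le_of_mul_le_mul_right (by linarith) h4
  calc u c ^ 2 ≤ (gramE g₀ e y)⁻¹ c c * (C * u a) := h3 c
    _ ≤ (gramE g₀ e y)⁻¹ c c * (C * (C * (gramE g₀ e y)⁻¹ a a)) := by
      have := hG₀.inv.diag_pos (i := c)
      gcongr
    _ = _ := by ring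

theorem subound_gramE_inv_zero (hg : RelativelyBounded g₀ g) (x₀ : X) {K : Set (Coord d)}
    (hK : K ⊆ (chartAt (Coord d) x₀).target) (hKc : IsCompact K) (a c : Fin d) :
    SUBound (chartAt (Coord d) x₀).target K 0
      fun ω y => (gramE (g ω) (chartAt (Coord d) x₀) y)⁻¹ a c := by
  obtain ⟨C, hC0, hC, -⟩ := hg
  have he := chartAt_mem (d := d) x₀
  exact ⟨fun ω => contDiffOn_gramE_inv (g ω) he a c,
    exists_bound_of_sq_le hKc (ContinuousOn.mono (contDiffOn_const.mul
      ((contDiffOn_gramE_inv g₀ he a a).mul (contDiffOn_gramE_inv g₀ he c c))).continuousOn hK)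
      fun ω y hy => gramE_inv_bound (hC0 0) (fun x v => (hC ω x v).1) he (hK hy) c a⟩

/-- The reciprocal of the determinant is the determinant of the inverse matrix, whose entries are
already bounded. -/
theorem exists_bound_det_inv (hg : RelativelyBounded g₀ g) (x₀ : X) {K : Set (Coord d)}
    (hK : K ⊆ (chartAt (Coord d) x₀).target) (hKc : IsCompact K) :
    ∃ C : ℝ, ∀ ω, ∀ y ∈ K, |(gramE (g ω) (chartAt (Coord d) x₀) y).det⁻¹| ≤ C := by
  obtain ⟨C, hC⟩ := (SUBound.det (chartAt (Coord d) x₀).open_target hK hKc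
    (subound_gramE_inv_zero hg x₀ hK hKc)).bound
  refine ⟨C, fun ω y hy => ?_⟩
  have : |(gramE (g ω) (chartAt (Coord d) x₀) y)⁻¹.det| ≤ C := hC ω y hy
  rwa [Matrix.det_nonsing_inv, Ring.inverse_eq_inv'] at this

theorem det_gramE_pos (g : SmoothMetric d X) (x₀ : X) {y : Coord d}
    (hy : y ∈ (chartAt (Coord d) x₀).target) : 0 < (gramE g (chartAt (Coord d) x₀) y).det :=
  (posDef_gramE g (chartAt_mem x₀) hy).det_pos

theorem subound_gramE_inv (hg : RelativelyBounded g₀ g) (x₀ : X) {K : Set (Coord d)}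
    (hK : K ⊆ (chartAt (Coord d) x₀).target) (hKc : IsCompact K) (m : ℕ) (a c : Fin d) :
    SUBound (chartAt (Coord d) x₀).target K m
      fun ω y => (gramE (g ω) (chartAt (Coord d) x₀) y)⁻¹ a c :=
  SUBound.matrix_inv (chartAt (Coord d) x₀).open_target hK hKc (subound_gramE hg x₀ hK hKc m)
    (fun ω _ hy => (det_gramE_pos (g ω) x₀ hy).ne') (exists_bound_det_inv hg x₀ hK hKc) a c

theorem subound_densityE (hg : RelativelyBounded g₀ g) (x₀ : X) {K : Set (Coord d)}
    (hK : K ⊆ (chartAt (Coord d) x₀).target) (hKc : IsCompact K) (m : ℕ) :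
    SUBound (chartAt (Coord d) x₀).target K m
        (fun ω y => densityE (g ω) (chartAt (Coord d) x₀) y) ∧
      SUBound (chartAt (Coord d) x₀).target K m
        (fun ω y => (densityE (g ω) (chartAt (Coord d) x₀) y)⁻¹) := by
  have hU := (chartAt (Coord d) x₀).open_target
  have h1 := SUBound.det hU hK hKc (subound_gramE hg x₀ hK hKc m)
  have h2 := h1.inv hU hK hKc (fun ω _ hy => (det_gramE_pos (g ω) x₀ hy).ne')
    (exists_bound_det_inv hg x₀ hK hKc)
  have h3 := h1.sqrt hU hK hKc (fun ω _ hy => det_gramE_pos (g ω) x₀ hy) h2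
  refine ⟨h3, (h3.mul hU hK h2).congr hU hK fun ω y hy => ?_⟩
  have hp := det_gramE_pos (g ω) x₀ hy
  have hsq := Real.mul_self_sqrt hp.le
  have hs0 := (Real.sqrt_pos.2 hp).ne'
  change (Real.sqrt _)⁻¹ = Real.sqrt _ * _⁻¹
  nth_rewrite 3 [← hsq]
  field_simp

end UniformMetric

/-! ### Uniform families of functions and vector fields on the manifold. -/

section UniformFamilies

variable {d : ℕ} {X : Type*} [TopologicalSpace X] [ChartedSpace (Coord d) X]
  [IsManifold 𝓘(ℝ, Coord d) (⊤ : ℕ∞) X] {Ω : Type*}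

/-- Families of smooth functions all of whose derivatives are locally uniformly bounded. -/
structure UniformFun (d : ℕ) {X : Type*} [TopologicalSpace X] [ChartedSpace (Coord d) X]
    (h : Ω → X → ℝ) : Prop where
  smooth : ∀ ω, SmoothFun d (h ω)
  bound : ∀ (x₀ : X) (K : Set (Coord d)), K ⊆ (chartAt (Coord d) x₀).target → IsCompact K →
    ∀ m, SUBound (chartAt (Coord d) x₀).target K m fun ω y => h ω ((chartAt (Coord d) x₀).symm y)

/-- Families of smooth vector fields all of whose derivatives are locally uniformly bounded. -/
structure UniformField (Z : Ω → (x : X) → Tan d x) : Prop where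
  smooth : ∀ ω, SmoothField (Z ω)
  bound : ∀ (x₀ : X) (K : Set (Coord d)), K ⊆ (chartAt (Coord d) x₀).target → IsCompact K →
    ∀ m i, SUBound (chartAt (Coord d) x₀).target K m
      fun ω y => compE (chartAt (Coord d) x₀) (Z ω) y i

theorem UniformFun.const {h : X → ℝ} (hh : SmoothFun d h) : UniformFun d fun _ : Ω => h :=
  ⟨fun _ => hh, fun x₀ _ hK hKc m => SUBound.const_family (chartAt (Coord d) x₀).open_target hK hKc
    (hh.coord (chartAt_mem x₀)) m⟩

theorem UniformField.const {Z : (x : X) → Tan d x} (hZ : SmoothField Z) :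
    UniformField fun _ : Ω => Z :=
  ⟨fun _ => hZ, fun x₀ _ hK hKc m i => SUBound.const_family (chartAt (Coord d) x₀).open_target
    hK hKc (hZ _ (chartAt_mem x₀) i) m⟩

variable {g₀ : SmoothMetric d X} {g : Ω → SmoothMetric d X}

theorem UniformFun.grad (hg : RelativelyBounded g₀ g) {h : Ω → X → ℝ} (hh : UniformFun d h) :
    UniformField fun ω => RandomSchroedinger.grad (g ω) (h ω) := by
  refine ⟨fun ω => (hh.smooth ω).grad (g ω), fun x₀ K hK hKc m i => ?_⟩
  have hU := (chartAt (Coord d) x₀).open_target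
  exact (SUBound.sum hU hK hKc Finset.univ fun k => (subound_gramE_inv hg x₀ hK hKc m i k).mul hU hK
    ((hh.bound x₀ K hK hKc (m + 1)).pderiv hU k)).congr hU hK fun ω y hy =>
      grad_coord (g ω) (chartAt_mem x₀) hy ((hh.smooth ω).mdiff _) i

theorem UniformFun.exists_bound {h : Ω → X → ℝ} (hh : UniformFun d h) {K : Set X}
    (hK : IsCompact K) : ∃ C : ℝ, ∀ ω, ∀ x ∈ K, |h ω x| ≤ C := by
  refine hK.induction_on (p := fun S => ∃ C : ℝ, ∀ ω, ∀ x ∈ S, |h ω x| ≤ C) ⟨0, by simp⟩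
    (fun S T hST ⟨C, hC⟩ => ⟨C, fun ω x hx => hC ω x (hST hx)⟩)
    (fun S T ⟨C, hC⟩ ⟨C', hC'⟩ => ⟨max C C', ?_⟩) fun x _ => ?_
  · rintro ω x (hx | hx)
    exacts [(hC ω x hx).trans (le_max_left _ _), (hC' ω x hx).trans (le_max_right _ _)]
  · obtain ⟨L, hL, hLt, hLc⟩ := local_compact_nhds ((chartAt (Coord d) x).open_target.mem_nhds
      (mem_chart_target (Coord d) x))
    obtain ⟨C, hC⟩ := (hh.bound x L hLt hLc 0).bound.zero
    refine ⟨(chartAt (Coord d) x).source ∩ chartAt (Coord d) x ⁻¹' L,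
      mem_nhdsWithin_of_mem_nhds ?_, C, fun ω z hz => ?_⟩
    · exact inter_mem ((chartAt (Coord d) x).open_source.mem_nhds (mem_chart_source _ x))
        (((chartAt (Coord d) x).continuousAt (mem_chart_source _ x)).preimage_mem_nhds hL)
    · have := hC ω _ hz.2
      rwa [(chartAt (Coord d) x).left_inv hz.1] at this

variable [MeasurableSpace X] [BorelSpace X] [SecondCountableTopology X] [T2Space X]

theorem UniformField.inner {Z Z' : Ω → (x : X) → Tan d x} (hZ : UniformField Z)
    (hZ' : UniformField Z') : UniformFun d fun ω x => g₀.inner x (Z ω x) (Z' ω x) := by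
  refine ⟨fun ω => smoothFun_inner g₀ (hZ.smooth ω) (hZ'.smooth ω), fun x₀ K hK hKc m => ?_⟩
  have hU := (chartAt (Coord d) x₀).open_target
  exact (SUBound.sum hU hK hKc Finset.univ fun i => SUBound.sum hU hK hKc Finset.univ fun j =>
    ((hZ.bound x₀ K hK hKc m i).mul hU hK (hZ'.bound x₀ K hK hKc m j)).mul hU hK
      (SUBound.const_family hU hK hKc (contDiffOn_gramE g₀ (chartAt_mem x₀) i j) m)).congr hU hK
        fun ω y hy => inner_coord g₀ (chartAt_mem x₀) _ _ hy

theorem UniformFun.const_mul {h : Ω → X → ℝ} (hh : UniformFun d h) (c : ℝ) :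
    UniformFun d fun ω x => c * h ω x :=
  ⟨fun ω => SmoothFun.mul contMDiff_const (hh.smooth ω),
    fun x₀ _ hK hKc m => (hh.bound x₀ _ hK hKc m).const_mul (chartAt (Coord d) x₀).open_target
      hK hKc c⟩

theorem UniformField.divg (hg : RelativelyBounded g₀ g) {Z : Ω → (x : X) → Tan d x}
    (hZ : UniformField Z) : UniformFun d fun ω => RandomSchroedinger.divg (g ω) (Z ω) := by
  refine ⟨fun ω => smoothFun_divg (g ω) (hZ.smooth ω), fun x₀ K hK hKc m => ?_⟩
  have hU := (chartAt (Coord d) x₀).open_target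
  exact ((subound_densityE hg x₀ hK hKc m).2.mul hU hK (SUBound.sum hU hK hKc Finset.univ
    fun i => ((subound_densityE hg x₀ hK hKc (m + 1)).1.mul hU hK
      (hZ.bound x₀ K hK hKc (m + 1) i)).pderiv hU i)).congr hU hK fun ω y hy =>
        divg_coord (g ω) (chartAt_mem x₀) (hZ.smooth ω) hy

theorem UniformFun.laplacian (hg : RelativelyBounded g₀ g) {h : Ω → X → ℝ} (hh : UniformFun d h) :
    UniformFun d fun ω => RandomSchroedinger.laplacian (g ω) (h ω) := (hh.grad hg).divg hg

end UniformFamilies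

/-! ### Bounds uniform in `ω` and in group translates. -/

section UniformWords

variable {d : ℕ} {X : Type*} [TopologicalSpace X] [ChartedSpace (Coord d) X]
  [IsManifold 𝓘(ℝ, Coord d) (⊤ : ℕ∞) X] {Ω : Type*}
  [MeasurableSpace X] [BorelSpace X] [SecondCountableTopology X] [T2Space X]

/-- Families of complex functions all of whose derivatives are locally uniformly bounded. -/
def UniformFunC (d : ℕ) {X : Type*} [TopologicalSpace X] [ChartedSpace (Coord d) X]
    (u : Ω → X → ℂ) : Prop :=
  UniformFun d (fun ω x => (u ω x).re) ∧ UniformFun d (fun ω x => (u ω x).im)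

theorem UniformFunC.complexify {D : Ω → (X → ℝ) → X → ℝ}
    (hD : ∀ h : Ω → X → ℝ, UniformFun d h → UniformFun d fun ω => D ω (h ω)) {u : Ω → X → ℂ}
    (hu : UniformFunC d u) : UniformFunC d fun ω => complexify (D ω) (u ω) := by
  refine ⟨?_, ?_⟩
  · simpa [RandomSchroedinger.complexify] using hD _ hu.1
  · simpa [RandomSchroedinger.complexify] using hD _ hu.2

theorem UniformFunC.exists_bound {u : Ω → X → ℂ} (hu : UniformFunC d u) {K : Set X}
    (hK : IsCompact K) : ∃ C : ℝ, ∀ ω, ∀ x ∈ K, ‖u ω x‖ ≤ C := by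
  obtain ⟨C, hC⟩ := hu.1.exists_bound hK
  obtain ⟨C', hC'⟩ := hu.2.exists_bound hK
  exact ⟨C + C', fun ω x hx => (Complex.norm_le_abs_re_add_abs_im _).trans
    (add_le_add (hC ω x hx) (hC' ω x hx))⟩

theorem UniformFunC.const {u : X → ℂ} {U : Set X} (hu : IsTest d U u) :
    UniformFunC d fun _ : Ω => u :=
  ⟨UniformFun.const hu.re.smooth, UniformFun.const hu.im.smooth⟩

variable {Γ : Type*} [Group Γ] [MulAction Γ X]
  {g₀ : SmoothMetric d X} {g : Ω → SmoothMetric d X}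

theorem UniformFun.realD2 (hg : RelativelyBounded g₀ g) (P : PeriodicFrame Γ g₀) (i : Fin d)
    (β : Fin P.n) {h : Ω → X → ℝ} (hh : UniformFun d h) :
    UniformFun d fun ω => P.realD2 (g ω) i β (h ω) :=
  (UniformField.inner (hh.grad hg) (UniformField.const (P.smoothField_vec i β))).const_mul (-2)

theorem UniformFunC.applyD (hg : RelativelyBounded g₀ g) (P : PeriodicFrame Γ g₀)
    (L : DLabel d P.n) {u : Ω → X → ℂ} (hu : UniformFunC d u) :
    UniformFunC d fun ω => P.applyD (g ω) L (u ω) := by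
  have h1 : ∀ {u : Ω → X → ℂ}, UniformFunC d u → UniformFunC d fun ω => P.opD1 (g ω) (u ω) :=
    fun hu => hu.complexify (D := fun ω => laplacian (g ω)) fun h hh => hh.laplacian hg
  have h2 : ∀ {u : Ω → X → ℂ} i β, UniformFunC d u →
      UniformFunC d fun ω => P.opD2 (g ω) i β (u ω) := fun i β hu =>
    hu.complexify (D := fun ω => P.realD2 (g ω) i β) fun h hh => hh.realD2 hg P i β
  cases L with
  | id => exact hu
  | D1 => exact h1 hu
  | D2 i β => exact h2 i β hu
  | D3 i β => exact h1 (h2 i β hu)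
  | D4 i β j μ => exact h2 j μ (h2 i β hu)

theorem UniformFunC.applyWord (hg : RelativelyBounded g₀ g) (P : PeriodicFrame Γ g₀)
    (D : List (DLabel d P.n)) {u : Ω → X → ℂ} (hu : UniformFunC d u) :
    UniformFunC d fun ω => P.applyWord (g ω) D (u ω) := by
  induction D with
  | nil => exact hu
  | cons L D ih => exact UniformFunC.applyD hg P L ih

theorem PeriodicFrame.isTest_applyWord (P : PeriodicFrame Γ g₀) (g : SmoothMetric d X)
    (D : List (DLabel d P.n)) {U : Set X} {u : X → ℂ} (hu : IsTest d U u) :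
    IsTest d U (P.applyWord g D u) ∧ tsupport (P.applyWord g D u) ⊆ tsupport u := by
  induction D with
  | nil => exact ⟨hu, le_rfl⟩
  | cons L D ih =>
    have := P.isTest_applyD g L ih.1
    exact ⟨this.1, this.2.trans ih.2⟩

variable [MulAction Γ Ω]

/-- By equivariance, the value at `x` for the translate of `f` and the metric `g_ω` is the value at
`γ⁻¹ x` for `f` itself and the metric of `γ⁻¹ ω`. So the uniform bound over all metrics on the one
compact set `tsupport f` serves every translate. -/
theorem exists_bound_applyWord (hΓ : PeriodicAction Γ g₀) (P : PeriodicFrame Γ g₀)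
    (hg : RelativelyBounded g₀ g)
    (hc : ∀ (γ : Γ) (ω : Ω), IsMetricMap (g ω) (g (γ • ω)) fun x => γ • x)
    (D : List (DLabel d P.n)) {f : X → ℂ} (hf : IsTest d Set.univ f) :
    ∃ C : ℝ, ∀ (γ : Γ) (ω : Ω) (x : X),
      ‖P.applyWord (g ω) D (fun x => f (γ⁻¹ • x)) x‖ ≤ C := by
  obtain ⟨C, hC⟩ := (UniformFunC.applyWord hg P D (UniformFunC.const (Ω := Ω) hf)).exists_bound
    hf.compact
  refine ⟨max C 0, fun γ ω x => ?_⟩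
  have hm := hc γ (γ⁻¹ • ω)
  rw [smul_inv_smul] at hm
  have hf' : IsTest d Set.univ fun x => f (γ⁻¹ • x) :=
    ⟨hf.smooth.comp (hΓ.isometric γ⁻¹).smooth, hf.compact.comp_homeomorph (hΓ.homeo γ⁻¹),
      Set.subset_univ _⟩
  have h1 := (applyWord_equivariant hΓ P hm D hf' (u := f) fun x => by simp).2 (γ⁻¹ • x)
  rw [smul_inv_smul] at h1
  rw [h1]
  by_cases hx : γ⁻¹ • x ∈ tsupport f
  · exact (hC _ _ hx).trans (le_max_left _ _)
  · have h2 : P.applyWord (g (γ⁻¹ • ω)) D f (γ⁻¹ • x) = 0 :=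
      image_eq_zero_of_notMem_tsupport fun h => hx ((P.isTest_applyWord _ D hf).2 h)
    rw [h2, norm_zero]
    exact le_max_right _ _

/-- The quotient map is open, so interiors of compact neighbourhoods project to an open cover of the
compact quotient; finitely many suffice. -/
theorem exists_compact_cover (hΓ : PeriodicAction Γ g₀)
    [CompactSpace (MulAction.orbitRel.Quotient Γ X)] :
    ∃ K : Set X, IsCompact K ∧ ∀ x, ∃ (γ : Γ), ∃ k ∈ K, x = γ • k := by
  have : ContinuousConstSMul Γ X := ⟨fun γ => (hΓ.isometric γ).smooth.continuous⟩
  have : LocallyCompactSpace X := ChartedSpace.locallyCompactSpace (Coord d) X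
  have hq : IsOpenMap (Quotient.mk (MulAction.orbitRel Γ X)) := isOpenMap_quotient_mk'_mul
  choose L hL hLx using fun x : X => exists_compact_mem_nhds x
  obtain ⟨t, ht⟩ := isCompact_univ.elim_finite_subcover
    (fun x : X => Quotient.mk (MulAction.orbitRel Γ X) '' interior (L x))
    (fun x => hq _ isOpen_interior) (fun q _ => by
      induction q using Quotient.inductionOn with
      | h x => exact Set.mem_iUnion.2 ⟨x, x, mem_interior_iff_mem_nhds.2 (hLx x), rfl⟩)
  refine ⟨⋃ x ∈ t, L x, t.isCompact_biUnion fun x _ => hL x, fun x => ?_⟩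
  obtain ⟨z, hz, k, hk, hkx⟩ := Set.mem_iUnion₂.1 (ht (Set.mem_univ (Quotient.mk _ x)))
  obtain ⟨γ, hγ⟩ := Quotient.exact hkx.symm
  exact ⟨γ, k, Set.mem_iUnion₂.2 ⟨z, hz, interior_subset hk⟩, hγ.symm⟩

/-- The fields `ψ_β X_{i,β}` are periodic. A bound over all metrics of the family on a compact set
meeting every orbit therefore holds on all of `X`, at the price of replacing `ω` by `γ⁻¹ ω`. -/
theorem exists_bound_divg_cut (hΓ : PeriodicAction Γ g₀) (P : PeriodicFrame Γ g₀)
    [CompactSpace (MulAction.orbitRel.Quotient Γ X)] (hg : RelativelyBounded g₀ g)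
    (hc : ∀ (γ : Γ) (ω : Ω), IsMetricMap (g ω) (g (γ • ω)) fun x => γ • x) :
    ∃ C : ℝ, 0 ≤ C ∧ ∀ (i : Fin d) (β : Fin P.n) (ω : Ω) (x : X),
      |divg (g ω) (P.cut i β) x| ≤ C := by
  obtain ⟨K, hK, hKX⟩ := exists_compact_cover hΓ
  choose C hC using fun p : Fin d × Fin P.n =>
    ((UniformField.const (Ω := Ω) (P.smoothField_cut p.1 p.2)).divg hg).exists_bound hK
  refine ⟨∑ p, |C p|, Finset.sum_nonneg fun _ _ => abs_nonneg _, fun i β ω x => ?_⟩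
  obtain ⟨γ, k, hk, rfl⟩ := hKX x
  have hm := hc γ (γ⁻¹ • ω)
  rw [smul_inv_smul] at hm
  rw [divg_cut_equivariant hΓ P hm i β k]
  exact (hC (i, β) _ k hk).trans ((le_abs_self _).trans
    (Finset.single_le_sum (f := fun p => |C p|) (fun _ _ => abs_nonneg _) (Finset.mem_univ (i, β))))

end UniformWords

/-! ### The energy form -/

section EnergyForm

variable {d : ℕ} {X : Type*} [TopologicalSpace X] [ChartedSpace (Coord d) X]
  [IsManifold 𝓘(ℝ, Coord d) (⊤ : ℕ∞) X]

variable [MeasurableSpace X] [BorelSpace X] [SecondCountableTopology X] [T2Space X]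

/-- The function `g(grad p, grad q)`. -/
noncomputable def gradR (g : SmoothMetric d X) (p q : X → ℝ) (x : X) : ℝ :=
  g.inner x (grad g p x) (grad g q x)

theorem gradR_eq_lieD (g : SmoothMetric d X) (p q : X → ℝ) : gradR g p q = lieD (grad g p) q :=
  funext fun x => inner_grad_eq_lieD g (grad g p) q x

theorem gradR_symm (g : SmoothMetric d X) (p q : X → ℝ) (x : X) : gradR g p q x = gradR g q p x :=
  g.symm _ _ _

theorem gradR_self_nonneg (g : SmoothMetric d X) (p : X → ℝ) (x : X) : 0 ≤ gradR g p p x := by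
  by_cases h : grad g p x = 0
  · simp [gradR, h]
  · exact (g.pos x _ h).le

theorem lieD_const_mul {Z : (x : X) → Tan d x} {u : X → ℝ} (hu : SmoothFun d u) (c : ℝ) (x : X) :
    lieD Z (fun z => c * u z) x = c * lieD Z u x := by
  have h1 : lieD Z (fun z => c * u z) x =
      (c • mfderiv 𝓘(ℝ, Coord d) 𝓘(ℝ, ℝ) u x) (Z x) :=
    DFunLike.congr_fun (const_smul_mfderiv (hu.mdiff x) c) (Z x)
  rw [h1]
  rfl

variable {g : SmoothMetric d X} {p q r : X → ℝ}

theorem gradR_add_right (hq : SmoothFun d q) (hr : SmoothFun d r) (x : X) :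
    gradR g p (fun z => q z + r z) x = gradR g p q x + gradR g p r x := by
  simp only [gradR_eq_lieD, lieD_add hq hr]

theorem gradR_add_left (hq : SmoothFun d q) (hr : SmoothFun d r) (x : X) :
    gradR g (fun z => q z + r z) p x = gradR g q p x + gradR g r p x := by
  simp only [gradR_symm g _ p, gradR_add_right hq hr]

theorem gradR_const_mul_left (hp : SmoothFun d p) (c : ℝ) (x : X) :
    gradR g (fun z => c * p z) q x = c * gradR g p q x := by
  rw [gradR_symm, gradR_symm g p, gradR_eq_lieD, gradR_eq_lieD, lieD_const_mul hp]

theorem gradR_mul_left (hp : SmoothFun d p) (hq : SmoothFun d q) (x : X) :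
    gradR g (fun z => p z * q z) r x = p x * gradR g q r x + q x * gradR g p r x := by
  simp only [gradR_symm g _ r, gradR_eq_lieD, lieD_mul hp hq]

theorem inner_sq_le (g : SmoothMetric d X) (x : X) (v w : Tan d x) :
    g.inner x v w ^ 2 ≤ g.inner x v v * g.inner x w w := by
  have := discrim_le_zero (a := g.inner x w w) (b := 2 * g.inner x v w) (c := g.inner x v v)
    fun t => by
      have h : 0 ≤ g.inner x (v + t • w) (v + t • w) := by
        by_cases h : v + t • w = 0
        · simp [h]
        · exact (g.pos x _ h).le
      simp only [map_add, map_smul, add_apply, smul_apply, smul_eq_mul] at h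
      rw [g.symm x w v] at h
      linarith
  unfold discrim at this
  linarith

theorem gradInner_eq (g : SmoothMetric d X) (u v : X → ℂ) (x : X) : gradInner g u v x =
    ((gradR g (fun z => (u z).re) (fun z => (v z).re) x +
      gradR g (fun z => (u z).im) (fun z => (v z).im) x : ℝ) : ℂ) +
    Complex.I * ((gradR g (fun z => (u z).im) (fun z => (v z).re) x -
      gradR g (fun z => (u z).re) (fun z => (v z).im) x : ℝ) : ℂ) := rfl

theorem gradInner_conj (g : SmoothMetric d X) (u v : X → ℂ) (x : X) :
    starRingEnd ℂ (gradInner g u v x) = gradInner g v u x := by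
  rw [gradInner_eq, gradInner_eq, gradR_symm g (fun z => (v z).re) (fun z => (u z).re),
    gradR_symm g (fun z => (v z).im) (fun z => (u z).im),
    gradR_symm g (fun z => (v z).im) (fun z => (u z).re),
    gradR_symm g (fun z => (v z).re) (fun z => (u z).im)]
  apply Complex.ext <;> simp

theorem gradInner_self (g : SmoothMetric d X) (u : X → ℂ) (x : X) : gradInner g u u x =
    ((gradR g (fun z => (u z).re) (fun z => (u z).re) x +
      gradR g (fun z => (u z).im) (fun z => (u z).im) x : ℝ) : ℂ) := by
  rw [gradInner_eq, gradR_symm g (fun z => (u z).im) (fun z => (u z).re)]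
  simp

variable {U : Set X} {u v w : X → ℂ}

theorem gradInner_add_left (hu : IsTest d U u) (hv : IsTest d U v) (x : X) :
    gradInner g (u + v) w x = gradInner g u w x + gradInner g v w x := by
  simp only [gradInner_eq, Pi.add_apply, Complex.add_re, Complex.add_im,
    gradR_add_left hu.re.smooth hv.re.smooth, gradR_add_left hu.im.smooth hv.im.smooth]
  push_cast
  ring

theorem gradInner_smul_left (hu : IsTest d U u) (c : ℂ) (x : X) :
    gradInner g (c • u) w x = c * gradInner g u w x := by
  have h1 : ∀ q : X → ℝ, gradR g (fun z => ((c • u) z).re) q x =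
      c.re * gradR g (fun z => (u z).re) q x - c.im * gradR g (fun z => (u z).im) q x := fun q => by
    have : (fun z => ((c • u) z).re) = fun z => c.re * (u z).re + (-c.im) * (u z).im := by
      ext z; simp; ring
    rw [this, gradR_add_left (SmoothFun.mul contMDiff_const hu.re.smooth)
      (SmoothFun.mul contMDiff_const hu.im.smooth), gradR_const_mul_left hu.re.smooth,
      gradR_const_mul_left hu.im.smooth]
    ring
  have h2 : ∀ q : X → ℝ, gradR g (fun z => ((c • u) z).im) q x =
      c.re * gradR g (fun z => (u z).im) q x + c.im * gradR g (fun z => (u z).re) q x := fun q => by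
    have : (fun z => ((c • u) z).im) = fun z => c.re * (u z).im + c.im * (u z).re := by
      ext z; simp
    rw [this, gradR_add_left (SmoothFun.mul contMDiff_const hu.im.smooth)
      (SmoothFun.mul contMDiff_const hu.re.smooth), gradR_const_mul_left hu.re.smooth,
      gradR_const_mul_left hu.im.smooth]
  rw [gradInner_eq, gradInner_eq, h1, h1, h2, h2]
  apply Complex.ext <;> simp <;> ring

/-- The complex linear extension of the derivative along a real vector field. -/
noncomputable def lieC (Z : (x : X) → Tan d x) : (X → ℂ) → X → ℂ := complexify (lieD Z)

theorem lieC_ofReal (Z : (x : X) → Tan d x) (p : X → ℝ) (x : X) :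
    lieC Z (fun z => (p z : ℂ)) x = lieD Z p x := by
  have h : lieD Z (fun _ => (0 : ℝ)) x = 0 := lieD_eq_zero (by simp [tsupport])
  simp [lieC, complexify, h]

theorem lieC_add {Z : (x : X) → Tan d x} (hu : IsTest d U u) (hv : IsTest d U v) (x : X) :
    lieC Z (u + v) x = lieC Z u x + lieC Z v x := by
  simp only [lieC, complexify, Pi.add_apply, Complex.add_re, Complex.add_im,
    lieD_add hu.re.smooth hv.re.smooth, lieD_add hu.im.smooth hv.im.smooth]
  push_cast
  ring

theorem lieC_smul {Z : (x : X) → Tan d x} (hu : IsTest d U u) (c : ℂ) (x : X) :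
    lieC Z (c • u) x = c * lieC Z u x := by
  have h1 : (fun z => ((c • u) z).re) = fun z => c.re * (u z).re + (-c.im) * (u z).im := by
    ext z; simp; ring
  have h2 : (fun z => ((c • u) z).im) = fun z => c.re * (u z).im + c.im * (u z).re := by
    ext z; simp
  simp only [lieC, complexify, h1, h2]
  rw [lieD_add (SmoothFun.mul contMDiff_const hu.re.smooth)
      (SmoothFun.mul contMDiff_const hu.im.smooth),
    lieD_add (SmoothFun.mul contMDiff_const hu.im.smooth)
      (SmoothFun.mul contMDiff_const hu.re.smooth), lieD_const_mul hu.re.smooth,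
    lieD_const_mul hu.im.smooth, lieD_const_mul hu.re.smooth, lieD_const_mul hu.im.smooth]
  apply Complex.ext
  · simp [sub_eq_add_neg]
  · simp

theorem IsTest.lieC {Z : (x : X) → Tan d x} (hZ : SmoothField Z) (hu : IsTest d U u) :
    IsTest d U (lieC Z u) :=
  (hu.complexify (D := RandomSchroedinger.lieD Z) (fun _ hh => SmoothFun.lieD hZ hh)
    fun _ _ hx => lieD_eq_zero hx).1

theorem isTest_gradR (hp : SmoothFun d p) (hq : IsTest d U q) : IsTest d U (gradR g p q) := by
  rw [gradR_eq_lieD]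
  exact hq.lieD (hp.grad g)

theorem isTest_gradInner (hu : IsTest d U u) (hv : IsTest d U v) :
    IsTest d U (gradInner g u v) := by
  have h1 := isTest_gradR (g := g) hu.re.smooth hv.re
  have h2 := isTest_gradR (g := g) hu.im.smooth hv.im
  have h3 := isTest_gradR (g := g) hu.im.smooth hv.re
  have h4 := isTest_gradR (g := g) hu.re.smooth hv.im
  refine IsTest.of_subset (u := fun x =>
    (((gradR g (fun z => (u z).re) (fun z => (v z).re) x : ℝ) : ℂ) +
      ((gradR g (fun z => (u z).im) (fun z => (v z).im) x : ℝ) : ℂ)) +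
    (Complex.I * ((gradR g (fun z => (u z).im) (fun z => (v z).re) x : ℝ) : ℂ) +
     (-Complex.I) * ((gradR g (fun z => (u z).re) (fun z => (v z).im) x : ℝ) : ℂ)))
    ((h1.ofReal.add h2.ofReal).add ((h3.ofReal.const_mul _).add (h4.ofReal.const_mul _))) ?_ ?_
  · have e : (fun x => (((gradR g (fun z => (u z).re) (fun z => (v z).re) x : ℝ) : ℂ) +
      ((gradR g (fun z => (u z).im) (fun z => (v z).im) x : ℝ) : ℂ)) +
      (Complex.I * ((gradR g (fun z => (u z).im) (fun z => (v z).re) x : ℝ) : ℂ) +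
      (-Complex.I) * ((gradR g (fun z => (u z).re) (fun z => (v z).im) x : ℝ) : ℂ))) =
        gradInner g u v := by
      ext x; rw [gradInner_eq]; push_cast; ring
    rw [← e]
    exact ((h1.ofReal.add h2.ofReal).add ((h3.ofReal.const_mul _).add (h4.ofReal.const_mul _))).smooth
  · refine tsupport_mono fun x hx => ?_
    rw [gradInner_eq, ← hx]; push_cast; ring

/-- The standing assumption on the potential in the definition of the form. -/
structure FormPotential (g : SmoothMetric d X) (V : X → ℝ) : Prop where
  nonneg : ∀ x, 0 ≤ V x
  integrable : ∀ p q : X → ℝ, IsTest d Set.univ p → IsTest d Set.univ q →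
    Integrable (fun x => V x * p x * q x) (vol g)

/-- The Laplacian of a test function is again a test function, so the relative bound gives `V p ∈
L²`. Integrability against a second test function is all that the quadratic form needs. -/
theorem RelLaplaceBounded.formPotential {V : X → ℝ} (h : RelLaplaceBounded g V)
    (h0 : ∀ x, 0 ≤ V x) (hm : Measurable V) : FormPotential g V := by
  refine ⟨h0, fun p q hp hq => ?_⟩
  obtain ⟨a, b, -, -, -, hab⟩ := h
  have h1 : MemLp (fun x => V x * p x) 2 (vol g) := by
    refine ⟨(hm.mul hp.continuous.measurable).aestronglyMeasurable, (hab p hp).trans_lt ?_⟩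
    have hl : IsTest d Set.univ (laplacian g p) := hp.of_subset (SmoothFun.laplacian g hp.smooth)
      (closure_minimal (fun x hx => by
        by_contra h
        exact hx (laplacian_eq_zero g h)) (isClosed_tsupport _))
    exact ENNReal.add_lt_top.2 ⟨ENNReal.mul_lt_top ENNReal.ofReal_lt_top
      (hl.continuous.memLp_of_hasCompactSupport hl.compact).eLpNorm_lt_top,
      ENNReal.mul_lt_top ENNReal.ofReal_lt_top
      (hp.continuous.memLp_of_hasCompactSupport hp.compact).eLpNorm_lt_top⟩
  exact h1.integrable_mul (q := 2) (hq.continuous.memLp_of_hasCompactSupport hq.compact)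

theorem FormPotential.integrable_complex {V : X → ℝ} (hV : FormPotential g V)
    (hu : IsTest d U u) (hv : IsTest d U v) :
    Integrable (fun x => (V x : ℂ) * u x * starRingEnd ℂ (v x)) (vol g) := by
  have hu := hu.mono (Set.subset_univ U)
  have hv := hv.mono (Set.subset_univ U)
  have h1 := (hV.integrable _ _ hu.re hv.re).add (hV.integrable _ _ hu.im hv.im)
  have h2 := (hV.integrable _ _ hu.im hv.re).sub (hV.integrable _ _ hu.re hv.im)
  refine (h1.ofReal.add (h2.ofReal.const_mul Complex.I)).congr (.of_forall fun x => ?_)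
  apply Complex.ext
  · simp
  · simp
    ring

theorem FormPotential.integrable_energy {V : X → ℝ} (hV : FormPotential g V)
    (hu : IsTest d U u) (hv : IsTest d U v) : Integrable (fun x => gradInner g u v x +
      (V x : ℂ) * u x * starRingEnd ℂ (v x)) (vol g) :=
  (integrable_of_isTest g (isTest_gradInner hu hv)).add (hV.integrable_complex hu hv)

theorem energyForm_add_left {V : X → ℝ} (hV : FormPotential g V)
    (hu : IsTest d U u) (hv : IsTest d U v) (hw : IsTest d U w) :
    energyForm g V U (u + v) w = energyForm g V U u w + energyForm g V U v w := by
  unfold energyForm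
  rw [← integral_add (hV.integrable_energy hu hw).restrict (hV.integrable_energy hv hw).restrict]
  refine integral_congr_ae (.of_forall fun x => ?_)
  simp only [gradInner_add_left hu hv, Pi.add_apply]
  ring

theorem energyForm_smul_left {V : X → ℝ} (hu : IsTest d U u) (c : ℂ) :
    energyForm g V U (c • u) w = c * energyForm g V U u w := by
  unfold energyForm
  rw [← integral_const_mul]
  refine integral_congr_ae (.of_forall fun x => ?_)
  simp only [gradInner_smul_left hu, Pi.smul_apply, smul_eq_mul]
  ring

theorem energyForm_conj (g : SmoothMetric d X) (V : X → ℝ) (U : Set X) (u v : X → ℂ) :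
    starRingEnd ℂ (energyForm g V U u v) = energyForm g V U v u := by
  unfold energyForm
  rw [← integral_conj]
  refine integral_congr_ae (.of_forall fun x => ?_)
  simp only [map_add, map_mul, gradInner_conj, Complex.conj_ofReal, Complex.conj_conj]
  ring

theorem energyForm_self (g : SmoothMetric d X) (V : X → ℝ) (U : Set X) (u : X → ℂ) :
    energyForm g V U u u = ((∫ x in U, (gradR g (fun z => (u z).re) (fun z => (u z).re) x +
      gradR g (fun z => (u z).im) (fun z => (u z).im) x + V x * ‖u x‖ ^ 2) ∂(vol g) : ℝ) : ℂ) := by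
  unfold energyForm
  rw [← integral_complex_ofReal]
  refine integral_congr_ae (.of_forall fun x => ?_)
  simp only [gradInner_self, mul_assoc, Complex.mul_conj, Complex.normSq_eq_norm_sq]
  push_cast
  ring

end EnergyForm

/-! ### The form domain and the resolvent -/

section Completion

/-- The space is produced existentially, which keeps the seminorm of the core from becoming an
instance on `W`. -/
theorem exists_hilbert_completion.{u} {W : Type u} [AddCommGroup W] [Module ℂ W]
    (c : PreInnerProductSpace.Core ℂ W) :
    ∃ (H : Type u) (_ : NormedAddCommGroup H) (_ : InnerProductSpace ℂ H) (_ : CompleteSpace H)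
      (J : W →ₗ[ℂ] H), DenseRange J ∧ ∀ u v, inner ℂ (J u) (J v) = c.inner u v := by
  let : SeminormedAddCommGroup W := InnerProductSpace.Core.toSeminormedAddCommGroup (𝕜 := ℂ)
  let : InnerProductSpace ℂ W := InnerProductSpace.ofCore c
  refine ⟨UniformSpace.Completion W, inferInstance, inferInstance, inferInstance,
    (UniformSpace.Completion.toComplₗᵢ (𝕜 := ℂ) (E := W)).toLinearMap,
    UniformSpace.Completion.denseRange_coe, fun u v => ?_⟩
  exact UniformSpace.Completion.inner_coe u v

theorem exists_extension {W H F : Type*} [AddCommGroup W] [Module ℂ W] [NormedAddCommGroup H]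
    [NormedSpace ℂ H] [NormedAddCommGroup F] [NormedSpace ℂ F] [CompleteSpace F]
    {J : W →ₗ[ℂ] H} (hJ : DenseRange J) (T₀ : W →ₗ[ℂ] F) {c : ℝ} (hc : 0 ≤ c)
    (h : ∀ u, ‖T₀ u‖ ≤ c * ‖J u‖) :
    ∃ T : H →L[ℂ] F, (∀ u, T (J u) = T₀ u) ∧ ‖T‖ ≤ c :=
  ⟨T₀.extendOfNorm J, LinearMap.extendOfNorm_eq hJ ⟨c, h⟩, LinearMap.opNorm_extendOfNorm_le hJ hc h⟩

theorem inner_self_eq_ofReal {E : Type*} [NormedAddCommGroup E] [InnerProductSpace ℂ E] (x : E) :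
    inner ℂ x x = ((‖x‖ ^ 2 : ℝ) : ℂ) := by
  rw [inner_self_eq_norm_sq_to_K]
  push_cast
  rfl

end Completion

/-! ### The form domain, and the resolvent as embedding times adjoint. -/

section FormDomain

universe u

variable {d : ℕ} {X : Type u} [TopologicalSpace X] [ChartedSpace (Coord d) X]
  [IsManifold 𝓘(ℝ, Coord d) (⊤ : ℕ∞) X] [MeasurableSpace X] [BorelSpace X]
  [SecondCountableTopology X] [T2Space X]

/-- The space `C_c^∞(Λ)`. -/
def testSpace (d : ℕ) {X : Type*} [TopologicalSpace X] [ChartedSpace (Coord d) X] [T2Space X]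
    (Λ : Set X) : Submodule ℂ (X → ℂ) where
  carrier := {u | IsTest d Λ u}
  add_mem' := fun hu hv => hu.add hv
  zero_mem' := IsTest.zero Λ
  smul_mem' := fun c _ hu => hu.const_mul c

variable {g : SmoothMetric d X} {V : X → ℝ} {Λ : Set X}

theorem IsTest.memLp (g : SmoothMetric d X) (Λ' : Set X) {u : X → ℂ} (hu : IsTest d Λ u) :
    MemLp u 2 ((vol g).restrict Λ') :=
  hu.continuous.memLp_of_hasCompactSupport hu.compact

/-- The inclusion of `C_c^∞(Λ)` into `L²(Λ, g)`. -/
noncomputable def toL2 (g : SmoothMetric d X) (Λ : Set X) : testSpace d Λ →ₗ[ℂ] L2 g Λ where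
  toFun u := (IsTest.memLp g Λ u.2).toLp u
  map_add' u v := MemLp.toLp_add (IsTest.memLp g Λ u.2) (IsTest.memLp g Λ v.2)
  map_smul' c u := MemLp.toLp_const_smul c (IsTest.memLp g Λ u.2)

theorem coeFn_toL2 (u : testSpace d Λ) :
    toL2 g Λ u =ᵐ[(vol g).restrict Λ] (u : X → ℂ) :=
  MemLp.coeFn_toLp (IsTest.memLp g Λ u.2)

theorem inner_toL2 (u : testSpace d Λ) (w : L2 g Λ) :
    inner ℂ (toL2 g Λ u) w = ∫ x in Λ, w x * starRingEnd ℂ ((u : X → ℂ) x) ∂(vol g) := by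
  rw [L2.inner_def]
  refine integral_congr_ae ?_
  filter_upwards [coeFn_toL2 (g := g) u] with x hx
  rw [RCLike.inner_apply, hx]

theorem inner_toL2_toL2 (u v : testSpace d Λ) : inner ℂ (toL2 g Λ u) (toL2 g Λ v) =
    ∫ x in Λ, (v : X → ℂ) x * starRingEnd ℂ ((u : X → ℂ) x) ∂(vol g) := by
  rw [inner_toL2]
  refine integral_congr_ae ?_
  filter_upwards [coeFn_toL2 (g := g) v] with x hx
  rw [hx]

theorem setIntegral_eq_of_isTest {u : X → ℂ} (hu : IsTest d Λ u) (w : X → ℂ) :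
    ∫ x in Λ, w x * u x ∂(vol g) = ∫ x, w x * u x ∂(vol g) :=
  setIntegral_eq_integral_of_forall_compl_eq_zero fun x hx => by
    rw [image_eq_zero_of_notMem_tsupport fun h => hx (hu.subset h), mul_zero]

/-- The scalar product of the form domain. -/
@[reducible] noncomputable def formCore (hV : FormPotential g V) (Λ : Set X) :
    PreInnerProductSpace.Core ℂ (testSpace d Λ) where
  -- The arguments are exchanged because `energyForm` is antilinear in its second argument and the
  -- scalar product in its first.
  inner u v := energyForm g V Λ v u + inner ℂ (toL2 g Λ u) (toL2 g Λ v)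
  conj_inner_symm u v := by
    simp only [map_add, energyForm_conj, inner_conj_symm]
  re_inner_nonneg u := by
    rw [map_add]
    refine add_nonneg ?_ inner_self_nonneg
    rw [energyForm_self]
    exact integral_nonneg fun x => add_nonneg (add_nonneg (gradR_self_nonneg _ _ _)
      (gradR_self_nonneg _ _ _)) (mul_nonneg (hV.nonneg x) (sq_nonneg _))
  add_left u v w := by
    rw [← energyForm_conj g V Λ ((u + v : testSpace d Λ) : X → ℂ), ← energyForm_conj g V Λ (u : X → ℂ),
      ← energyForm_conj g V Λ (v : X → ℂ), Submodule.coe_add, energyForm_add_left hV u.2 v.2 w.2,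
      map_add, map_add, inner_add_left]
    ring
  smul_left u v c := by
    rw [← energyForm_conj g V Λ ((c • u : testSpace d Λ) : X → ℂ),
      ← energyForm_conj g V Λ (u : X → ℂ), Submodule.coe_smul, energyForm_smul_left u.2,
      map_mul, map_smul, inner_smul_left]
    ring

/-- `J` embeds `C_c^∞(Λ)` as a dense subspace of the form domain `H`, with the form norm. -/
structure IsFormDomain (g : SmoothMetric d X) (V : X → ℝ) (Λ : Set X) {H : Type*}
    [NormedAddCommGroup H] [InnerProductSpace ℂ H] (J : testSpace d Λ →ₗ[ℂ] H) : Prop where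
  dense : DenseRange J
  inner_eq : ∀ u v, inner ℂ (J u) (J v) =
    energyForm g V Λ v u + inner ℂ (toL2 g Λ u) (toL2 g Λ v)

theorem exists_formDomain (hV : FormPotential g V) (Λ : Set X) :
    ∃ (H : Type u) (_ : NormedAddCommGroup H) (_ : InnerProductSpace ℂ H) (_ : CompleteSpace H)
      (J : testSpace d Λ →ₗ[ℂ] H), IsFormDomain g V Λ J := by
  obtain ⟨H, h1, h2, h3, J, hJ, hi⟩ := exists_hilbert_completion (formCore hV Λ)
  exact ⟨H, h1, h2, h3, J, hJ, hi⟩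

section Resolvent

variable {H : Type*} [NormedAddCommGroup H] [InnerProductSpace ℂ H] [CompleteSpace H]
  {J : testSpace d Λ →ₗ[ℂ] H}

theorem IsFormDomain.norm_sq (hJ : IsFormDomain g V Λ J) (u : testSpace d Λ) :
    ‖J u‖ ^ 2 = (∫ x in Λ, (gradR g (fun z => ((u : X → ℂ) z).re) (fun z => ((u : X → ℂ) z).re) x +
      gradR g (fun z => ((u : X → ℂ) z).im) (fun z => ((u : X → ℂ) z).im) x +
        V x * ‖(u : X → ℂ) x‖ ^ 2) ∂(vol g)) + ‖toL2 g Λ u‖ ^ 2 := by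
  have h := hJ.inner_eq u u
  rw [inner_self_eq_ofReal, inner_self_eq_ofReal, energyForm_self] at h
  exact_mod_cast h

theorem norm_toL2_sq (u : testSpace d Λ) :
    ‖toL2 g Λ u‖ ^ 2 = ∫ x in Λ, ‖(u : X → ℂ) x‖ ^ 2 ∂(vol g) := by
  have h := inner_toL2_toL2 (g := g) u u
  simp only [Complex.mul_conj, Complex.normSq_eq_norm_sq] at h
  rw [inner_self_eq_ofReal, integral_complex_ofReal] at h
  exact_mod_cast h

theorem IsFormDomain.norm_toL2_le (hV : FormPotential g V) (hJ : IsFormDomain g V Λ J)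
    (u : testSpace d Λ) : ‖toL2 g Λ u‖ ≤ 1 * ‖J u‖ := by
  rw [one_mul]
  refine le_of_sq_le_sq ?_ (norm_nonneg _)
  rw [hJ.norm_sq]
  exact le_add_of_nonneg_left (integral_nonneg fun x => add_nonneg (add_nonneg
    (gradR_self_nonneg _ _ _) (gradR_self_nonneg _ _ _)) (mul_nonneg (hV.nonneg x) (sq_nonneg _)))

/-- The resolvent as the product of the embedding of the form domain and its adjoint. -/
theorem IsFormDomain.isResolvent (hJ : IsFormDomain g V Λ J) {ι : H →L[ℂ] L2 g Λ}
    (hι : ∀ u, ι (J u) = toL2 g Λ u) :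
    IsResolvent g V Λ (ι.comp (ContinuousLinearMap.adjoint ι)) := by
  have hnorm : ∀ (φ : testSpace d Λ) (u : L2 g Λ),
      eLpNorm (fun x => (φ : X → ℂ) x - u x) 2 ((vol g).restrict Λ) =
        ENNReal.ofReal ‖toL2 g Λ φ - u‖ := fun φ u => by
    rw [Lp.norm_def, ENNReal.ofReal_toReal (Lp.eLpNorm_ne_top _)]
    refine eLpNorm_congr_ae ?_
    filter_upwards [coeFn_toL2 (g := g) φ, Lp.coeFn_sub (toL2 g Λ φ) u] with x h1 h2
    rw [h2, Pi.sub_apply, h1]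
  have hten : ∀ (φ : ℕ → testSpace d Λ) (u : L2 g Λ),
      Tendsto (fun n => eLpNorm (fun x => (φ n : X → ℂ) x - u x) 2 ((vol g).restrict Λ)) atTop
        (𝓝 0) ↔ Tendsto (fun n => toL2 g Λ (φ n)) atTop (𝓝 u) := fun φ u => by
    simp only [hnorm]
    rw [tendsto_iff_norm_sub_tendsto_zero, ← ENNReal.ofReal_zero]
    refine ⟨fun h => ?_, fun h => ENNReal.tendsto_ofReal h⟩
    have := (ENNReal.tendsto_toReal (by simp)).comp h
    simpa [Function.comp_def] using this
  have hw : ∀ (v : testSpace d Λ) (h : L2 g Λ),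
      inner ℂ (toL2 g Λ v) h = inner ℂ (J v) (ContinuousLinearMap.adjoint ι h) := fun v h => by
    rw [ContinuousLinearMap.adjoint_inner_right, hι]
  have hen : ∀ u v : testSpace d Λ, energyForm g V Λ v u =
      inner ℂ (J u) (J v) - inner ℂ (toL2 g Λ u) (toL2 g Λ v) := fun u v => by
    rw [hJ.inner_eq]; ring
  have henself : ∀ u : testSpace d Λ, energyForm g V Λ u u =
      ((‖J u‖ ^ 2 - ‖toL2 g Λ u‖ ^ 2 : ℝ) : ℂ) := fun u => by
    rw [hen, inner_self_eq_ofReal, inner_self_eq_ofReal, Complex.ofReal_sub]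
  intro h u
  rw [ContinuousLinearMap.comp_apply]
  constructor
  · rintro rfl
    -- In the form domain `ξ` represents the functional `v ↦ ⟨h, v⟩` of the weak equation. Test
    -- functions converging to it in the form norm are the required approximation of `ι ξ`.
    set ξ := ContinuousLinearMap.adjoint ι h with hξ
    obtain ⟨z, hz, hzξ⟩ := mem_closure_iff_seq_limit.1 (hJ.dense ξ)
    choose φ hφ using hz
    have hJφ : Tendsto (fun n => J (φ n)) atTop (𝓝 ξ) := by simpa only [hφ] using hzξ
    have hLφ : Tendsto (fun n => toL2 g Λ (φ n)) atTop (𝓝 (ι ξ)) := by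
      have : Tendsto (fun n => ι (J (φ n))) atTop (𝓝 (ι ξ)) := (ι.continuous.tendsto ξ).comp hJφ
      simpa only [hι] using this
    refine ⟨fun n => φ n, fun n => (φ n).2, (hten φ _).2 hLφ, ?_, fun v hv => ?_⟩
    · have h1 : ∀ p : ℕ × ℕ, energyForm g V Λ ((φ p.1 : X → ℂ) - φ p.2) ((φ p.1 : X → ℂ) - φ p.2) =
          ((dist (J (φ p.1)) (J (φ p.2)) ^ 2 -
            dist (toL2 g Λ (φ p.1)) (toL2 g Λ (φ p.2)) ^ 2 : ℝ) : ℂ) := fun p => by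
        rw [dist_eq_norm, dist_eq_norm, ← map_sub, ← map_sub]
        exact henself (φ p.1 - φ p.2)
      have h2 := cauchySeq_iff_tendsto_dist_atTop_0.1 hJφ.cauchySeq
      have h3 := cauchySeq_iff_tendsto_dist_atTop_0.1 hLφ.cauchySeq
      have h4 := (Complex.continuous_ofReal.tendsto _).comp ((h2.pow 2).sub (h3.pow 2))
      simp only [h1]
      simpa [Function.comp_def] using h4
    · lift v to testSpace d Λ using hv
      simp only [hen v]
      rw [← inner_toL2 v (h - ι ξ), inner_sub_right, hw v h]
      exact (tendsto_const_nhds.inner hJφ).sub (tendsto_const_nhds.inner hLφ)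
  · rintro ⟨φ, hφ, h1, h2, h3⟩
    lift φ to ℕ → testSpace d Λ using hφ
    have hLφ := (hten φ u).1 h1
    -- The squared form norm is the energy plus the squared `L²` norm, and the sequence is Cauchy
    -- for both.
    have hcs : CauchySeq fun n => J (φ n) := by
      rw [cauchySeq_iff_tendsto_dist_atTop_0]
      have h4 := cauchySeq_iff_tendsto_dist_atTop_0.1 hLφ.cauchySeq
      have h5 := (Complex.continuous_re.tendsto _).comp h2
      have h6 := (h5.add (h4.pow 2)).sqrt
      have h7 : ∀ p : ℕ × ℕ, dist (J (φ p.1)) (J (φ p.2)) = Real.sqrt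
          ((energyForm g V Λ ((φ p.1 : X → ℂ) - φ p.2) ((φ p.1 : X → ℂ) - φ p.2)).re +
            dist (toL2 g Λ (φ p.1)) (toL2 g Λ (φ p.2)) ^ 2) := fun p => by
        have := henself (φ p.1 - φ p.2)
        rw [Submodule.coe_sub] at this
        rw [this, Complex.ofReal_re, dist_eq_norm, dist_eq_norm, ← map_sub, ← map_sub,
          sub_add_cancel, Real.sqrt_sq (norm_nonneg _)]
      simp only [h7]
      simpa [Function.comp_def] using h6
    obtain ⟨ξ, hξ⟩ := cauchySeq_tendsto_of_complete hcs
    have hιξ : ι ξ = u := by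
      have := (ι.continuous.tendsto ξ).comp hξ
      simp only [Function.comp_def, hι] at this
      exact tendsto_nhds_unique this hLφ
    -- The weak equation `q(u, v) = ⟨h - u, v⟩`, after adding `⟨u, v⟩`, says that the limit and `ι*
    -- h` have the same scalar product with every test function.
    have hξh : ξ = ContinuousLinearMap.adjoint ι h := by
      refine hJ.dense.eq_of_inner_right ℂ fun v => ?_
      rw [← hw v h]
      have h4 := h3 v v.2
      rw [← inner_toL2 v (h - u), inner_sub_right] at h4
      simp only [hen v] at h4
      have h5 : Tendsto (fun n => inner ℂ (J v) (J (φ n)) - inner ℂ (toL2 g Λ v) (toL2 g Λ (φ n)))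
          atTop (𝓝 (inner ℂ (J v) ξ - inner ℂ (toL2 g Λ v) u)) :=
        (tendsto_const_nhds.inner hξ).sub (tendsto_const_nhds.inner hLφ)
      have h6 := tendsto_nhds_unique h5 h4
      linear_combination h6
    rw [← hξh, hιξ]

end Resolvent

end FormDomain

/-! ### First-order operators and multiplications on the form core. -/

section FirstOrder

universe u

variable {d : ℕ} {X : Type u} [TopologicalSpace X] [ChartedSpace (Coord d) X]
  [IsManifold 𝓘(ℝ, Coord d) (⊤ : ℕ∞) X] [MeasurableSpace X] [BorelSpace X]
  [SecondCountableTopology X] [T2Space X] {g : SmoothMetric d X} {V : X → ℝ} {Λ : Set X}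

theorem norm_lieC_sq_le {Z : (x : X) → Tan d x} {c : ℝ} {x : X} (hc : g.inner x (Z x) (Z x) ≤ c)
    (u : X → ℂ) : ‖lieC Z u x‖ ^ 2 ≤ c * (gradR g (fun z => (u z).re) (fun z => (u z).re) x +
      gradR g (fun z => (u z).im) (fun z => (u z).im) x) := by
  have h1 : ∀ p : X → ℝ, lieD Z p x ^ 2 ≤ c * gradR g p p x := fun p => by
    rw [← inner_grad_eq_lieD g]
    exact (inner_sq_le g x _ _).trans (mul_le_mul_of_nonneg_right hc (gradR_self_nonneg g p x))
  have h2 : ‖lieC Z u x‖ ^ 2 = lieD Z (fun z => (u z).re) x ^ 2 +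
      lieD Z (fun z => (u z).im) x ^ 2 := by
    rw [← Complex.normSq_eq_norm_sq, Complex.normSq_apply]
    simp [lieC, complexify, sq]
  rw [h2, mul_add]
  exact add_le_add (h1 _) (h1 _)

theorem lieC_conj {Z : (x : X) → Tan d x} {U : Set X} {u : X → ℂ} (hu : IsTest d U u) (x : X) :
    lieC Z (fun z => starRingEnd ℂ (u z)) x = starRingEnd ℂ (lieC Z u x) := by
  have h : lieD Z (fun z => -(u z).im) x = -lieD Z (fun z => (u z).im) x := by
    simpa using lieD_const_mul (Z := Z) hu.im.smooth (-1) x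
  simp only [lieC, complexify, Complex.conj_re, Complex.conj_im, h]
  apply Complex.ext <;> simp

theorem lieC_mul {Z : (x : X) → Tan d x} {U U' : Set X} {u v : X → ℂ} (hu : IsTest d U u)
    (hv : IsTest d U' v) (x : X) :
    lieC Z (fun z => u z * v z) x = u x * lieC Z v x + v x * lieC Z u x := by
  have h1 : lieD Z (fun z => (u z).re * (v z).re - (u z).im * (v z).im) x =
      (u x).re * lieD Z (fun z => (v z).re) x + (v x).re * lieD Z (fun z => (u z).re) x -
      ((u x).im * lieD Z (fun z => (v z).im) x + (v x).im * lieD Z (fun z => (u z).im) x) := by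
    have h : (fun z => (u z).re * (v z).re - (u z).im * (v z).im) =
        fun z => (u z).re * (v z).re + (-1) * ((u z).im * (v z).im) := by ext z; ring
    rw [h, lieD_add (SmoothFun.mul hu.re.smooth hv.re.smooth)
      (SmoothFun.mul contMDiff_const (SmoothFun.mul hu.im.smooth hv.im.smooth)),
      lieD_const_mul (SmoothFun.mul hu.im.smooth hv.im.smooth), lieD_mul hu.re.smooth hv.re.smooth,
      lieD_mul hu.im.smooth hv.im.smooth]
    ring
  have h2 : lieD Z (fun z => (u z).re * (v z).im + (u z).im * (v z).re) x =
      (u x).re * lieD Z (fun z => (v z).im) x + (v x).im * lieD Z (fun z => (u z).re) x +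
      ((u x).im * lieD Z (fun z => (v z).re) x + (v x).re * lieD Z (fun z => (u z).im) x) := by
    rw [lieD_add (SmoothFun.mul hu.re.smooth hv.im.smooth) (SmoothFun.mul hu.im.smooth hv.re.smooth),
      lieD_mul hu.re.smooth hv.im.smooth, lieD_mul hu.im.smooth hv.re.smooth]
  simp only [lieC, complexify, Complex.mul_re, Complex.mul_im]
  rw [h1, h2]
  apply Complex.ext
  · simp
    ring
  · simp
    ring

theorem integral_mul_divg_complex (g : SmoothMetric d X) {Z : (x : X) → Tan d x}
    (hZ : SmoothField Z) {φ : X → ℂ} (hφ : IsTest d Set.univ φ) :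
    ∫ x, φ x * (divg g Z x : ℂ) ∂(vol g) = - ∫ x, lieC Z φ x ∂(vol g) := by
  have h1 : ∀ p : X → ℝ, IsTest d Set.univ p →
      Integrable (fun x => ((p x * divg g Z x : ℝ) : ℂ)) (vol g) := fun p hp =>
    (integrable_of_isTest g (hp.mul_right (smoothFun_divg g hZ))).ofReal
  have h2 : ∀ p : X → ℝ, IsTest d Set.univ p →
      Integrable (fun x => ((lieD Z p x : ℝ) : ℂ)) (vol g) := fun p hp =>
    (integrable_of_isTest g (hp.lieD hZ)).ofReal
  have h3 : ∀ x, φ x * (divg g Z x : ℂ) = (((φ x).re * divg g Z x : ℝ) : ℂ) +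
      Complex.I * (((φ x).im * divg g Z x : ℝ) : ℂ) := fun x => by
    apply Complex.ext <;> simp
  simp only [h3, lieC, complexify]
  rw [integral_add (h1 _ hφ.re) ((h1 _ hφ.im).const_mul _), integral_add (h2 _ hφ.re)
    ((h2 _ hφ.im).const_mul _), integral_const_mul, integral_const_mul]
  have h4 : ∀ p : X → ℝ, IsTest d Set.univ p → ∫ x, ((p x * divg g Z x : ℝ) : ℂ) ∂(vol g) =
      - ∫ x, ((lieD Z p x : ℝ) : ℂ) ∂(vol g) := fun p hp => by
    rw [integral_complex_ofReal, integral_complex_ofReal, integral_mul_divg g hZ hp,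
      Complex.ofReal_neg]
  rw [h4 _ hφ.re, h4 _ hφ.im]
  ring

/-- The derivative along a smooth vector field, on `C_c^∞(Λ)`. -/
noncomputable def lieL {Z : (x : X) → Tan d x} (hZ : SmoothField Z) (Λ : Set X) :
    testSpace d Λ →ₗ[ℂ] testSpace d Λ where
  toFun u := ⟨lieC Z u, u.2.lieC hZ⟩
  map_add' u v := Subtype.ext (funext fun x => lieC_add u.2 v.2 x)
  map_smul' c u := Subtype.ext (funext fun x => lieC_smul u.2 c x)

/-- Multiplication by a smooth real function, on `C_c^∞(Λ)`. -/
noncomputable def mulL {f : X → ℝ} (hf : SmoothFun d f) (Λ : Set X) :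
    testSpace d Λ →ₗ[ℂ] testSpace d Λ where
  toFun u := ⟨fun x => (f x : ℂ) * (u : X → ℂ) x, IsTest.mul_left u.2 (contMDiff_ofReal hf)⟩
  map_add' _ _ := Subtype.ext (funext fun _ => mul_add _ _ _)
  map_smul' _ _ := Subtype.ext (funext fun _ => mul_left_comm _ _ _)

/-- Integration by parts. -/
theorem inner_toL2_divg {Z : (x : X) → Tan d x} (hZ : SmoothField Z) (u v : testSpace d Λ) :
    inner ℂ (toL2 g Λ v) (toL2 g Λ (lieL hZ Λ u + mulL (smoothFun_divg g hZ) Λ u)) =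
      - inner ℂ (toL2 g Λ (lieL hZ Λ v)) (toL2 g Λ u) := by
  have hc := IsTest.conj v.2
  have hφ : IsTest d Set.univ fun x => (u : X → ℂ) x * starRingEnd ℂ ((v : X → ℂ) x) :=
    (IsTest.mul_left hc u.2.smooth).mono (Set.subset_univ _)
  have h1 := integral_mul_divg_complex g hZ hφ
  have h2 : ∀ x, lieC Z (fun x => (u : X → ℂ) x * starRingEnd ℂ ((v : X → ℂ) x)) x =
      (u : X → ℂ) x * starRingEnd ℂ (lieC Z v x) + starRingEnd ℂ ((v : X → ℂ) x) * lieC Z u x :=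
    fun x => by rw [lieC_mul u.2 hc, lieC_conj v.2]
  have hi1 : Integrable (fun x => (u : X → ℂ) x * starRingEnd ℂ (lieC Z v x)) (vol g) :=
    integrable_of_isTest g (IsTest.mul_left (IsTest.conj (v.2.lieC hZ)) u.2.smooth)
  have hi2 : Integrable (fun x => starRingEnd ℂ ((v : X → ℂ) x) * lieC Z u x) (vol g) :=
    integrable_of_isTest g (IsTest.mul_left (u.2.lieC hZ) hc.smooth)
  have hi3 : Integrable (fun x => (u : X → ℂ) x * starRingEnd ℂ ((v : X → ℂ) x) *
      (divg g Z x : ℂ)) (vol g) :=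
    integrable_of_isTest g (IsTest.mul_right hφ (contMDiff_ofReal (smoothFun_divg g hZ)))
  simp only [h2] at h1
  rw [integral_add hi1 hi2] at h1
  rw [inner_toL2_toL2, inner_toL2_toL2, setIntegral_eq_of_isTest hc,
    setIntegral_eq_of_isTest (IsTest.conj (lieL hZ Λ v).2)]
  have h3 : ∀ x, ((lieL hZ Λ u + mulL (smoothFun_divg g hZ) Λ u : testSpace d Λ) : X → ℂ) x *
      starRingEnd ℂ ((v : X → ℂ) x) = starRingEnd ℂ ((v : X → ℂ) x) * lieC Z u x +
      (u : X → ℂ) x * starRingEnd ℂ ((v : X → ℂ) x) * (divg g Z x : ℂ) := fun x => by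
    change (lieC Z u x + (divg g Z x : ℂ) * (u : X → ℂ) x) * _ = _
    ring
  simp only [h3]
  rw [integral_add hi2 hi3, h1]
  change _ = - ∫ x, (u : X → ℂ) x * starRingEnd ℂ (lieC Z v x) ∂(vol g)
  ring

/-- The square of the norm of the gradient of a complex function. -/
noncomputable def gradSq (g : SmoothMetric d X) (u : X → ℂ) (x : X) : ℝ :=
  gradR g (fun z => (u z).re) (fun z => (u z).re) x +
    gradR g (fun z => (u z).im) (fun z => (u z).im) x

theorem gradSq_nonneg (g : SmoothMetric d X) (u : X → ℂ) (x : X) : 0 ≤ gradSq g u x :=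
  add_nonneg (gradR_self_nonneg _ _ _) (gradR_self_nonneg _ _ _)

theorem integrable_gradSq (g : SmoothMetric d X) (u : testSpace d Λ) :
    Integrable (gradSq g u) (vol g) :=
  (integrable_of_isTest g (isTest_gradR u.2.re.smooth u.2.re)).add
    (integrable_of_isTest g (isTest_gradR u.2.im.smooth u.2.im))

theorem FormPotential.integrable_sq (hV : FormPotential g V) (u : testSpace d Λ) :
    Integrable (fun x => V x * ‖(u : X → ℂ) x‖ ^ 2) (vol g) := by
  refine (hV.integrable_complex u.2 u.2).re.congr (.of_forall fun x => ?_)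
  simp only [mul_assoc, Complex.mul_conj, Complex.normSq_eq_norm_sq]
  exact (congrArg Complex.re (Complex.ofReal_mul _ _)).symm

theorem integrable_norm_sq (g : SmoothMetric d X) (u : testSpace d Λ) :
    Integrable (fun x => ‖(u : X → ℂ) x‖ ^ 2) (vol g) :=
  (u.2.continuous.memLp_of_hasCompactSupport u.2.compact).integrable_norm_pow (by simp)

section

variable {H : Type*} [NormedAddCommGroup H] [InnerProductSpace ℂ H] [CompleteSpace H]
  {J : testSpace d Λ →ₗ[ℂ] H}

theorem IsFormDomain.norm_sq_eq (hV : FormPotential g V) (hJ : IsFormDomain g V Λ J)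
    (u : testSpace d Λ) : ‖J u‖ ^ 2 = ∫ x in Λ, (gradSq g u x + V x * ‖(u : X → ℂ) x‖ ^ 2 +
      ‖(u : X → ℂ) x‖ ^ 2) ∂(vol g) := by
  have h := integral_add ((integrable_gradSq g u).add (hV.integrable_sq u)).restrict
    (integrable_norm_sq g u).restrict (μ := (vol g).restrict Λ)
  rw [hJ.norm_sq, norm_toL2_sq]
  exact h.symm

theorem IsFormDomain.norm_lieL_le (hV : FormPotential g V) (hJ : IsFormDomain g V Λ J)
    {Z : (x : X) → Tan d x} (hZ : SmoothField Z) {c : ℝ} (hc0 : 0 ≤ c)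
    (hc : ∀ x, g.inner x (Z x) (Z x) ≤ c ^ 2) (u : testSpace d Λ) :
    ‖toL2 g Λ (lieL hZ Λ u)‖ ≤ c * ‖J u‖ := by
  refine le_of_sq_le_sq ?_ (mul_nonneg hc0 (norm_nonneg _))
  rw [norm_toL2_sq, mul_pow, hJ.norm_sq_eq hV, ← integral_const_mul]
  refine integral_mono (integrable_norm_sq g _).restrict
    ((((integrable_gradSq g u).add (hV.integrable_sq u)).add
      (integrable_norm_sq g u)).const_mul _).restrict fun x => ?_
  refine (norm_lieC_sq_le (hc x) u).trans ?_
  have := mul_nonneg (hV.nonneg x) (sq_nonneg ‖(u : X → ℂ) x‖)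
  refine mul_le_mul_of_nonneg_left ?_ (sq_nonneg c)
  change gradSq g u x ≤ gradSq g u x + V x * ‖(u : X → ℂ) x‖ ^ 2 + ‖(u : X → ℂ) x‖ ^ 2
  linarith [sq_nonneg ‖(u : X → ℂ) x‖]

theorem norm_toL2_le_of_le {u v : testSpace d Λ} {c : ℝ}
    (h : ∀ x, ‖(v : X → ℂ) x‖ ≤ c * ‖(u : X → ℂ) x‖) : ‖toL2 g Λ v‖ ≤ c * ‖toL2 g Λ u‖ := by
  refine Lp.norm_le_mul_norm_of_ae_le_mul ?_
  filter_upwards [coeFn_toL2 (g := g) u, coeFn_toL2 (g := g) v] with x hu hv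
  rw [hu, hv]
  exact h x

theorem gradSq_mul_le {f : X → ℝ} (hf : SmoothFun d f) (u : testSpace d Λ) (x : X) :
    gradSq g (mulL hf Λ u : testSpace d Λ) x ≤
      2 * f x ^ 2 * gradSq g u x + 2 * gradR g f f x * ‖(u : X → ℂ) x‖ ^ 2 := by
  have h1 : ∀ p : X → ℝ, SmoothFun d p → gradR g (fun z => f z * p z) (fun z => f z * p z) x ≤
      2 * f x ^ 2 * gradR g p p x + 2 * gradR g f f x * p x ^ 2 := fun p hp => by
    have h2 : ∀ r, gradR g r (fun z => f z * p z) x = f x * gradR g r p x + p x * gradR g r f x :=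
      fun r => by rw [gradR_symm, gradR_mul_left hf hp, gradR_symm g p, gradR_symm g f]
    -- Leibniz gives `|f ∇p + p ∇f|²`; adding the nonnegative `|f ∇p - p ∇f|²` removes the mixed
    -- terms and doubles the squares.
    have h3 : 0 ≤ g.inner x (f x • grad g p x - p x • grad g f x)
        (f x • grad g p x - p x • grad g f x) := by
      by_cases h : f x • grad g p x - p x • grad g f x = 0
      · simp [h]
      · exact (g.pos x _ h).le
    simp only [map_sub, map_smul, sub_apply, smul_apply, smul_eq_mul] at h3
    rw [gradR_mul_left hf hp, h2, h2]
    unfold gradR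
    nlinarith [g.symm x (grad g p x) (grad g f x)]
  have e1 : (fun z => ((mulL hf Λ u : testSpace d Λ) : X → ℂ) z |>.re) =
      fun z => f z * ((u : X → ℂ) z).re := funext fun z => Complex.re_ofReal_mul _ _
  have e2 : (fun z => ((mulL hf Λ u : testSpace d Λ) : X → ℂ) z |>.im) =
      fun z => f z * ((u : X → ℂ) z).im := funext fun z => Complex.im_ofReal_mul _ _
  unfold gradSq
  rw [e1, e2, ← Complex.normSq_eq_norm_sq, Complex.normSq_apply]
  linarith [h1 _ u.2.re.smooth, h1 _ u.2.im.smooth]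

/-- This lets multiplication by `f` extend to the form domain. The constant depends on `g` and `f`,
but it does not enter the final bounds, for which only the existence of the extension matters. -/
theorem IsFormDomain.exists_norm_mulL_le (hV : FormPotential g V) (hJ : IsFormDomain g V Λ J)
    {f : X → ℝ} (hf : IsTest d Set.univ f) :
    ∃ c : ℝ, 0 ≤ c ∧ ∀ u : testSpace d Λ, ‖J (mulL hf.smooth Λ u)‖ ≤ c * ‖J u‖ := by
  obtain ⟨A, hA⟩ := hf.continuous.bounded_above_of_compact_support hf.compact
  have hG : IsTest d Set.univ (gradR g f f) := isTest_gradR hf.smooth hf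
  obtain ⟨B, hB⟩ := hG.continuous.bounded_above_of_compact_support hG.compact
  refine ⟨Real.sqrt (2 * A ^ 2 + 2 * |B|), Real.sqrt_nonneg _, fun u => ?_⟩
  refine le_of_sq_le_sq ?_ (mul_nonneg (Real.sqrt_nonneg _) (norm_nonneg _))
  rw [mul_pow, Real.sq_sqrt (by positivity), hJ.norm_sq_eq hV, hJ.norm_sq_eq hV,
    ← integral_const_mul]
  refine integral_mono (((integrable_gradSq g _).add (hV.integrable_sq _)).add
      (integrable_norm_sq g _)).restrict ((((integrable_gradSq g u).add (hV.integrable_sq u)).add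
      (integrable_norm_sq g u)).const_mul _).restrict fun x => ?_
  have h1 := gradSq_mul_le (g := g) hf.smooth u x
  have h2 : ‖((mulL hf.smooth Λ u : testSpace d Λ) : X → ℂ) x‖ ^ 2 =
      f x ^ 2 * ‖(u : X → ℂ) x‖ ^ 2 := by
    change ‖(f x : ℂ) * (u : X → ℂ) x‖ ^ 2 = _
    rw [norm_mul, mul_pow, Complex.norm_real, Real.norm_eq_abs, sq_abs]
  have h3 : f x ^ 2 ≤ A ^ 2 := sq_le_sq' (neg_le_of_abs_le (hA x)) (le_of_abs_le (hA x))
  have h4 : gradR g f f x ≤ |B| := (le_abs_self _).trans ((hB x).trans (le_abs_self B))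
  have h5 := gradSq_nonneg g u x
  have h6 := hV.nonneg x
  have h7 := sq_nonneg ‖(u : X → ℂ) x‖
  simp only
  rw [h2]
  have h8 : 2 * f x ^ 2 * gradSq g u x ≤ 2 * A ^ 2 * gradSq g u x := by gcongr
  have h9 : 2 * gradR g f f x * ‖(u : X → ℂ) x‖ ^ 2 ≤ 2 * |B| * ‖(u : X → ℂ) x‖ ^ 2 := by gcongr
  have h10 : f x ^ 2 * ‖(u : X → ℂ) x‖ ^ 2 ≤ A ^ 2 * ‖(u : X → ℂ) x‖ ^ 2 := by gcongr
  have h11 := mul_le_mul_of_nonneg_left h10 h6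
  have h12 := mul_nonneg h6 h7
  have h13 := mul_nonneg (sq_nonneg A) h12
  have h14 := mul_nonneg (abs_nonneg B) h12
  have h15 := mul_nonneg (abs_nonneg B) h5
  have h16 := mul_nonneg (sq_nonneg A) h7
  nlinarith

/-- By Leibniz both sides contain `f` times the gradient pairing of `u` and `v`, and this
second-order part cancels. -/
theorem gradInner_mul_sub {f : X → ℝ} (hf : SmoothFun d f) (u v : testSpace d Λ) (x : X) :
    gradInner g (mulL hf Λ u : testSpace d Λ) v x - gradInner g u (mulL hf Λ v : testSpace d Λ) x =
      (u : X → ℂ) x * starRingEnd ℂ (lieC (grad g f) v x) -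
        lieC (grad g f) u x * starRingEnd ℂ ((v : X → ℂ) x) := by
  have e1 : ∀ w : testSpace d Λ, (fun z => (((mulL hf Λ w : testSpace d Λ) : X → ℂ) z).re) =
      fun z => f z * ((w : X → ℂ) z).re := fun w => funext fun z => Complex.re_ofReal_mul _ _
  have e2 : ∀ w : testSpace d Λ, (fun z => (((mulL hf Λ w : testSpace d Λ) : X → ℂ) z).im) =
      fun z => f z * ((w : X → ℂ) z).im := fun w => funext fun z => Complex.im_ofReal_mul _ _
  have h1 : ∀ p q : X → ℝ, SmoothFun d p → gradR g (fun z => f z * p z) q x =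
      f x * gradR g p q x + p x * lieD (grad g f) q x := fun p q hp => by
    rw [gradR_mul_left hf hp, ← gradR_eq_lieD]
  have h2 : ∀ p q : X → ℝ, SmoothFun d q → gradR g p (fun z => f z * q z) x =
      f x * gradR g p q x + q x * lieD (grad g f) p x := fun p q hq => by
    rw [gradR_symm, h1 q p hq, gradR_symm g q]
  rw [gradInner_eq, gradInner_eq, e1, e1, e2, e2, h1 _ _ u.2.re.smooth, h1 _ _ u.2.im.smooth,
    h1 _ _ u.2.im.smooth, h1 _ _ u.2.re.smooth, h2 _ _ v.2.re.smooth, h2 _ _ v.2.im.smooth,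
    h2 _ _ v.2.re.smooth, h2 _ _ v.2.im.smooth]
  simp only [lieC, complexify]
  apply Complex.ext
  · simp
    ring
  · simp
    ring

theorem inner_toL2_mulL {f : X → ℝ} (hf : SmoothFun d f) (u v : testSpace d Λ) :
    inner ℂ (toL2 g Λ v) (toL2 g Λ (mulL hf Λ u)) =
      inner ℂ (toL2 g Λ (mulL hf Λ v)) (toL2 g Λ u) := by
  rw [inner_toL2_toL2, inner_toL2_toL2]
  refine integral_congr_ae (.of_forall fun x => ?_)
  change (f x : ℂ) * (u : X → ℂ) x * _ =
    (u : X → ℂ) x * starRingEnd ℂ ((f x : ℂ) * (v : X → ℂ) x)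
  rw [map_mul, Complex.conj_ofReal]
  ring

/-- The commutator of the form with multiplication by a real function. -/
theorem IsFormDomain.inner_mulL_sub (hV : FormPotential g V) (hJ : IsFormDomain g V Λ J)
    {f : X → ℝ} (hf : SmoothFun d f) (u v : testSpace d Λ) :
    inner ℂ (J v) (J (mulL hf Λ u)) - inner ℂ (J (mulL hf Λ v)) (J u) =
      inner ℂ (toL2 g Λ v) (toL2 g Λ (mulL (SmoothFun.laplacian g hf) Λ u)) +
        2 * inner ℂ (toL2 g Λ (lieL (hf.grad g) Λ v)) (toL2 g Λ u) := by
  have h1 := inner_toL2_divg (g := g) (hf.grad g) u v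
  rw [map_add, inner_add_right] at h1
  have h2 : inner ℂ (J v) (J (mulL hf Λ u)) - inner ℂ (J (mulL hf Λ v)) (J u) =
      inner ℂ (toL2 g Λ (lieL (hf.grad g) Λ v)) (toL2 g Λ u) -
        inner ℂ (toL2 g Λ v) (toL2 g Λ (lieL (hf.grad g) Λ u)) := by
    rw [hJ.inner_eq, hJ.inner_eq, inner_toL2_mulL, inner_toL2_toL2 (lieL (hf.grad g) Λ v),
      inner_toL2_toL2 v (lieL (hf.grad g) Λ u), add_sub_add_right_eq_sub]
    unfold energyForm
    rw [← integral_sub (hV.integrable_energy (mulL hf Λ u).2 v.2).restrict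
      (hV.integrable_energy u.2 (mulL hf Λ v).2).restrict, ← integral_sub]
    · refine integral_congr_ae (.of_forall fun x => ?_)
      have h3 := gradInner_mul_sub (g := g) hf u v x
      have h4 : starRingEnd ℂ (((mulL hf Λ v : testSpace d Λ) : X → ℂ) x) =
          (f x : ℂ) * starRingEnd ℂ ((v : X → ℂ) x) := by
        change starRingEnd ℂ ((f x : ℂ) * (v : X → ℂ) x) = _
        rw [map_mul, Complex.conj_ofReal]
      have h5 : ((mulL hf Λ u : testSpace d Λ) : X → ℂ) x = (f x : ℂ) * (u : X → ℂ) x := rfl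
      simp only [h4, h5]
      change _ = (u : X → ℂ) x * starRingEnd ℂ (lieC (grad g f) v x) -
        lieC (grad g f) u x * starRingEnd ℂ ((v : X → ℂ) x)
      linear_combination h3
    · exact (integrable_of_isTest g (IsTest.mul_right u.2
        (IsTest.conj (lieL (hf.grad g) Λ v).2).smooth)).restrict
    · exact (integrable_of_isTest g (IsTest.mul_right (lieL (hf.grad g) Λ u).2
        (IsTest.conj v.2).smooth)).restrict
  have h6 : (mulL (SmoothFun.laplacian g hf) Λ u) =
      (mulL (smoothFun_divg g (hf.grad g)) Λ u) := rfl
  rw [h2, h6]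
  linear_combination (-1 : ℂ) * h1

end

end FirstOrder

/-! ### Multiplication operators and the frame -/

section Operators

universe u

variable {d : ℕ} {X : Type u} [TopologicalSpace X] [ChartedSpace (Coord d) X]
  [IsManifold 𝓘(ℝ, Coord d) (⊤ : ℕ∞) X] [MeasurableSpace X] [BorelSpace X]
  [SecondCountableTopology X] [T2Space X] {g : SmoothMetric d X} {V : X → ℝ} {Λ U : Set X}

theorem IsTest.memLp_top (g : SmoothMetric d X) (Λ' : Set X) {u : X → ℂ} (hu : IsTest d U u) :
    MemLp u ⊤ ((vol g).restrict Λ') :=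
  hu.continuous.memLp_of_hasCompactSupport hu.compact

theorem coeFn_mulOp {f : X → ℂ} (hf : IsTest d U f) (h : L2 g Λ) :
    mulOp g Λ f h =ᵐ[(vol g).restrict Λ] fun x => f x * h x := by
  have hh := hf.memLp_top g Λ
  unfold mulOp
  rw [dif_pos hh, ContinuousLinearMap.holderL_apply_apply]
  filter_upwards [ContinuousLinearMap.coeFn_holder (r := 2) (ContinuousLinearMap.mul ℂ ℂ)
    (hh.toLp f) h, hh.coeFn_toLp] with x h1 h2
  rw [h1, h2]
  rfl

theorem mulOp_mul {f F : X → ℂ} (hf : IsTest d U f) (hF : IsTest d U F)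
    (h : ∀ x ∈ tsupport f, F x = 1) : mulOp g Λ F * mulOp g Λ f = mulOp g Λ f := by
  ext1 w
  refine Lp.ext ?_
  filter_upwards [coeFn_mulOp (g := g) (Λ := Λ) hF (mulOp g Λ f w),
    coeFn_mulOp (g := g) (Λ := Λ) hf w] with x h1 h2
  rw [mul_apply_eq_comp, h1, h2]
  by_cases hx : x ∈ tsupport f
  · rw [h x hx, one_mul]
  · rw [image_eq_zero_of_notMem_tsupport hx]
    simp

theorem mulOp_add_I_mul {p q : X → ℝ} (hp : IsTest d U p) (hq : IsTest d U q) :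
    mulOp g Λ (fun x => (p x : ℂ) + Complex.I * (q x : ℂ)) =
      mulOp g Λ (fun x => (p x : ℂ)) + Complex.I • mulOp g Λ (fun x => (q x : ℂ)) := by
  ext1 w
  refine Lp.ext ?_
  rw [add_apply, smul_apply]
  filter_upwards [coeFn_mulOp (g := g) (Λ := Λ) (hp.ofReal.add (hq.ofReal.const_mul Complex.I)) w,
    coeFn_mulOp (g := g) (Λ := Λ) hp.ofReal w, coeFn_mulOp (g := g) (Λ := Λ) hq.ofReal w,
    Lp.coeFn_add (mulOp g Λ (fun x => (p x : ℂ)) w)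
      (Complex.I • mulOp g Λ (fun x => (q x : ℂ)) w),
    Lp.coeFn_smul Complex.I (mulOp g Λ (fun x => (q x : ℂ)) w)] with x h1 h2 h3 h4 h5
  rw [h1, h4, Pi.add_apply, h5, Pi.smul_apply, h2, h3, smul_eq_mul]
  ring

theorem mulOp_toL2 {f : X → ℝ} (hf : IsTest d U f) (u : testSpace d Λ) :
    mulOp g Λ (fun x => (f x : ℂ)) (toL2 g Λ u) = toL2 g Λ (mulL hf.smooth Λ u) := by
  refine Lp.ext ?_
  filter_upwards [coeFn_mulOp (g := g) (Λ := Λ) hf.ofReal (toL2 g Λ u), coeFn_toL2 (g := g) u,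
    coeFn_toL2 (g := g) (mulL hf.smooth Λ u)] with x h1 h2 h3
  rw [h1, h2, h3]
  rfl

theorem inner_mulOp {f : X → ℝ} (hf : IsTest d U f) (a b : L2 g Λ) :
    inner ℂ a (mulOp g Λ (fun x => (f x : ℂ)) b) = inner ℂ (mulOp g Λ (fun x => (f x : ℂ)) a) b := by
  rw [L2.inner_def, L2.inner_def]
  refine integral_congr_ae ?_
  filter_upwards [coeFn_mulOp (g := g) (Λ := Λ) hf.ofReal a,
    coeFn_mulOp (g := g) (Λ := Λ) hf.ofReal b] with x h1 h2
  rw [h1, h2, RCLike.inner_apply, RCLike.inner_apply, map_mul, Complex.conj_ofReal]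
  ring

variable {Γ : Type*} [Group Γ] [MulAction Γ X] {g₀ : SmoothMetric d X}

/-- On the support of `ψ_β` the `d` orthonormal fields form a basis, so `ψ_β w` is expanded there;
elsewhere `ψ_β = 0`. Summing over `β` recovers `w`, because the `ψ_β` add up to one. -/
theorem PeriodicFrame.expansion (P : PeriodicFrame Γ g₀) (x : X) (w : Tan d x) :
    w = ∑ i, ∑ β, g₀.inner x w (P.vec i β x) • P.cut i β x := by
  have h1 : ∀ β, P.ψ β x • w = ∑ i, g₀.inner x w (P.vec i β x) • P.cut i β x := fun β => by
    by_cases hx : x ∈ tsupport (P.ψ β)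
    · have ho := P.orthonormal β x hx
      have hli : LinearIndependent ℝ fun i => P.vec i β x := by
        rw [Fintype.linearIndependent_iff]
        intro c hc j
        have h2 : g₀.inner x (∑ i, c i • P.vec i β x) (P.vec j β x) = c j := by
          simp [map_sum, sum_apply, ho]
        rw [← h2]
        rw [hc]
        simp
      have : FiniteDimensional ℝ (Tan d x) := inferInstanceAs (FiniteDimensional ℝ (Coord d))
      have hspan := hli.span_eq_top_of_card_eq_finrank'
        ((Fintype.card_fin d).trans (finrank_euclideanSpace_fin (𝕜 := ℝ)).symm)
      have hw : ∀ z : Tan d x, g₀.inner x (w - ∑ i, g₀.inner x w (P.vec i β x) • P.vec i β x)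
          z = 0 := fun z => by
        have hz : z ∈ Submodule.span ℝ (Set.range fun i => P.vec i β x) := by
          rw [hspan]; trivial
        induction hz using Submodule.span_induction with
        | mem z hz =>
          obtain ⟨j, rfl⟩ := hz
          simp [map_sum, sum_apply, ho]
        | zero => exact map_zero _
        | add a b _ _ ha hb =>
          rw [map_add, ha, hb, add_zero]
        | smul c a _ ha => rw [map_smul, ha, smul_zero]
      have h0 : w - ∑ i, g₀.inner x w (P.vec i β x) • P.vec i β x = 0 := by
        by_contra h
        exact (g₀.pos x _ h).ne' (hw _)
      conv_lhs => rw [sub_eq_zero.1 h0]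
      rw [Finset.smul_sum]
      refine Finset.sum_congr rfl fun i _ => ?_
      rw [PeriodicFrame.cut, smul_comm]
    · have h2 : P.ψ β x = 0 := image_eq_zero_of_notMem_tsupport hx
      simp [PeriodicFrame.cut, h2]
  rw [Finset.sum_comm, ← Finset.sum_congr rfl fun β _ => h1 β, ← Finset.sum_smul, P.ψ_sum, one_smul]

/-- The frame expansion of `grad f`: its coefficients are `g₀(grad f, X_{i,β})`, and the factor `-2`
in the definition of `D^{(2,i,β)}` is chosen to absorb the `2`, with a sign. -/
theorem PeriodicFrame.lieL_grad (P : PeriodicFrame Γ g₀) {f : X → ℝ} (hf : SmoothFun d f)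
    (v : testSpace d Λ) : (2 : ℂ) • lieL (hf.grad g) Λ v =
      -∑ i, ∑ β, mulL (P.smoothFun_realD2 g i β hf) Λ (lieL (P.smoothField_cut i β) Λ v) := by
  have h1 : ∀ (h : X → ℝ) (x : X), 2 * lieD (grad g f) h x =
      -∑ i, ∑ β, P.realD2 g i β f x * lieD (P.cut i β) h x := fun h x => by
    have key : ∀ L : Tan d x →L[ℝ] ℝ, 2 * L (grad g f x) =
        -∑ i, ∑ β, P.realD2 g i β f x * L (P.cut i β x) := fun L => by
      conv_lhs => rw [P.expansion x (grad g f x)]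
      simp only [map_sum, map_smul, Finset.mul_sum, ← Finset.sum_neg_distrib]
      refine Finset.sum_congr rfl fun i _ => Finset.sum_congr rfl fun β _ => ?_
      simp only [PeriodicFrame.realD2, smul_eq_mul]
      ring
    exact key (mfderiv 𝓘(ℝ, Coord d) 𝓘(ℝ, ℝ) h x)
  refine Subtype.ext (funext fun x => ?_)
  have h2 : ((-∑ i, ∑ β, mulL (P.smoothFun_realD2 g i β hf) Λ
      (lieL (P.smoothField_cut i β) Λ v) : testSpace d Λ) : X → ℂ) x =
      -∑ i, ∑ β, (P.realD2 g i β f x : ℂ) * lieC (P.cut i β) v x := by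
    simp only [Submodule.coe_neg, Submodule.coe_sum, Pi.neg_apply, Finset.sum_apply]
    rfl
  rw [h2]
  change (2 : ℂ) * lieC (grad g f) v x = _
  simp only [lieC, complexify, mul_add, Finset.sum_add_distrib]
  have h3 := congrArg (fun r : ℝ => (r : ℂ)) (h1 (fun z => ((v : X → ℂ) z).re) x)
  have h4 := congrArg (fun r : ℝ => (r : ℂ)) (h1 (fun z => ((v : X → ℂ) z).im) x)
  push_cast at h3 h4
  have h5 : ∑ i, ∑ β, (P.realD2 g i β f x : ℂ) *
      (Complex.I * (lieD (P.cut i β) (fun z => ((v : X → ℂ) z).im) x : ℂ)) =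
      Complex.I * ∑ i, ∑ β, (P.realD2 g i β f x : ℂ) *
        (lieD (P.cut i β) (fun z => ((v : X → ℂ) z).im) x : ℂ) := by
    simp only [Finset.mul_sum]
    exact Finset.sum_congr rfl fun i _ => Finset.sum_congr rfl fun β _ => by ring
  rw [h5]
  linear_combination h3 + Complex.I * h4

/-- Weak divergences are tested on real functions only; splitting a complex test function into real
and imaginary parts passes to scalar products. -/
theorem isWeakDiv_iff {Z : (x : X) → Tan d x} (hZ : SmoothField Z) (h w : L2 g Λ) :
    IsWeakDiv g Λ Z h w ↔ ∀ v : testSpace d Λ,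
      inner ℂ (toL2 g Λ v) w = - inner ℂ (toL2 g Λ (lieL hZ Λ v)) h := by
  have hr : ∀ v : X → ℝ, ∀ hv : IsTest d Λ v,
      (∫ x in Λ, w x * (v x : ℂ) ∂(vol g) =
        - ∫ x in Λ, h x * ((g.inner x (Z x) (grad g v x) : ℝ) : ℂ) ∂(vol g)) ↔
      inner ℂ (toL2 g Λ ⟨fun x => (v x : ℂ), hv.ofReal⟩) w =
        - inner ℂ (toL2 g Λ (lieL hZ Λ ⟨fun x => (v x : ℂ), hv.ofReal⟩)) h := fun v hv => by
    rw [inner_toL2, inner_toL2]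
    have h1 : ∀ x, ((lieL hZ Λ ⟨fun x => (v x : ℂ), hv.ofReal⟩ : testSpace d Λ) : X → ℂ) x =
        (lieD Z v x : ℂ) := fun x => lieC_ofReal Z v x
    simp only [h1, Complex.conj_ofReal, inner_grad_eq_lieD]
  constructor
  · intro hw v
    have h1 := (hr _ v.2.re).1 (hw _ v.2.re)
    have h2 := (hr _ v.2.im).1 (hw _ v.2.im)
    have h3 : v = (⟨_, v.2.re.ofReal⟩ : testSpace d Λ) +
        Complex.I • (⟨_, v.2.im.ofReal⟩ : testSpace d Λ) :=
      Subtype.ext (funext fun x => ((Complex.re_add_im ((v : X → ℂ) x)).symm.trans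
        (by rw [mul_comm]; rfl)))
    rw [h3]
    simp only [map_add, map_smul, inner_add_left, inner_smul_left, h1, h2]
    ring
  · intro hw v hv
    exact (hr v hv).2 (hw _)

end Operators

/-! ### The commutator of the resolvent with a multiplication operator -/

section Commutator

universe u

variable {d : ℕ} {X : Type u} [TopologicalSpace X] [ChartedSpace (Coord d) X]
  [IsManifold 𝓘(ℝ, Coord d) (⊤ : ℕ∞) X] [MeasurableSpace X] [BorelSpace X]
  [SecondCountableTopology X] [T2Space X] {g : SmoothMetric d X} {V : X → ℝ} {Λ U : Set X}

theorem IsTest.laplacian (g : SmoothMetric d X) {f : X → ℝ} (hf : IsTest d U f) :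
    IsTest d U (RandomSchroedinger.laplacian g f) :=
  hf.of_subset (SmoothFun.laplacian g hf.smooth)
    (closure_minimal (fun _ hx => by_contra fun h => hx (laplacian_eq_zero g h)) isClosed_closure)

variable {Γ : Type*} [Group Γ] [MulAction Γ X] {g₀ : SmoothMetric d X} (P : PeriodicFrame Γ g₀)

theorem IsTest.realD2 (g : SmoothMetric d X) (i : Fin d) (β : Fin P.n) {f : X → ℝ}
    (hf : IsTest d U f) : IsTest d U (P.realD2 g i β f) :=
  hf.of_subset (P.smoothFun_realD2 g i β hf.smooth)
    (closure_minimal (fun _ hx => by_contra fun h => hx (P.realD2_eq_zero g i β h))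
      isClosed_closure)

theorem two_mul_inner_lieL_grad {f : X → ℝ} (hf : SmoothFun d f) (v : testSpace d Λ)
    (w : L2 g Λ) : 2 * inner ℂ (toL2 g Λ (lieL (hf.grad g) Λ v)) w =
      -∑ i, ∑ β, inner ℂ (toL2 g Λ (mulL (P.smoothFun_realD2 g i β hf) Λ
        (lieL (P.smoothField_cut i β) Λ v))) w := by
  have h1 : 2 * inner ℂ (toL2 g Λ (lieL (hf.grad g) Λ v)) w =
      inner ℂ (toL2 g Λ ((2 : ℂ) • lieL (hf.grad g) Λ v)) w := by
    rw [map_smul, inner_smul_left, map_ofNat]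
  rw [h1, P.lieL_grad hf, map_neg, inner_neg_left, map_sum, sum_inner]
  refine congrArg _ (Finset.sum_congr rfl fun i _ => ?_)
  rw [map_sum, sum_inner]

/-- Bounded operators on the form domain `H`: the embedding `ι` into `L²(Λ, g)`, the derivatives `G`
along the fields `ψ_β X_{i,β}`, and the divergences `E` of the products with these fields. -/
structure IsFormSystem (g : SmoothMetric d X) (V : X → ℝ) (Λ : Set X) {H : Type*}
    [NormedAddCommGroup H] [InnerProductSpace ℂ H] (J : testSpace d Λ →ₗ[ℂ] H)
    (ι : H →L[ℂ] L2 g Λ) (G E : Fin d × Fin P.n → H →L[ℂ] L2 g Λ) : Prop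
    extends IsFormDomain g V Λ J where
  embed : ∀ u, ι (J u) = toL2 g Λ u
  deriv : ∀ p u, G p (J u) = toL2 g Λ (lieL (P.smoothField_cut p.1 p.2) Λ u)
  diverg : ∀ p u, E p (J u) = toL2 g Λ (lieL (P.smoothField_cut p.1 p.2) Λ u +
    mulL (smoothFun_divg g (P.smoothField_cut p.1 p.2)) Λ u)

namespace IsFormSystem

open ContinuousLinearMap (adjoint)

variable {P} {H : Type*} [NormedAddCommGroup H] [InnerProductSpace ℂ H] [CompleteSpace H]
  {J : testSpace d Λ →ₗ[ℂ] H} {ι : H →L[ℂ] L2 g Λ} {G E : Fin d × Fin P.n → H →L[ℂ] L2 g Λ}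

theorem inner_diverg (h : IsFormSystem P g V Λ J ι G E) (p : Fin d × Fin P.n) (η ξ : H) :
    inner ℂ (ι η) (E p ξ) = -inner ℂ (G p η) (ι ξ) := by
  refine h.dense.induction_on (p := fun η => inner ℂ (ι η) (E p ξ) = -inner ℂ (G p η) (ι ξ)) η
    (isClosed_eq (by fun_prop) (by fun_prop)) fun v => ?_
  refine h.dense.induction_on
    (p := fun ξ => inner ℂ (ι (J v)) (E p ξ) = -inner ℂ (G p (J v)) (ι ξ)) ξ
    (isClosed_eq (by fun_prop) (by fun_prop)) fun u => ?_
  rw [h.embed, h.embed, h.diverg, h.deriv, inner_toL2_divg]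

/-- The adjoint of a derivative is minus the divergence. For an argument from the form domain the
divergence is in `L²`, and the unbounded `G*` side turns into `ι*`, that is, into a resolvent after
applying `ι`. -/
theorem adjoint_deriv_embed (h : IsFormSystem P g V Λ J ι G E) (p : Fin d × Fin P.n) (ξ : H) :
    adjoint (G p) (ι ξ) = -adjoint ι (E p ξ) := by
  refine ext_inner_left ℂ fun η => ?_
  rw [ContinuousLinearMap.adjoint_inner_right, inner_neg_right,
    ContinuousLinearMap.adjoint_inner_right, h.inner_diverg, neg_neg]

theorem isWeakDiv_embed (h : IsFormSystem P g V Λ J ι G E) (p : Fin d × Fin P.n) (ξ : H) :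
    IsWeakDiv g Λ (P.cut p.1 p.2) (ι ξ) (E p ξ) :=
  (isWeakDiv_iff (P.smoothField_cut p.1 p.2) _ _).2 fun v => by
    rw [← h.embed, ← h.deriv, h.inner_diverg]

/-- The same relation for any `L²` function with a weak divergence in `L²`. It shows that `-E G*`
really extends `div R div`. -/
theorem adjoint_embed_of_isWeakDiv (h : IsFormSystem P g V Λ J ι G E) (p : Fin d × Fin P.n)
    {a b : L2 g Λ} (hab : IsWeakDiv g Λ (P.cut p.1 p.2) a b) :
    adjoint ι b = -adjoint (G p) a := by
  refine h.dense.eq_of_inner_right ℂ fun v => ?_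
  rw [ContinuousLinearMap.adjoint_inner_right, inner_neg_right,
    ContinuousLinearMap.adjoint_inner_right, h.embed, h.deriv]
  exact (isWeakDiv_iff (P.smoothField_cut p.1 p.2) a b).1 hab v

/-- The first commutation, at the level of the form domain: pairing `f` times `ι* k` with test
functions and using `IsFormDomain.inner_mulL_sub`, the commutator becomes `Δf` and, via the frame,
adjoints of derivatives. The terms with `G*` are weak divergences with the sign reversed. -/
theorem exists_mul (hV : FormPotential g V) (h : IsFormSystem P g V Λ J ι G E) {f : X → ℝ}
    (hf : IsTest d Set.univ f) : ∃ M : H →L[ℂ] H,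
      (∀ ξ, ι (M ξ) = mulOp g Λ (fun x => (f x : ℂ)) (ι ξ)) ∧
      ∀ k, M (adjoint ι k) = adjoint ι (mulOp g Λ (fun x => (f x : ℂ)) k) +
        adjoint ι (mulOp g Λ (fun x => (laplacian g f x : ℂ)) (ι (adjoint ι k))) -
        ∑ i, ∑ β, adjoint (G (i, β))
          (mulOp g Λ (fun x => (P.realD2 g i β f x : ℂ)) (ι (adjoint ι k))) := by
  obtain ⟨c, hc0, hc⟩ := h.exists_norm_mulL_le hV hf
  obtain ⟨M, hM, -⟩ := exists_extension h.dense (J ∘ₗ mulL hf.smooth Λ) hc0 hc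
  replace hM : ∀ u, M (J u) = J (mulL hf.smooth Λ u) := hM
  refine ⟨M, fun ξ => ?_, fun k => h.dense.eq_of_inner_right ℂ fun v => ?_⟩
  · refine h.dense.induction_on (p := fun ξ => ι (M ξ) = mulOp g Λ (fun x => (f x : ℂ)) (ι ξ)) ξ
      (isClosed_eq (by fun_prop) (by fun_prop)) fun u => ?_
    rw [hM, h.embed, h.embed, mulOp_toL2 hf]
  · have h1 : ∀ ξ : H, inner ℂ (J v) (M ξ) - inner ℂ (J (mulL hf.smooth Λ v)) ξ =
        inner ℂ (toL2 g Λ v) (mulOp g Λ (fun x => (laplacian g f x : ℂ)) (ι ξ)) -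
        ∑ i, ∑ β, inner ℂ (G (i, β) (J v))
          (mulOp g Λ (fun x => (P.realD2 g i β f x : ℂ)) (ι ξ)) := fun ξ => by
      refine h.dense.induction_on (p := fun ξ : H =>
        inner ℂ (J v) (M ξ) - inner ℂ (J (mulL hf.smooth Λ v)) ξ =
        inner ℂ (toL2 g Λ v) (mulOp g Λ (fun x => (laplacian g f x : ℂ)) (ι ξ)) -
        ∑ i, ∑ β, inner ℂ (G (i, β) (J v))
          (mulOp g Λ (fun x => (P.realD2 g i β f x : ℂ)) (ι ξ))) ξ
        (isClosed_eq (by fun_prop) (by fun_prop)) fun u => ?_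
      rw [hM, h.inner_mulL_sub hV, h.embed, mulOp_toL2 (hf.laplacian g)]
      rw [two_mul_inner_lieL_grad P hf.smooth, ← sub_eq_add_neg]
      congr 1
      refine Finset.sum_congr rfl fun i _ => Finset.sum_congr rfl fun β _ => ?_
      rw [h.deriv, mulOp_toL2 (hf.realD2 P g i β), inner_toL2_mulL]
    have h3 : inner ℂ (J (mulL hf.smooth Λ v)) (adjoint ι k) =
        inner ℂ (J v) (adjoint ι (mulOp g Λ (fun x => (f x : ℂ)) k)) := by
      rw [ContinuousLinearMap.adjoint_inner_right, ContinuousLinearMap.adjoint_inner_right,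
        h.embed, h.embed, ← mulOp_toL2 hf, inner_mulOp hf]
    have h4 := h1 (adjoint ι k)
    simp only [inner_sub_right, inner_add_right, inner_sum,
      ContinuousLinearMap.adjoint_inner_right, h.embed] at h3 h4 ⊢
    rw [h3] at h4
    linear_combination h4

/-- The second commutation. After `exists_mul` for `f`, the terms `ι G* q R` with `q = D^{(2,i,β)}
f` remain. Since `q R k` comes from the form domain, `adjoint_deriv_embed` replaces `G*` by `-ι* E`,
and `exists_mul` for `q` expands what `E` acts on. -/
theorem mul_resolvent (hV : FormPotential g V) (h : IsFormSystem P g V Λ J ι G E) {f : X → ℝ}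
    (hf : IsTest d Set.univ f) {R : L2 g Λ →L[ℂ] L2 g Λ} (hR : R = ι.comp (adjoint ι)) :
    mulOp g Λ (fun x => (f x : ℂ)) * R =
      R * mulOp g Λ (fun x => (f x : ℂ)) +
      R * mulOp g Λ (fun x => (laplacian g f x : ℂ)) * R +
      ∑ i, ∑ β, (R * (E (i, β)).comp (adjoint ι) *
          mulOp g Λ (fun x => (P.realD2 g i β f x : ℂ)) +
        R * (E (i, β)).comp (adjoint ι) *
          mulOp g Λ (fun x => (laplacian g (P.realD2 g i β f) x : ℂ)) * R +
        ∑ j, ∑ μ, R * (-(E (i, β)).comp (adjoint (G (j, μ)))) *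
          mulOp g Λ (fun x => (P.realD2 g j μ (P.realD2 g i β f) x : ℂ)) * R) := by
  subst hR
  ext1 k
  obtain ⟨M, hM1, hM2⟩ := h.exists_mul hV hf
  have h1 : ∀ i β, ι (adjoint (G (i, β))
      (mulOp g Λ (fun x => (P.realD2 g i β f x : ℂ)) (ι (adjoint ι k)))) =
      -ι (adjoint ι (E (i, β) (adjoint ι
        (mulOp g Λ (fun x => (P.realD2 g i β f x : ℂ)) k) + adjoint ι
        (mulOp g Λ (fun x => (laplacian g (P.realD2 g i β f) x : ℂ)) (ι (adjoint ι k))) -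
        ∑ j, ∑ μ, adjoint (G (j, μ))
          (mulOp g Λ (fun x => (P.realD2 g j μ (P.realD2 g i β f) x : ℂ))
            (ι (adjoint ι k)))))) := fun i β => by
    -- `N` is multiplication by `D^{(2,i,β)} f` on the form domain; it exhibits the product with `R
    -- k` as an element of that domain.
    obtain ⟨N, hN1, hN2⟩ := h.exists_mul hV (hf.realD2 P g i β)
    rw [← hN1, h.adjoint_deriv_embed, hN2, map_neg]
  have h2 : mulOp g Λ (fun x => (f x : ℂ)) (ι (adjoint ι k)) = ι (M (adjoint ι k)) := (hM1 _).symm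
  simp only [mul_apply_eq_comp, add_apply, sum_apply, ContinuousLinearMap.comp_apply, h2, hM2,
    map_add, map_sub, map_sum, h1, neg_apply, map_neg, sub_neg_eq_add, Finset.sum_neg_distrib]
  simp only [← sub_eq_add_neg]

end IsFormSystem

end Commutator

/-! ### Operators indexed by the labels in `𝓓` -/

section Labels

/-- The labels in `𝓓` as a disjoint union. -/
def DLabel.equiv (d n : ℕ) : DLabel d n ≃
    (Unit ⊕ Unit) ⊕ (Fin d × Fin n) ⊕ (Fin d × Fin n) ⊕ (Fin d × Fin n × Fin d × Fin n) where
  toFun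
    | .id => .inl (.inl ())
    | .D1 => .inl (.inr ())
    | .D2 i β => .inr (.inl (i, β))
    | .D3 i β => .inr (.inr (.inl (i, β)))
    | .D4 i β j μ => .inr (.inr (.inr (i, β, j, μ)))
  invFun
    | .inl (.inl _) => .id
    | .inl (.inr _) => .D1
    | .inr (.inl p) => .D2 p.1 p.2
    | .inr (.inr (.inl p)) => .D3 p.1 p.2
    | .inr (.inr (.inr p)) => .D4 p.1 p.2.1 p.2.2.1 p.2.2.2
  left_inv L := by cases L <;> rfl
  right_inv
    | .inl (.inl _) => rfl
    | .inl (.inr _) => rfl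
    | .inr (.inl _) => rfl
    | .inr (.inr (.inl _)) => rfl
    | .inr (.inr (.inr _)) => rfl

instance DLabel.fintype (d n : ℕ) : Fintype (DLabel d n) := Fintype.ofEquiv _ (DLabel.equiv d n).symm

theorem DLabel.sum_eq {d n : ℕ} {A : Type*} [AddCommMonoid A] (a : DLabel d n → A) :
    ∑ L, a L = a .id + a .D1 + (∑ i, ∑ β, a (.D2 i β) + (∑ i, ∑ β, a (.D3 i β) +
      ∑ i, ∑ β, ∑ j, ∑ μ, a (.D4 i β j μ))) := by
  rw [← (DLabel.equiv d n).symm.sum_comp]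
  simp only [Fintype.sum_sum_type, Fintype.sum_prod_type, Finset.univ_unique, Finset.sum_singleton]
  rfl

/-- The operator in `𝓑` that accompanies a commutator term with the given label in `𝓓`. -/
def DLabel.toB {d n : ℕ} : DLabel d n → BLabel d n
  | .id => .id
  | .D1 => .id
  | .D2 i β => .divR i β
  | .D3 i β => .divR i β
  | .D4 i β j μ => .divRdiv i β j μ

/-- The number of further resolvents in a commutator term. -/
def DLabel.exponent {d n : ℕ} : DLabel d n → ℕ
  | .id => 0
  | .D1 => 1
  | .D2 _ _ => 0
  | .D3 _ _ => 1
  | .D4 _ _ _ _ => 1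

theorem DLabel.exponent_le_one {d n : ℕ} (L : DLabel d n) : L.exponent ≤ 1 := by
  cases L <;> simp [DLabel.exponent]

end Labels

/-! ### The commutator formula for complex functions, with uniform operator bounds. -/

section CommutatorExpansion

universe u

variable {d : ℕ} {X : Type u} [TopologicalSpace X] [ChartedSpace (Coord d) X]
  [IsManifold 𝓘(ℝ, Coord d) (⊤ : ℕ∞) X] [MeasurableSpace X] [BorelSpace X]
  [SecondCountableTopology X] [T2Space X] {g : SmoothMetric d X} {V : X → ℝ} {Λ U : Set X}

variable {Γ : Type*} [Group Γ] [MulAction Γ X] {g₀ : SmoothMetric d X} (P : PeriodicFrame Γ g₀)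

/-- The restriction of an operator in `𝓓` to real functions. -/
noncomputable def PeriodicFrame.realApplyD (g : SmoothMetric d X) :
    DLabel d P.n → (X → ℝ) → X → ℝ
  | .id, h => h
  | .D1, h => laplacian g h
  | .D2 i β, h => P.realD2 g i β h
  | .D3 i β, h => laplacian g (P.realD2 g i β h)
  | .D4 i β j μ, h => P.realD2 g j μ (P.realD2 g i β h)

theorem complexify_complexify (A B : (X → ℝ) → X → ℝ) (f : X → ℂ) :
    complexify A (complexify B f) = complexify (fun h => A (B h)) f := by
  ext x
  simp [complexify]

/-- Commutators are computed for real multipliers, which act symmetrically. Every operator in `𝓓` is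
the complex linear extension of a real one, so the formula passes to complex `f`. -/
theorem PeriodicFrame.applyD_eq (g : SmoothMetric d X) (L : DLabel d P.n) (f : X → ℂ) :
    P.applyD g L f = complexify (P.realApplyD g L) f := by
  cases L with
  | id =>
    ext x
    rw [complexify, mul_comm]
    exact (Complex.re_add_im (f x)).symm
  | D1 => rfl
  | D2 i β => rfl
  | D3 i β => exact complexify_complexify (laplacian g) (P.realD2 g i β) f
  | D4 i β j μ => exact complexify_complexify (P.realD2 g j μ) (P.realD2 g i β) f

theorem IsTest.realApplyD (g : SmoothMetric d X) (L : DLabel d P.n) {f : X → ℝ}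
    (hf : IsTest d U f) : IsTest d U (P.realApplyD g L f) := by
  cases L with
  | id => exact hf
  | D1 => exact hf.laplacian g
  | D2 i β => exact hf.realD2 P g i β
  | D3 i β => exact (hf.realD2 P g i β).laplacian g
  | D4 i β j μ => exact (hf.realD2 P g i β).realD2 P g j μ

theorem mulOp_complexify {D : (X → ℝ) → X → ℝ} {f : X → ℂ}
    (hD : ∀ h, IsTest d U h → IsTest d U (D h)) (hf : IsTest d U f) :
    mulOp g Λ (complexify D f) = mulOp g Λ (fun x => (D (fun z => (f z).re) x : ℂ)) +
      Complex.I • mulOp g Λ (fun x => (D (fun z => (f z).im) x : ℂ)) :=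
  mulOp_add_I_mul (hD _ hf.re) (hD _ hf.im)

theorem inner_cut_le (g : SmoothMetric d X) {c : ℝ}
    (hc : ∀ x (v : Tan d x), g.inner x v v ≤ c ^ 2 * g₀.inner x v v) (i : Fin d) (β : Fin P.n)
    (x : X) : g.inner x (P.cut i β x) (P.cut i β x) ≤ c ^ 2 := by
  refine (hc x _).trans ?_
  have h1 : g₀.inner x (P.cut i β x) (P.cut i β x) =
      P.ψ β x * (P.ψ β x * g₀.inner x (P.vec i β x) (P.vec i β x)) := by
    simp [PeriodicFrame.cut]
  have h2 : P.ψ β x ≤ 1 := by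
    rw [← P.ψ_sum x]
    exact Finset.single_le_sum (f := fun β => P.ψ β x) (fun _ _ => P.ψ_nonneg _ _)
      (Finset.mem_univ β)
  have h3 : g₀.inner x (P.cut i β x) (P.cut i β x) ≤ 1 := by
    rw [h1]
    by_cases hx : x ∈ tsupport (P.ψ β)
    · rw [P.orthonormal β x hx, if_pos rfl, mul_one]
      exact mul_le_one₀ h2 (P.ψ_nonneg β x) h2
    · rw [image_eq_zero_of_notMem_tsupport hx, zero_mul]
      exact zero_le_one
  exact mul_le_of_le_one_right (sq_nonneg c) h3

/-- The resolvent, and operators in `𝓑` that give the commutators of the resolvent with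
multiplication operators. -/
theorem exists_resolvent_commutator (hV : FormPotential g V) (Λ : Set X) {c c' : ℝ} (hc0 : 0 ≤ c)
    (hc : ∀ x (v : Tan d x), g.inner x v v ≤ c ^ 2 * g₀.inner x v v) (hc0' : 0 ≤ c')
    (hc' : ∀ (i : Fin d) (β : Fin P.n) (x : X), |divg g (P.cut i β) x| ≤ c') :
    ∃ (R : L2 g Λ →L[ℂ] L2 g Λ) (T : DLabel d P.n → L2 g Λ →L[ℂ] L2 g Λ),
      IsResolvent g V Λ R ∧ ‖R‖ ≤ 1 ∧ (∀ L, P.IsOpB g Λ R (T L) L.toB) ∧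
      (∀ L, ‖T L‖ ≤ 1 + (c + c') + (c + c') * c) ∧
      ∀ f : X → ℂ, IsTest d Set.univ f → mulOp g Λ f * R =
        ∑ L, R * T L * mulOp g Λ (P.applyD g L f) * R ^ L.exponent := by
  obtain ⟨H, _, _, _, J, hJ⟩ := exists_formDomain hV Λ
  obtain ⟨ι, hι, hιn⟩ := exists_extension hJ.dense (toL2 g Λ) zero_le_one (hJ.norm_toL2_le hV)
  have hG (p : Fin d × Fin P.n) : ∃ T : H →L[ℂ] L2 g Λ,
      (∀ u, T (J u) = toL2 g Λ (lieL (P.smoothField_cut p.1 p.2) Λ u)) ∧ ‖T‖ ≤ c :=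
    exists_extension hJ.dense (toL2 g Λ ∘ₗ lieL (P.smoothField_cut p.1 p.2) Λ) hc0 fun u =>
      hJ.norm_lieL_le hV _ hc0 (inner_cut_le P g hc p.1 p.2) u
  have hE (p : Fin d × Fin P.n) : ∃ T : H →L[ℂ] L2 g Λ,
      (∀ u, T (J u) = toL2 g Λ (lieL (P.smoothField_cut p.1 p.2) Λ u +
        mulL (smoothFun_divg g (P.smoothField_cut p.1 p.2)) Λ u)) ∧ ‖T‖ ≤ c + c' := by
    refine exists_extension hJ.dense (toL2 g Λ ∘ₗ (lieL (P.smoothField_cut p.1 p.2) Λ +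
      mulL (smoothFun_divg g (P.smoothField_cut p.1 p.2)) Λ)) (add_nonneg hc0 hc0') fun u => ?_
    rw [LinearMap.comp_apply, LinearMap.add_apply, map_add, add_mul]
    refine (norm_add_le _ _).trans (add_le_add
      (hJ.norm_lieL_le hV _ hc0 (inner_cut_le P g hc p.1 p.2) u) ?_)
    refine (norm_toL2_le_of_le (u := u) (c := c') fun x => ?_).trans
      (mul_le_mul_of_nonneg_left ((hJ.norm_toL2_le hV u).trans_eq (one_mul _)) hc0')
    change ‖(divg g (P.cut p.1 p.2) x : ℂ) * (u : X → ℂ) x‖ ≤ _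
    rw [norm_mul, Complex.norm_real, Real.norm_eq_abs]
    exact mul_le_mul_of_nonneg_right (hc' _ _ x) (norm_nonneg _)
  choose G hG hGn using hG
  choose E hE hEn using hE
  have h : IsFormSystem P g V Λ J ι G E := ⟨hJ, hι, hG, hE⟩
  have hιa : ‖ContinuousLinearMap.adjoint ι‖ ≤ 1 := by rwa [LinearIsometryEquiv.norm_map]
  have hGa (p) : ‖ContinuousLinearMap.adjoint (G p)‖ ≤ c := by
    rw [LinearIsometryEquiv.norm_map]
    exact hGn p
  have hcc := add_nonneg hc0 hc0'
  have hcc2 := mul_nonneg hcc hc0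
  set R := ι.comp (ContinuousLinearMap.adjoint ι) with hR
  set S : Fin d → Fin P.n → L2 g Λ →L[ℂ] L2 g Λ :=
    fun i β => (E (i, β)).comp (ContinuousLinearMap.adjoint ι) with hS
  -- The sign comes from `G*` being minus the divergence; with it `S₂` is the extension of `div R
  -- div`.
  set S₂ : Fin d → Fin P.n → Fin d → Fin P.n → L2 g Λ →L[ℂ] L2 g Λ :=
    fun i β j μ => -(E (i, β)).comp (ContinuousLinearMap.adjoint (G (j, μ))) with hS₂
  have hSn (i β) : ‖S i β‖ ≤ 1 + (c + c') + (c + c') * c := by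
    refine (ContinuousLinearMap.opNorm_comp_le _ _).trans
      ((mul_le_mul (hEn _) hιa (norm_nonneg _) hcc).trans ?_)
    linarith
  have hS₂n (i β j μ) : ‖S₂ i β j μ‖ ≤ 1 + (c + c') + (c + c') * c := by
    rw [hS₂, norm_neg]
    refine (ContinuousLinearMap.opNorm_comp_le _ _).trans
      ((mul_le_mul (hEn _) (hGa _) (norm_nonneg _) hcc).trans ?_)
    linarith
  have h1n : ‖(1 : L2 g Λ →L[ℂ] L2 g Λ)‖ ≤ 1 + (c + c') + (c + c') * c :=
    ContinuousLinearMap.norm_id_le.trans (by linarith)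
  let T : DLabel d P.n → L2 g Λ →L[ℂ] L2 g Λ
    | .id => 1
    | .D1 => 1
    | .D2 i β => S i β
    | .D3 i β => S i β
    | .D4 i β j μ => S₂ i β j μ
  have hSw (i β) : P.IsOpB g Λ R (S i β) (.divR i β) := fun a =>
    h.isWeakDiv_embed (i, β) (ContinuousLinearMap.adjoint ι a)
  refine ⟨R, T, hJ.isResolvent hι, ?_, fun L => ?_, fun L => ?_, fun f hf => ?_⟩
  · refine (ContinuousLinearMap.opNorm_comp_le _ _).trans ?_
    exact mul_le_one₀ hιn (norm_nonneg _) hιa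
  · cases L with
    | id => rfl
    | D1 => rfl
    | D2 i β => exact hSw i β
    | D3 i β => exact hSw i β
    | D4 i β j μ =>
      intro a b hab
      -- If `b` is the weak divergence of `a`, then `G* a = -ι* b`, so `S₂ a` is `E` applied to `ι*
      -- b`, whose embedding is `R b`.
      have h1 : S₂ i β j μ a = E (i, β) (ContinuousLinearMap.adjoint ι b) := by
        rw [h.adjoint_embed_of_isWeakDiv (j, μ) hab, map_neg]
        rfl
      rw [h1]
      exact h.isWeakDiv_embed (i, β) (ContinuousLinearMap.adjoint ι b)
  · cases L with
    | id => exact h1n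
    | D1 => exact h1n
    | D2 i β => exact hSn i β
    | D3 i β => exact hSn i β
    | D4 i β j μ => exact hS₂n i β j μ
  · have key (q : X → ℝ) (hq : IsTest d Set.univ q) : mulOp g Λ (fun x => (q x : ℂ)) * R =
        ∑ L, R * T L * mulOp g Λ (fun x => (P.realApplyD g L q x : ℂ)) * R ^ L.exponent := by
      rw [h.mul_resolvent hV hq hR, DLabel.sum_eq]
      simp only [T, DLabel.exponent, PeriodicFrame.realApplyD, pow_zero, pow_one, mul_one,
        Finset.sum_add_distrib, ← add_assoc]
      rfl
    have h2 : mulOp g Λ f = mulOp g Λ (fun x => ((f x).re : ℂ)) +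
        Complex.I • mulOp g Λ (fun x => ((f x).im : ℂ)) := by
      conv_lhs => rw [show f = P.applyD g .id f from rfl, P.applyD_eq]
      exact mulOp_complexify (U := Set.univ) (fun _ hh => hh) hf
    rw [h2, add_mul, smul_mul_assoc, key _ hf.re, key _ hf.im, Finset.smul_sum,
      ← Finset.sum_add_distrib]
    refine Finset.sum_congr rfl fun L _ => ?_
    rw [P.applyD_eq, mulOp_complexify (U := Set.univ) (fun _ hh => hh.realApplyD P g L) hf, mul_add,
      add_mul, mul_smul_comm, smul_mul_assoc]

end CommutatorExpansion

/-! ### Iteration of the commutator expansion -/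

/-- Each round inserts `F` in front of `m f`, commutes `m f` past one resolvent, and is left with `m
(D a f)` before the other resolvents and `e a` new ones. The parameter `s` counts the extra
resolvents, so the induction on `ν` runs for all `s`. The word is reversed because `foldr` applies
the last letter first, while the first label acts first on `f`. -/
theorem iterated_commutator_expansion {α Y A : Type*} [Fintype α] [Ring A] {m : Y → A} {R F : A}
    {T : α → A} {e : α → ℕ} {D : α → Y → Y} {S : Set Y} (hS : ∀ a, ∀ f ∈ S, D a f ∈ S)
    (hF : ∀ f ∈ S, F * m f = m f)
    (hc : ∀ f ∈ S, m f * R = ∑ a, R * T a * m (D a f) * R ^ e a) (ν s : ℕ) {f : Y} (hf : f ∈ S) :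
    m f * R ^ (ν + 1 + s) = ∑ L : Fin ν → α, (List.ofFn fun j => F * R * T (L j)).prod *
      (m ((List.ofFn L).reverse.foldr D f) * R * R ^ (s + ∑ j, e (L j))) := by
  induction ν generalizing s f with
  | zero =>
    rw [Fintype.sum_unique]
    simp [pow_add, mul_assoc]
  | succ ν ih =>
    have h1 : m f * R ^ (ν + 1 + 1 + s) = F * (m f * R) * R ^ (ν + 1 + s) := by
      rw [← mul_assoc F, hF f hf, add_right_comm, pow_succ', ← mul_assoc]
    rw [h1, hc f hf, Finset.mul_sum, Finset.sum_mul, ← (Fin.consEquiv fun _ => α).sum_comp,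
      Fintype.sum_prod_type]
    refine Finset.sum_congr rfl fun a _ => ?_
    have h2 : F * (R * T a * m (D a f) * R ^ e a) * R ^ (ν + 1 + s) =
        F * R * T a * (m (D a f) * R ^ (ν + 1 + (s + e a))) := by
      rw [show ν + 1 + (s + e a) = e a + (ν + 1 + s) by omega, pow_add R (e a)]
      simp only [mul_assoc]
    rw [h2, ih (s + e a) (hS a f hf), Finset.mul_sum]
    refine Finset.sum_congr rfl fun L _ => ?_
    simp [Fin.consEquiv, List.ofFn_succ, Fin.sum_univ_succ, mul_assoc, add_assoc]

theorem norm_pow_le_one {E : Type*} [NormedAddCommGroup E] [NormedSpace ℂ E] {R : E →L[ℂ] E}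
    (hR : ‖R‖ ≤ 1) (l : ℕ) : ‖R ^ l‖ ≤ 1 := by
  cases l with
  | zero => exact ContinuousLinearMap.norm_id_le
  | succ l => exact (norm_pow_le' R l.succ_pos).trans (pow_le_one₀ (norm_nonneg _) hR)

theorem PeriodicAction.isTest_translate {d : ℕ} {X : Type*} [TopologicalSpace X]
    [ChartedSpace (Coord d) X] [IsManifold 𝓘(ℝ, Coord d) (⊤ : ℕ∞) X] {Γ : Type*} [Group Γ]
    [MulAction Γ X] {g₀ : SmoothMetric d X} (hΓ : PeriodicAction Γ g₀) {f : X → ℂ}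
    (hf : IsTest d Set.univ f) (γ : Γ) : IsTest d Set.univ fun x => f (γ⁻¹ • x) :=
  ⟨hf.smooth.comp (hΓ.isometric γ⁻¹).smooth, hf.compact.comp_homeomorph (hΓ.homeo γ⁻¹),
    Set.subset_univ _⟩

end RandomSchroedinger
-- The expansion of `f R^ν` and its uniform bounds.
theorem mainTheorem10 {d : ℕ} {X : Type*} [TopologicalSpace X] [T2Space X]
    [SecondCountableTopology X] [ChartedSpace (RandomSchroedinger.Coord d) X]
    [IsManifold 𝓘(ℝ, RandomSchroedinger.Coord d) (⊤ : ℕ∞) X] [MeasurableSpace X] [BorelSpace X]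
    {Γ : Type*} [Group Γ] [MulAction Γ X] [ProperlyDiscontinuousSMul Γ X]
    [CompactSpace (MulAction.orbitRel.Quotient Γ X)]
    {Ω : Type*} [MeasurableSpace Ω] [MulAction Γ Ω] [MeasurableConstSMul Γ Ω]
    (ℙ : Measure Ω) [IsProbabilityMeasure ℙ] [ErgodicSMul Γ Ω ℙ]
    (g₀ : RandomSchroedinger.SmoothMetric d X)
    (hΓ : RandomSchroedinger.PeriodicAction Γ g₀)
    (g : Ω → RandomSchroedinger.SmoothMetric d X) (V : Ω → X → ℝ)
    (hgV : RandomSchroedinger.RandomFamily Γ g₀ g V)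
    (Q : RandomSchroedinger.Agglomerates Γ g₀)
    (P : RandomSchroedinger.PeriodicFrame Γ g₀) :
    ∃ C₂ : ℝ, ∀ ν : ℕ, 1 ≤ ν →
      ∃ (N : ℕ) (D : Fin N → List (RandomSchroedinger.DLabel d P.n))
        (b : Fin N → Fin ν → RandomSchroedinger.BLabel d P.n) (l : Fin N → Fin ν → ℕ),
        (∀ i, (D i).length = ν - 1) ∧ (∀ i j, l i j ≤ ν - 1) ∧
        ∀ f F : X → ℂ,
          RandomSchroedinger.IsTest d Set.univ f → RandomSchroedinger.IsTest d Set.univ F →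
          (∀ x ∈ tsupport f, F x = 1) →
          ∃ C₁ : ℝ, ∀ (γ : Γ) (ω : Ω) (I : Set Γ),
            ∃ R : RandomSchroedinger.L2 (g ω) (Q.Λ I) →L[ℂ] RandomSchroedinger.L2 (g ω) (Q.Λ I),
              RandomSchroedinger.IsResolvent (g ω) (V ω) (Q.Λ I) R ∧
              ∃ (fs : Fin N → Fin ν → X → ℂ)
                (B : Fin N → Fin ν →
                  (RandomSchroedinger.L2 (g ω) (Q.Λ I) →L[ℂ]
                    RandomSchroedinger.L2 (g ω) (Q.Λ I))),
                (∀ i (j : Fin ν), (j : ℕ) + 1 < ν → fs i j = fun x => F (γ⁻¹ • x)) ∧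
                (∀ i (j : Fin ν), (j : ℕ) + 1 = ν →
                  fs i j = P.applyWord (g ω) (D i) (fun x => f (γ⁻¹ • x))) ∧
                (∀ i j, ∃ T : RandomSchroedinger.L2 (g ω) (Q.Λ I) →L[ℂ]
                    RandomSchroedinger.L2 (g ω) (Q.Λ I),
                  P.IsOpB (g ω) (Q.Λ I) R T (b i j) ∧ B i j = T * R ^ l i j) ∧
                (RandomSchroedinger.mulOp (g ω) (Q.Λ I) (fun x => f (γ⁻¹ • x)) * R ^ ν =
                  ∑ i : Fin N, (List.ofFn fun j : Fin ν =>
                    RandomSchroedinger.mulOp (g ω) (Q.Λ I) (fs i j) * R * B i j).prod) ∧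
                (∀ i j x, ‖fs i j x‖ ≤ C₁) ∧
                (∀ i j, ‖B i j‖ ≤ C₂) := by
  classical
  obtain ⟨C, hC0, hC, -⟩ := hgV.relatively_bounded
  obtain ⟨c', hc0', hc'⟩ := RandomSchroedinger.exists_bound_divg_cut hΓ P hgV.relatively_bounded
    hgV.compatible
  set c := Real.sqrt (C 0) with hc
  have hc0 : 0 ≤ c := Real.sqrt_nonneg _
  have hcsq : c ^ 2 = C 0 := Real.sq_sqrt (hC0 0).le
  -- The derivatives have norm at most `c = √(C 0)` and the divergences at most `c + c'` on the form
  -- domain. The three summands dominate `Id`, `div R` and `div R div`, respectively.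
  refine ⟨1 + (c + c') + (c + c') * c, fun ν hν => ?_⟩
  obtain ⟨n, rfl⟩ : ∃ n, ν = n + 1 := ⟨ν - 1, (Nat.sub_add_cancel hν).symm⟩
  let W := (Fintype.equivFin (Fin n → RandomSchroedinger.DLabel d P.n)).symm
  -- One summand for each word of `n = ν - 1` labels. The first `n` factors carry the operators
  -- attached to the letters, without further resolvents; the last factor carries the identity and
  -- all the resolvents collected.
  refine ⟨Fintype.card (Fin n → RandomSchroedinger.DLabel d P.n),
    fun i => (List.ofFn (W i)).reverse,
    fun i => Fin.snoc (α := fun _ => RandomSchroedinger.BLabel d P.n) (fun j => (W i j).toB) .id,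
    fun i => Fin.snoc (α := fun _ => ℕ) (fun _ => 0) (∑ j, (W i j).exponent), fun i => by simp,
    fun i j => ?_, fun f F hf hF hfF => ?_⟩
  · refine Fin.lastCases ?_ (fun j => ?_) j
    · simp only [Fin.snoc_last]
      -- Each of the `ν - 1` commutations adds at most one resolvent.
      exact (Finset.sum_le_sum fun j _ => (W i j).exponent_le_one).trans (by simp)
    · simp only [Fin.snoc_castSucc]
      exact Nat.zero_le _
  -- The empty word is the identity, so this is the bound for the translates of `F` themselves.
  obtain ⟨K, hK⟩ := RandomSchroedinger.exists_bound_applyWord hΓ P hgV.relatively_bounded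
    hgV.compatible [] hF
  choose K' hK' using fun i => RandomSchroedinger.exists_bound_applyWord hΓ P
    hgV.relatively_bounded hgV.compatible (List.ofFn (W i)).reverse hf
  refine ⟨|K| + ∑ i, |K' i|, fun γ ω I => ?_⟩
  have hVω : RandomSchroedinger.FormPotential (g ω) (V ω) :=
    (hgV.potential_bounded ω).formPotential (hgV.potential_nonneg ω)
      (hgV.potential_measurable.of_uncurry_left (x := ω))
  obtain ⟨R, T, hR, hRn, hT, hTn, hTc⟩ := RandomSchroedinger.exists_resolvent_commutator P hVω
    (Q.Λ I) hc0 (fun x v => by rw [hcsq]; exact (hC ω x v).2) hc0' (fun i β x => hc' i β ω x)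
  have hC1 : 1 ≤ 1 + (c + c') + (c + c') * c := by
    have := mul_nonneg (add_nonneg hc0 hc0') hc0
    linarith
  have hf' := hΓ.isTest_translate hf γ
  have hF' := hΓ.isTest_translate hF γ
  have hfF' : ∀ x ∈ tsupport (fun x => f (γ⁻¹ • x)), F (γ⁻¹ • x) = 1 := fun x hx =>
    hfF _ (tsupport_comp_subset_preimage f (hΓ.isometric γ⁻¹).smooth.continuous hx)
  refine ⟨R, hR, fun i => Fin.snoc (α := fun _ => X → ℂ) (fun _ x => F (γ⁻¹ • x))
      (P.applyWord (g ω) (List.ofFn (W i)).reverse fun x => f (γ⁻¹ • x)),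
    fun i => Fin.snoc (α := fun _ => RandomSchroedinger.L2 (g ω) (Q.Λ I) →L[ℂ]
      RandomSchroedinger.L2 (g ω) (Q.Λ I)) (fun j => T (W i j)) (R ^ ∑ j, (W i j).exponent),
    fun i j hj => ?_, fun i j hj => ?_, fun i j => ?_, ?_, fun i j x => ?_, fun i j => ?_⟩
  · obtain ⟨j, rfl⟩ : ∃ k : Fin n, j = k.castSucc := ⟨⟨j, by omega⟩, rfl⟩
    exact Fin.snoc_castSucc ..
  · obtain rfl : j = Fin.last n := Fin.ext (by simpa using hj)
    exact Fin.snoc_last ..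
  · refine Fin.lastCases ?_ (fun j => ?_) j
    · simp only [Fin.snoc_last]
      exact ⟨1, rfl, (one_mul _).symm⟩
    · simp only [Fin.snoc_castSucc]
      exact ⟨T (W i j), hT _, by rw [pow_zero, mul_one]⟩
  -- The expansion runs within the test functions on whose support the translated `F` is one;
  -- operators in `𝓓` preserve this set because they do not enlarge supports.
  · have key := RandomSchroedinger.iterated_commutator_expansion
      (m := RandomSchroedinger.mulOp (g ω) (Q.Λ I)) (R := R)
      (F := RandomSchroedinger.mulOp (g ω) (Q.Λ I) fun x => F (γ⁻¹ • x)) (T := T)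
      (e := RandomSchroedinger.DLabel.exponent) (D := P.applyD (g ω))
      (S := {h | RandomSchroedinger.IsTest d Set.univ h ∧ ∀ x ∈ tsupport h, F (γ⁻¹ • x) = 1})
      (fun L h hh => ⟨(P.isTest_applyD (g ω) L hh.1).1, fun x hx =>
        hh.2 x ((P.isTest_applyD (g ω) L hh.1).2 hx)⟩)
      (fun h hh => RandomSchroedinger.mulOp_mul hh.1 hF' hh.2) (fun h hh => hTc h hh.1) n 0
      ⟨hf', hfF'⟩
    rw [add_zero] at key
    rw [key, ← W.sum_comp]
    refine Finset.sum_congr rfl fun i _ => ?_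
    rw [List.ofFn_succ', List.concat_eq_append, List.prod_append, List.prod_singleton]
    simp only [Fin.snoc_last, Fin.snoc_castSucc, zero_add]
    rfl
  · refine Fin.lastCases ?_ (fun j => ?_) j
    · simp only [Fin.snoc_last]
      exact (hK' i γ ω x).trans ((le_abs_self _).trans ((Finset.single_le_sum
        (f := fun i => |K' i|) (fun _ _ => abs_nonneg _) (Finset.mem_univ i)).trans
        (le_add_of_nonneg_left (abs_nonneg _))))
    · simp only [Fin.snoc_castSucc]
      exact (hK γ ω x).trans ((le_abs_self _).trans
        (le_add_of_nonneg_right (Finset.sum_nonneg fun _ _ => abs_nonneg _)))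
  · refine Fin.lastCases ?_ (fun j => ?_) j
    · simp only [Fin.snoc_last]
      exact (RandomSchroedinger.norm_pow_le_one hRn _).trans hC1
    · simp only [Fin.snoc_castSucc]
      exact hTn _
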